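/- Let $d\ge 2$, let $\theta$ be a real skew symmetric $d\times d$ matrix, and let $\mathbb{T}^d_\theta$ be the quantum $d$-torus: the von Neumann algebra generated by unitaries $U_1,\dots,U_d$ with $U_kU_j=e^{2\pi i\theta_{kj}}U_jU_k$, in the GNS representation of the trace $\tau$ determined by $\tau(\sum_m a_mU^m)=a_0$, where $U^m=U_1^{m_1}\cdots U_d^{m_d}$ for $m\in\mathbb{Z}^d$. For $1\le p<\infty$ let $L_p(\mathbb{T}^d_\theta)$ be the completion of $\mathbb{T}^d_\theta$ for the norm $\|x\|_p=\tau(|x|^p)^{1/p}$, and let $L_\infty(\mathbb{T}^d_\theta)=\mathbb{T}^d_\theta$ with the operator norm. Let $\mathcal{S}(\mathbb{T}^d_\theta)=\{\sum_m a_mU^m:(a_m)\text{ rapidly decreasing}\}$ with the topology given by the norms $\max_{|m|_1\le k}\|D^mx\|_\infty$, $k\ge 0$, where $D^m=\partial_1^{m_1}\cdots\partial_d^{m_d}$ for $m\in\mathbb{N}_0^d$ and $\partial_jU^n=2\pi i\,n_jU^n$. Let $\mathcal{S}'(\mathbb{T}^d_\theta)$ be the space of continuous linear functionals on $\mathcal{S}(\mathbb{T}^d_\theta)$,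 which contains $L_p(\mathbb{T}^d_\theta)$ via $y\mapsto\tau(y\,\cdot)$ and to which the $\partial_j$ extend by $\langle\partial_jF,x\rangle=-\langle F,\partial_jx\rangle$. For a positive integer $k$ put $$W^k_p(\mathbb{T}^d_\theta)=\{x\in\mathcal{S}'(\mathbb{T}^d_\theta): D^mx\in L_p(\mathbb{T}^d_\theta)\ \text{for all } m\in\mathbb{N}_0^d,\ |m|_1\le k\},\qquad |x|_{W^k_p}=\Big(\sum_{|m|_1=k}\|D^mx\|_p^p\Big)^{1/p},$$ with the maximum in place of the sum when $p=\infty$. For $u\in\mathbb{R}^d$ let $T_u$ be the Fourier multiplier $U^n\mapsto e^{2\pi i u\cdot n}U^n$, let $\Delta_u=T_u-1$, and let $$\omega^k_p(x,\varepsilon)=\sup_{0<|u|\le\varepsilon}\|\Delta_u^kx\|_p,\qquad \|x\|_{B^{\alpha,\omega}_{p,q}}=\Big(\int_0^1\varepsilon^{-\alpha q}\,\omega^k_p(x,\varepsilon)^q\,\frac{d\varepsilon}{\varepsilon}\Big)^{1/q},$$ where $|u|$ is the Euclidean norm. **Theorem.** For all integers $d\ge2$ and $k\ge1$ there are constants $c,C>0$,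 depending only on $d$ and $k$, such that for every real skew symmetric $d\times d$ matrix $\theta$, all $1\le p\le\infty$ and $1\le q<\infty$, and every $x\in W^k_p(\mathbb{T}^d_\theta)$: $\|x\|_{B^{\alpha,\omega}_{p,q}}<\infty$ for all $0<\alpha<k$, the limit below exists and is finite, and $$c\,q^{-1/q}\,|x|_{W^k_p}\ \le\ \lim_{\alpha\to k^-}(k-\alpha)^{1/q}\,\|x\|_{B^{\alpha,\omega}_{p,q}}\ \le\ C\,q^{-1/q}\,|x|_{W^k_p}.$$ -/

import Mathlib

open Filter Topology MeasureTheory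
open scoped ENNReal NNReal InnerProductSpace

noncomputable section

namespace QuantumTorus

/-! ### The quantum torus and its trace -/

/-- The Hilbert space `ℓ²(ℤ^d)`.  It is the GNS space of the canonical trace of the rotation algebra
`A_θ`: the class of the monomial `U^m` is the basis vector at `m`. -/
abbrev Hilb (d : ℕ) : Type := lp (fun _ : Fin d → ℤ => ℂ) 2

/-- The phase `e^{2πi ∑_{l<j} θ_{jl} m_l}`; moving `U_j` past `U_1^{m_1} ⋯ U_{j-1}^{m_{j-1}}`
produces exactly this factor, so that `U_j U^m = phase θ j m • U^{m + e_j}`. -/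
def phase {d : ℕ} (θ : Matrix (Fin d) (Fin d) ℝ) (j : Fin d) (m : Fin d → ℤ) : ℂ :=
  Complex.exp (((2 * Real.pi * ∑ l ∈ Finset.univ.filter (· < j), θ j l * (m l : ℝ) : ℝ) : ℂ)
    * Complex.I)

lemma norm_phase {d : ℕ} (θ : Matrix (Fin d) (Fin d) ℝ) (j : Fin d) (m : Fin d → ℤ) :
    ‖phase θ j m‖ = 1 := by
  rw [phase, Complex.norm_exp_ofReal_mul_I]

/-- A permutation of the index set composed with a unimodular weight is a unitary of `ℓ²(ℤ^d)`:
`(weightedPerm σ c f) n = c n * f (σ n)`. -/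
def weightedPerm {d : ℕ} (σ : Equiv.Perm (Fin d → ℤ)) (c : (Fin d → ℤ) → ℂ)
    (hc : ∀ n, ‖c n‖ = 1) : Hilb d ≃ₗᵢ[ℂ] Hilb d where
  toFun f := ⟨fun n => c n * f (σ n), by
    refine memℓp_gen ?_
    simp only [norm_mul, hc, one_mul]
    exact (σ.summable_iff (f := fun n => ‖f n‖ ^ (2 : ℝ≥0∞).toReal)).2
      ((lp.memℓp f).summable (by norm_num))⟩
  invFun f := ⟨fun n => (c (σ.symm n))⁻¹ * f (σ.symm n), by
    refine memℓp_gen ?_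
    simp only [norm_mul, norm_inv, hc, inv_one, one_mul]
    exact (σ.symm.summable_iff (f := fun n => ‖f n‖ ^ (2 : ℝ≥0∞).toReal)).2
      ((lp.memℓp f).summable (by norm_num))⟩
  map_add' f g := by
    ext n
    exact mul_add _ _ _
  map_smul' a f := by
    ext n
    simp [mul_left_comm]
  left_inv f := by
    ext n
    have h : c (σ.symm n) ≠ 0 := fun h => by simpa [h] using hc (σ.symm n)
    simp [h]
  right_inv f := by
    ext n
    have h : c n ≠ 0 := fun h => by simpa [h] using hc n
    simp [h]
  norm_map' f := by
    have h2 : 0 < (2 : ℝ≥0∞).toReal := by norm_num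
    rw [lp.norm_eq_tsum_rpow h2, lp.norm_eq_tsum_rpow h2]
    congr 1
    simp only [LinearEquiv.coe_mk, LinearMap.coe_mk, AddHom.coe_mk, norm_mul, hc, one_mul]
    exact σ.tsum_eq (fun n => ‖f n‖ ^ (2 : ℝ≥0∞).toReal)

/-- The generating unitary `U_j`, sending the basis vector at `m` to `phase θ j m` times the basis
vector at `m + e_j`.  For skew symmetric `θ` these satisfy `U_k U_j = e^{2πi θ_{kj}} U_j U_k`. -/
def gen {d : ℕ} (θ : Matrix (Fin d) (Fin d) ℝ) (j : Fin d) : Hilb d ≃ₗᵢ[ℂ] Hilb d :=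
  weightedPerm (Equiv.subRight (Pi.single j (1 : ℤ)))
    (fun n => phase θ j (n - Pi.single j (1 : ℤ))) (fun _ => norm_phase _ _ _)

/-- The bounded operators on `ℓ²(ℤ^d)`. -/
abbrev Op (d : ℕ) : Type := Hilb d →L[ℂ] Hilb d

/-- The operator `U^m = U_1^{m_1} ⋯ U_d^{m_d}`. -/
def monomial {d : ℕ} (θ : Matrix (Fin d) (Fin d) ℝ) (m : Fin d → ℤ) : Op d :=
  (((List.ofFn fun j => gen θ j ^ m j).prod : Hilb d ≃ₗᵢ[ℂ] Hilb d) : Hilb d →L[ℂ] Hilb d)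

/-- The quantum torus `𝕋^d_θ`: the von Neumann algebra generated by `U_1, …, U_d` in the GNS
representation of the trace, i.e. the double commutant of `{U_j} ∪ {U_j^*}`. -/
def torus {d : ℕ} (θ : Matrix (Fin d) (Fin d) ℝ) : VonNeumannAlgebra (Hilb d) where
  toStarSubalgebra := StarSubalgebra.centralizer ℂ
    (StarSubalgebra.centralizer ℂ
      (Set.range fun j => ((gen θ j : Hilb d ≃ₗᵢ[ℂ] Hilb d) : Op d)) : Set (Op d))
  centralizer_centralizer' := by
    simp

/-- The canonical trace `τ(y) = ⟨U^0, y U^0⟩` (a functional on all bounded operators, which is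
used on `𝕋^d_θ` only, where it is the normal faithful tracial state with `τ(U^m) = δ_{m,0}`). -/
def trace {d : ℕ} (y : Op d) : ℂ :=
  ⟪lp.single 2 (0 : Fin d → ℤ) (1 : ℂ), y (lp.single 2 (0 : Fin d → ℤ) (1 : ℂ))⟫_ℂ

/-- The power `|y|^p`, `|y| = (y^* y)^{1/2}`, of the absolute value of a bounded operator on a Hilbert
space, by continuous functional calculus. -/
def absPow {H : Type*} [NormedAddCommGroup H] [InnerProductSpace ℂ H] [CompleteSpace H]
    (y : H →L[ℂ] H) (p : ℝ) : H →L[ℂ] H :=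
  CFC.abs y ^ p

/-- For `y` in the quantum torus: `‖y‖_p = τ(|y|^p)^{1/p}` for `p < ∞`, and the operator norm for
`p = ∞`. -/
def opLpNorm {d : ℕ} (p : ℝ≥0∞) (y : Op d) : ℝ :=
  if p = ∞ then ‖y‖ else (trace (absPow y p.toReal)).re ^ (1 / p.toReal)

/-! ### Smooth elements and distributions -/

/-- Rapidly decreasing families `(a_n)` indexed by `ℤ^d`.  They parametrise the smooth algebra
`𝒮(𝕋^d_θ) = {∑ a_n U^n : (a_n) rapidly decreasing}`; the element itself is `toOp θ a`. -/
def Smooth (d : ℕ) : Submodule ℂ ((Fin d → ℤ) → ℂ) where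
  carrier := {a | ∀ N : ℕ, ∃ C : ℝ, ∀ n, (1 + ‖n‖) ^ N * ‖a n‖ ≤ C}
  add_mem' {a b} ha hb N := by
    obtain ⟨A, hA⟩ := ha N
    obtain ⟨B, hB⟩ := hb N
    refine ⟨A + B, fun n => ?_⟩
    calc (1 + ‖n‖) ^ N * ‖(a + b) n‖ ≤ (1 + ‖n‖) ^ N * (‖a n‖ + ‖b n‖) := by
          gcongr
          exact norm_add_le _ _
      _ ≤ A + B := by
          rw [mul_add]
          exact add_le_add (hA n) (hB n)
  zero_mem' N := ⟨0, fun n => by simp⟩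
  smul_mem' c a ha N := by
    obtain ⟨A, hA⟩ := ha N
    refine ⟨‖c‖ * A, fun n => ?_⟩
    calc (1 + ‖n‖) ^ N * ‖(c • a) n‖ = ‖c‖ * ((1 + ‖n‖) ^ N * ‖a n‖) := by
          simp [mul_left_comm]
      _ ≤ ‖c‖ * A := by
          gcongr
          exact hA n

/-- The operator `∑ a_n U^n` (an absolutely convergent series in operator norm). -/
def toOp {d : ℕ} (θ : Matrix (Fin d) (Fin d) ℝ) (a : Smooth d) : Op d :=
  ∑' n : Fin d → ℤ, a.1 n • monomial θ n

/-- The derivation `∂_j` of `𝒮(𝕋^d_θ)`: `∂_j U^n = 2πi n_j U^n`. -/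
def partialDeriv {d : ℕ} (j : Fin d) : Smooth d →ₗ[ℂ] Smooth d where
  toFun a := ⟨fun n => 2 * Real.pi * Complex.I * (n j : ℂ) * a.1 n, fun N => by
    obtain ⟨A, hA⟩ := a.2 (N + 1)
    refine ⟨2 * Real.pi * A, fun n => ?_⟩
    have h1 : ‖(n j : ℂ)‖ ≤ 1 + ‖n‖ := by
      rw [Complex.norm_intCast, ← Int.norm_eq_abs]
      linarith [norm_le_pi_norm n j]
    have h2 : ‖(2 * Real.pi * Complex.I * (n j : ℂ) * a.1 n : ℂ)‖
        = 2 * Real.pi * ‖(n j : ℂ)‖ * ‖a.1 n‖ := by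
      simp [abs_of_pos Real.pi_pos]
    rw [h2]
    calc (1 + ‖n‖) ^ N * (2 * Real.pi * ‖(n j : ℂ)‖ * ‖a.1 n‖)
        ≤ (1 + ‖n‖) ^ N * (2 * Real.pi * (1 + ‖n‖) * ‖a.1 n‖) := by gcongr
      _ = 2 * Real.pi * ((1 + ‖n‖) ^ (N + 1) * ‖a.1 n‖) := by ring
      _ ≤ 2 * Real.pi * A := by
          gcongr
          exact hA n⟩
  map_add' a b := by
    ext n
    simp [mul_add]
  map_smul' c a := by
    ext n
    simp [mul_left_comm]

/-- The partial derivation `D^m = ∂_1^{m_1} ⋯ ∂_d^{m_d}` on `𝒮(𝕋^d_θ)`. -/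
def derivMulti {d : ℕ} (m : Fin d → ℕ) : Module.End ℂ (Smooth d) :=
  (List.ofFn fun j => (partialDeriv j : Module.End ℂ (Smooth d)) ^ m j).prod

/-- The character `e_u(n) = e^{2πi u·n}`. -/
def torusChar {d : ℕ} (u : EuclideanSpace ℝ (Fin d)) (n : Fin d → ℤ) : ℂ :=
  Complex.exp (((2 * Real.pi * ∑ j, u j * (n j : ℝ) : ℝ) : ℂ) * Complex.I)

/-- The translation `T_u` of `𝒮(𝕋^d_θ)`: `T_u U^n = e^{2πi u·n} U^n`. -/
def translate {d : ℕ} (u : EuclideanSpace ℝ (Fin d)) : Smooth d →ₗ[ℂ] Smooth d where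
  toFun a := ⟨fun n => torusChar u n * a.1 n, fun N => by
    obtain ⟨A, hA⟩ := a.2 N
    refine ⟨A, fun n => ?_⟩
    rw [norm_mul, torusChar, Complex.norm_exp_ofReal_mul_I, one_mul]
    exact hA n⟩
  map_add' a b := by
    ext n
    simp [mul_add]
  map_smul' c a := by
    ext n
    simp [mul_left_comm]

/-- The norm `p_k(a) = max_{|m|₁ ≤ k} ‖D^m a‖_∞` on `𝒮(𝕋^d_θ)`. -/
def smoothNorm {d : ℕ} (θ : Matrix (Fin d) (Fin d) ℝ) (k : ℕ) (a : Smooth d) : ℝ≥0 :=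
  (Finset.range (k + 1)).sup fun i =>
    (Finset.piAntidiag (Finset.univ : Finset (Fin d)) i).sup fun m => ‖toOp θ (derivMulti m a)‖₊

/-- Linear functionals on `𝒮(𝕋^d_θ)`. -/
abbrev Functional (d : ℕ) : Type := Smooth d →ₗ[ℂ] ℂ

/-- A functional is a distribution on `𝕋^d_θ` if it is continuous for the topology defined by the
increasing family of norms `p_k`. -/
def IsDistribution {d : ℕ} (θ : Matrix (Fin d) (Fin d) ℝ) (F : Functional d) : Prop :=
  ∃ (k : ℕ) (C : ℝ≥0), ∀ a, ‖F a‖ ≤ C * smoothNorm θ k a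

/-- `⟨∂_j F, a⟩ = -⟨F, ∂_j a⟩`. -/
def distDeriv {d : ℕ} (j : Fin d) : Module.End ℂ (Functional d) where
  toFun F := -(F ∘ₗ partialDeriv j)
  map_add' F G := by
    ext a
    simp [add_comm]
  map_smul' c F := by
    ext a
    simp

/-- `D^m = ∂_1^{m_1} ⋯ ∂_d^{m_d}` on distributions. -/
def distDerivMulti {d : ℕ} (m : Fin d → ℕ) : Module.End ℂ (Functional d) :=
  (List.ofFn fun j => distDeriv j ^ m j).prod

/-- The translation `T_u` on distributions, `⟨T_u F, a⟩ = ⟨F, T_{-u} a⟩`; it is the Fourier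
multiplier with symbol `e_u` and extends the automorphism `U^n ↦ e^{2πi u·n} U^n`. -/
def distTranslate {d : ℕ} (u : EuclideanSpace ℝ (Fin d)) : Module.End ℂ (Functional d) where
  toFun F := F ∘ₗ translate (-u)
  map_add' _ _ := rfl
  map_smul' _ _ := rfl

/-- The difference operator `Δ_u = T_u - 1`. -/
def difference {d : ℕ} (u : EuclideanSpace ℝ (Fin d)) : Module.End ℂ (Functional d) :=
  distTranslate u - 1

/-! ### Noncommutative `L_p`-spaces, Sobolev spaces and Besov norms -/

/-- `y` is a sequence in `𝕋^d_θ` which is Cauchy in `‖·‖_p` and whose associated functionals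
`a ↦ τ(y_i a)` converge to `F`.  Thus the class of `y` in the completion of `(𝕋^d_θ, ‖·‖_p)` is `F`,
under the natural embedding of this completion in the space of distributions. -/
structure Represents {d : ℕ} (θ : Matrix (Fin d) (Fin d) ℝ) (p : ℝ≥0∞) (y : ℕ → Op d)
    (F : Functional d) : Prop where
  mem : ∀ i, y i ∈ torus θ
  cauchy : ∀ ε > 0, ∃ N, ∀ i ≥ N, ∀ j ≥ N, opLpNorm p (y i - y j) < ε
  tendsto : ∀ a, Tendsto (fun i => trace (y i * toOp θ a)) atTop (𝓝 (F a))

/-- `F ∈ L_p(𝕋^d_θ)`: `L_p(𝕋^d_θ)` is the completion of `(𝕋^d_θ, ‖·‖_p)` (for `p = ∞`, this is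
`𝕋^d_θ` itself), regarded as a space of distributions via `y ↦ τ(y ·)`. -/
def MemNCLp {d : ℕ} (θ : Matrix (Fin d) (Fin d) ℝ) (p : ℝ≥0∞) (F : Functional d) : Prop :=
  ∃ y, Represents θ p y F

/-- The norm of `F` in `L_p(𝕋^d_θ)`, i.e. `lim ‖y_i‖_p` for any sequence `y` representing `F`; it
is `∞` if `F ∉ L_p(𝕋^d_θ)`. -/
def ncLpNorm {d : ℕ} (θ : Matrix (Fin d) (Fin d) ℝ) (p : ℝ≥0∞) (F : Functional d) : ℝ≥0∞ :=
  ⨅ (y : ℕ → Op d) (_ : Represents θ p y F),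
    limsup (fun i => ENNReal.ofReal (opLpNorm p (y i))) atTop

/-- The Sobolev space `W^k_p(𝕋^d_θ)`: the distributions `x` with `D^m x ∈ L_p(𝕋^d_θ)` for all
`|m|₁ ≤ k`. -/
structure MemSobolev {d : ℕ} (θ : Matrix (Fin d) (Fin d) ℝ) (k : ℕ) (p : ℝ≥0∞)
    (x : Functional d) : Prop where
  isDistribution : IsDistribution θ x
  memNCLp : ∀ m : Fin d → ℕ, ∑ j, m j ≤ k → MemNCLp θ p (distDerivMulti m x)

/-- The homogeneous seminorm `|x|_{W^k_p} = (∑_{|m|₁ = k} ‖D^m x‖_p^p)^{1/p}`, with the maximum in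
place of the sum if `p = ∞`. -/
def sobolevSeminorm {d : ℕ} (θ : Matrix (Fin d) (Fin d) ℝ) (k : ℕ) (p : ℝ≥0∞)
    (x : Functional d) : ℝ≥0∞ :=
  if p = ∞ then
    (Finset.piAntidiag (Finset.univ : Finset (Fin d)) k).sup fun m =>
      ncLpNorm θ p (distDerivMulti m x)
  else
    (∑ m ∈ Finset.piAntidiag (Finset.univ : Finset (Fin d)) k,
      ncLpNorm θ p (distDerivMulti m x) ^ p.toReal) ^ (1 / p.toReal)

/-- The modulus of smoothness `ω^k_p(x, ε) = sup_{0 < |u| ≤ ε} ‖Δ_u^k x‖_p`. -/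
def modulus {d : ℕ} (θ : Matrix (Fin d) (Fin d) ℝ) (k : ℕ) (p : ℝ≥0∞) (x : Functional d)
    (ε : ℝ) : ℝ≥0∞ :=
  ⨆ (u : EuclideanSpace ℝ (Fin d)) (_ : 0 < ‖u‖ ∧ ‖u‖ ≤ ε), ncLpNorm θ p ((difference u ^ k) x)

/-- `‖x‖_{B^{α,ω}_{p,q}} = (∫_0^1 ε^{-αq} ω^k_p(x, ε)^q dε/ε)^{1/q}`. -/
def besovNorm {d : ℕ} (θ : Matrix (Fin d) (Fin d) ℝ) (k : ℕ) (p : ℝ≥0∞) (q α : ℝ)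
    (x : Functional d) : ℝ≥0∞ :=
  (∫⁻ ε in Set.Ioo (0 : ℝ) 1,
    ENNReal.ofReal (ε ^ (-(α * q))) * modulus θ k p x ε ^ q * ENNReal.ofReal ε⁻¹) ^ (1 / q)

end QuantumTorus

end

/-! The limit equals L q^{-1/q}, where L is the supremum of ω(ε)/ε^k over 0 < ε ≤ 1. The modulus ω
is increasing, and Δ_{mu} = (1 + T_u + … + T_u^{m-1}) Δ_u with isometric T_u gives ω(mε) ≤ m^k ω(ε)
(`modulus_nat_mul_le`). These two facts force ω(ε)/ε^k → L as ε → 0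
(`exists_forall_lt_of_mono_of_nat_mul_le`). Since ∫_0^r ε^{(k-α)q-1} dε = r^{(k-α)q}/((k-α)q), the
factor (k-α)^{1/q} cancels the singularity at α = k, and r^{k-α} → 1 shows that only small ε matter
(`tendsto_besovNorm`).

It remains to compare L with the Sobolev seminorm, with constants free of θ, p and q. For L from
above, each factor of Δ_u^k is replaced by the directional derivation ∂_u through the mean value
inequality, and ∂_u^k is expanded by the multinomial theorem
(`MemSobolev.ncLpNorm_difference_pow_le`). For L from below, t^{-k} Δ_{tu}^k tends to ∂_u^k as t →
0, and polarization writes k! D^m as a signed sum of 2^k powers ∂_u^k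
(`MemSobolev.ncLpNorm_distDerivMulti_le`).

All these estimates are made by duality: for F in L_p, ‖F‖_p is the least C ≥ 0 with |F(a)| ≤ C
‖a‖_{p'} for every smooth a, p' being the conjugate exponent (`ncLpNorm_le_iff`). Only scalar mean
values and scalar limits are then needed, and p = ∞ is no exception. The duality rests on three
facts: Hölder's inequality, proved by the three lines theorem for τ(v a^{p(1-z)} w b^{p'z});
explicit elements that almost attain it, with a separate density argument for p = ∞; and Fejér
means, which reduce testing on the whole algebra to testing on smooth elements. -/

noncomputable section

set_option linter.unusedSectionVars false

section

namespace QuantumTorus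

variable {d : ℕ}

/-! ### The standard basis and the commutant of the quantum torus -/

/-- The standard basis vector of `ℓ²(ℤ^d)` at `n`. -/
def basisVec (n : Fin d → ℤ) : Hilb d := lp.single 2 n (1 : ℂ)

lemma basisVec_apply (n k : Fin d → ℤ) : basisVec n k = if k = n then 1 else 0 := by
  rw [basisVec, lp.coeFn_single, Pi.single_apply]

lemma inner_basisVec (n : Fin d → ℤ) (f : Hilb d) : ⟪basisVec n, f⟫_ℂ = f n := by
  rw [basisVec, lp.inner_single_left]
  simp

lemma trace_eq_inner (y : Op d) : trace y = ⟪basisVec 0, y (basisVec 0)⟫_ℂ := rfl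

lemma trace_mul_eq_inner (x y : Op d) :
    trace (x * y) = ⟪star x (basisVec 0), y (basisVec 0)⟫_ℂ := by
  rw [trace_eq_inner, ContinuousLinearMap.star_eq_adjoint, ContinuousLinearMap.adjoint_inner_left]
  rfl

/-- The trace as a bounded linear functional. -/
def traceCLM : Op d →L[ℂ] ℂ :=
  (innerSL ℂ (basisVec (0 : Fin d → ℤ))).comp
    (ContinuousLinearMap.apply ℂ (Hilb d) (basisVec (0 : Fin d → ℤ)))

lemma traceCLM_apply (y : Op d) : traceCLM y = trace y := rfl

lemma trace_add (x y : Op d) : trace (x + y) = trace x + trace y := by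
  simp only [← traceCLM_apply, map_add]

lemma trace_sub (x y : Op d) : trace (x - y) = trace x - trace y := by
  simp only [← traceCLM_apply, map_sub]

lemma trace_smul (c : ℂ) (x : Op d) : trace (c • x) = c * trace x := by
  simp only [← traceCLM_apply, map_smul, smul_eq_mul]

lemma weightedPerm_apply (σ : Equiv.Perm (Fin d → ℤ)) (c : (Fin d → ℤ) → ℂ) (hc : ∀ n, ‖c n‖ = 1)
    (f : Hilb d) (n : Fin d → ℤ) : weightedPerm σ c hc f n = c n * f (σ n) := rfl

lemma weightedPerm_basisVec (σ : Equiv.Perm (Fin d → ℤ)) (c : (Fin d → ℤ) → ℂ)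
    (hc : ∀ n, ‖c n‖ = 1) (m : Fin d → ℤ) :
    weightedPerm σ c hc (basisVec m) = c (σ.symm m) • basisVec (σ.symm m) := by
  ext n
  rw [weightedPerm_apply, lp.coeFn_smul, Pi.smul_apply, basisVec_apply, basisVec_apply]
  by_cases h : σ n = m
  · simp [← h]
  · rw [if_neg h, if_neg fun h' => h (by simp [h']), mul_zero, smul_zero]

lemma gen_apply (θ : Matrix (Fin d) (Fin d) ℝ) (j : Fin d) (f : Hilb d) (n : Fin d → ℤ) :
    gen θ j f n = phase θ j (n - Pi.single j 1) * f (n - Pi.single j 1) := rfl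

lemma gen_basisVec (θ : Matrix (Fin d) (Fin d) ℝ) (j : Fin d) (m : Fin d → ℤ) :
    gen θ j (basisVec m) = phase θ j m • basisVec (m + Pi.single j 1) := by
  rw [gen, weightedPerm_basisVec]
  simp

/-- The generator `U_j` as a bounded operator. -/
abbrev genOp (θ : Matrix (Fin d) (Fin d) ℝ) (j : Fin d) : Op d :=
  ((gen θ j : Hilb d ≃ₗᵢ[ℂ] Hilb d) : Op d)

lemma star_isometryEquiv (e : Hilb d ≃ₗᵢ[ℂ] Hilb d) :
    star (e : Op d) = (e.symm : Op d) := by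
  rw [ContinuousLinearMap.star_eq_adjoint]
  exact LinearIsometryEquiv.adjoint_eq_symm e

lemma isometryEquiv_mul_symm (e : Hilb d ≃ₗᵢ[ℂ] Hilb d) :
    (e : Op d) * (e.symm : Op d) = 1 := by
  ext1 f
  exact e.apply_symm_apply f

lemma isometryEquiv_symm_mul (e : Hilb d ≃ₗᵢ[ℂ] Hilb d) :
    (e.symm : Op d) * (e : Op d) = 1 := by
  ext1 f
  exact e.symm_apply_apply f

lemma isometryEquiv_mem_unitary (e : Hilb d ≃ₗᵢ[ℂ] Hilb d) : (e : Op d) ∈ unitary (Op d) := by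
  rw [Unitary.mem_iff, star_isometryEquiv]
  exact ⟨isometryEquiv_symm_mul e, isometryEquiv_mul_symm e⟩

/-- An operator commuting with all generators lies in the commutant of the quantum torus. -/
lemma commute_of_mem_torus {θ : Matrix (Fin d) (Fin d) ℝ} {y c : Op d} (hy : y ∈ torus θ)
    (hc : ∀ j, genOp θ j * c = c * genOp θ j) : c * y = y * c := by
  have hy' : y ∈ StarSubalgebra.centralizer ℂ (StarSubalgebra.centralizer ℂ
      (Set.range fun j => genOp θ j) : Set (Op d)) := hy
  refine ((StarSubalgebra.mem_centralizer_iff ℂ).1 hy' c ?_).1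
  refine (StarSubalgebra.mem_centralizer_iff ℂ).2 ?_
  rintro _ ⟨j, rfl⟩
  refine ⟨hc j, ?_⟩
  have h1 := Unitary.star_mul_self_of_mem (isometryEquiv_mem_unitary (gen θ j))
  have h2 := Unitary.mul_star_self_of_mem (isometryEquiv_mem_unitary (gen θ j))
  calc star (genOp θ j) * c = star (genOp θ j) * c * (genOp θ j * star (genOp θ j)) := by
        rw [h2, mul_one]
    _ = star (genOp θ j) * (c * genOp θ j) * star (genOp θ j) := by simp only [mul_assoc]
    _ = star (genOp θ j) * genOp θ j * c * star (genOp θ j) := by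
        rw [← hc j]; simp only [mul_assoc]
    _ = c * star (genOp θ j) := by rw [h1, one_mul]

/-- Testing without adjoints suffices because the commutant of the generators and their adjoints is
closed under the star operation. -/
lemma mem_torus_of_commute {θ : Matrix (Fin d) (Fin d) ℝ} {y : Op d}
    (hy : ∀ c : Op d, (∀ j, genOp θ j * c = c * genOp θ j) → c * y = y * c) : y ∈ torus θ := by
  change y ∈ StarSubalgebra.centralizer ℂ (StarSubalgebra.centralizer ℂ
      (Set.range fun j => genOp θ j) : Set (Op d))
  refine (StarSubalgebra.mem_centralizer_iff ℂ).2 fun c hc => ?_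
  have key : ∀ c ∈ StarSubalgebra.centralizer ℂ (Set.range fun j => genOp θ j), c * y = y * c :=
    fun c hc => hy c fun j => ((StarSubalgebra.mem_centralizer_iff ℂ).1 hc _ ⟨j, rfl⟩).1
  exact ⟨key c hc, key _ (star_mem hc)⟩

lemma genOp_mem_torus (θ : Matrix (Fin d) (Fin d) ℝ) (j : Fin d) : genOp θ j ∈ torus θ :=
  mem_torus_of_commute fun _ hc => (hc j).symm

lemma smul_mem_torus {θ : Matrix (Fin d) (Fin d) ℝ} {y : Op d} (c : ℂ) (hy : y ∈ torus θ) :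
    c • y ∈ torus θ :=
  (torus θ).toStarSubalgebra.smul_mem hy c

lemma isClosed_torus (θ : Matrix (Fin d) (Fin d) ℝ) : IsClosed (torus θ : Set (Op d)) := by
  rw [← VonNeumannAlgebra.centralizer_centralizer]
  exact Set.isClosed_centralizer _

/-! ### Right multiplications and the trace property -/

/-- The phase `e^{2πi ∑_{j<l} θ_{lj} m_l n_j}` of the right multiplication by `U^n`. -/
def rightPhase (θ : Matrix (Fin d) (Fin d) ℝ) (m n : Fin d → ℤ) : ℂ :=
  Complex.exp (((2 * Real.pi * ∑ l, (m l : ℝ) *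
    ∑ j ∈ Finset.univ.filter (· < l), θ l j * (n j : ℝ) : ℝ) : ℂ) * Complex.I)

lemma norm_rightPhase (θ : Matrix (Fin d) (Fin d) ℝ) (m n : Fin d → ℤ) :
    ‖rightPhase θ m n‖ = 1 := by
  rw [rightPhase, Complex.norm_exp_ofReal_mul_I]

lemma rightPhase_zero_left (θ : Matrix (Fin d) (Fin d) ℝ) (n : Fin d → ℤ) :
    rightPhase θ 0 n = 1 := by
  simp [rightPhase]

lemma rightPhase_neg_neg (θ : Matrix (Fin d) (Fin d) ℝ) (m n : Fin d → ℤ) :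
    rightPhase θ (-m) (-n) = rightPhase θ m n := by
  simp [rightPhase, Finset.sum_neg_distrib]

/-- This is associativity, U_k (U^m U^n) = (U_k U^m) U^n, read off from the phases. It is what makes
right multiplications commute with the generators. -/
lemma phase_mul_rightPhase (θ : Matrix (Fin d) (Fin d) ℝ) (k : Fin d) (m n : Fin d → ℤ) :
    phase θ k (m + n) * rightPhase θ m n = rightPhase θ (m + Pi.single k 1) n * phase θ k m := by
  rw [phase, rightPhase, rightPhase, phase, ← Complex.exp_add, ← Complex.exp_add, ← add_mul,
    ← add_mul, ← Complex.ofReal_add, ← Complex.ofReal_add, ← mul_add, ← mul_add]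
  refine congrArg (fun t : ℝ => Complex.exp (((2 * Real.pi * t : ℝ) : ℂ) * Complex.I)) ?_
  simp only [Pi.add_apply, Int.cast_add, mul_add, add_mul, Finset.sum_add_distrib]
  have : ∑ l, (((Pi.single k 1 : Fin d → ℤ) l : ℤ) : ℝ) *
      ∑ j ∈ Finset.univ.filter (· < l), θ l j * (n j : ℝ)
      = ∑ j ∈ Finset.univ.filter (· < k), θ k j * (n j : ℝ) := by
    rw [Finset.sum_eq_single k]
    · simp
    · intro l _ hl
      simp [hl]
    · simp
  rw [this]
  ring

/-- Right multiplication by `U^n`, a unitary in the commutant of the quantum torus. -/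
def rightMul (θ : Matrix (Fin d) (Fin d) ℝ) (n : Fin d → ℤ) : Hilb d ≃ₗᵢ[ℂ] Hilb d :=
  weightedPerm (Equiv.subRight n) (fun k => rightPhase θ (k - n) n) fun _ => norm_rightPhase _ _ _

lemma rightMul_apply (θ : Matrix (Fin d) (Fin d) ℝ) (n : Fin d → ℤ) (f : Hilb d)
    (k : Fin d → ℤ) : rightMul θ n f k = rightPhase θ (k - n) n * f (k - n) := rfl

lemma rightMul_basisVec_zero (θ : Matrix (Fin d) (Fin d) ℝ) (n : Fin d → ℤ) :
    rightMul θ n (basisVec 0) = basisVec n := by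
  rw [rightMul, weightedPerm_basisVec]
  simp [rightPhase_zero_left]

lemma genOp_mul_rightMul (θ : Matrix (Fin d) (Fin d) ℝ) (j : Fin d) (n : Fin d → ℤ) :
    genOp θ j * (rightMul θ n : Op d) = (rightMul θ n : Op d) * genOp θ j := by
  ext f k
  change gen θ j (rightMul θ n f) k = rightMul θ n (gen θ j f) k
  rw [gen_apply, rightMul_apply, rightMul_apply, gen_apply, ← mul_assoc, ← mul_assoc]
  have := phase_mul_rightPhase θ j (k - n - Pi.single j 1) n
  rw [sub_add_cancel] at this
  rw [sub_right_comm k n, sub_add_cancel] at this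
  rw [this, sub_right_comm k n]

/-- Elements of the torus commute with right multiplications, which carry the vector at 0 to every
basis vector. Hence an element is determined by its Fourier coefficients, the coordinates of its
value at the vector at 0. -/
lemma apply_basisVec_of_mem_torus {θ : Matrix (Fin d) (Fin d) ℝ} {y : Op d} (hy : y ∈ torus θ)
    (n : Fin d → ℤ) : y (basisVec n) = rightMul θ n (y (basisVec 0)) := by
  have h := commute_of_mem_torus hy (fun j => genOp_mul_rightMul θ j n)
  have := congrArg (fun T : Op d => T (basisVec 0)) h
  rw [← rightMul_basisVec_zero θ n]
  exact this.symm

lemma star_apply_basisVec_zero {θ : Matrix (Fin d) (Fin d) ℝ} {y : Op d} (hy : y ∈ torus θ)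
    (n : Fin d → ℤ) :
    starRingEnd ℂ (star y (basisVec 0) n) = rightPhase θ (-n) n * y (basisVec 0) (-n) := by
  rw [← inner_basisVec, inner_conj_symm, ContinuousLinearMap.star_eq_adjoint,
    ContinuousLinearMap.adjoint_inner_left, inner_basisVec, apply_basisVec_of_mem_torus hy,
    rightMul_apply, zero_sub]

lemma trace_mul_eq_tsum {θ : Matrix (Fin d) (Fin d) ℝ} {x : Op d} (hx : x ∈ torus θ) (y : Op d) :
    trace (x * y)
      = ∑' n, rightPhase θ (-n) n * x (basisVec 0) (-n) * y (basisVec 0) n := by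
  rw [trace_mul_eq_inner, lp.inner_eq_tsum]
  refine tsum_congr fun n => ?_
  rw [RCLike.inner_apply', star_apply_basisVec_zero hx]

/-- The trace property of `τ`. -/
theorem trace_mul_comm {θ : Matrix (Fin d) (Fin d) ℝ} {x y : Op d} (hx : x ∈ torus θ)
    (hy : y ∈ torus θ) : trace (x * y) = trace (y * x) := by
  -- The substitution n ↦ -n exchanges the roles of the two coefficient families, and the phase is
  -- even in the pair of its arguments.
  rw [trace_mul_eq_tsum hx, trace_mul_eq_tsum hy, ← (Equiv.neg (Fin d → ℤ)).tsum_eq]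
  refine tsum_congr fun n => ?_
  simp only [Equiv.neg_apply, neg_neg]
  rw [← rightPhase_neg_neg, neg_neg]
  ring

/-! ### Monomials and smooth elements -/

/-- The phase of U_j only sees coordinates below j, so it is trivial while these vanish. -/
lemma gen_zpow_basisVec (θ : Matrix (Fin d) (Fin d) ℝ) (j : Fin d) (z : ℤ) {m : Fin d → ℤ}
    (hm : ∀ l < j, m l = 0) :
    (gen θ j ^ z) (basisVec m) = basisVec (m + Pi.single j z) := by
  have h0 : ∀ w : ℤ, phase θ j (m + Pi.single j w) = 1 := by
    intro w
    have : ∑ l ∈ Finset.univ.filter (· < j), θ j l * ((m + Pi.single j w : Fin d → ℤ) l : ℝ) = 0 := by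
      refine Finset.sum_eq_zero fun l hl => ?_
      have hl' : l < j := (Finset.mem_filter.1 hl).2
      simp [hm l hl', hl'.ne]
    rw [phase, this]
    simp
  have h1 : ∀ w : ℤ, gen θ j (basisVec (m + Pi.single j w)) = basisVec (m + Pi.single j (w + 1)) := by
    intro w
    rw [gen_basisVec, h0, one_smul, add_assoc, ← Pi.single_add]
  induction z with
  | zero => simp
  | succ i ih =>
    rw [add_comm (i : ℤ) 1, zpow_add, zpow_one, LinearIsometryEquiv.coe_mul, Function.comp_apply,
      ih, h1, add_comm (i : ℤ) 1]
  | pred i ih =>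
    rw [sub_eq_add_neg, add_comm, zpow_add, zpow_neg_one, LinearIsometryEquiv.coe_mul,
      Function.comp_apply, ih]
    change (gen θ j).symm _ = _
    rw [LinearIsometryEquiv.symm_apply_eq, h1]
    congr 3
    ring

/-- In an increasing list the generators of largest index act first, so each generator meets a
vector whose lower coordinates are still zero and no phase appears. -/
lemma list_prod_gen_basisVec (θ : Matrix (Fin d) (Fin d) ℝ) (n : Fin d → ℤ) (l : List (Fin d))
    (hl : l.Pairwise (· < ·)) :
    (l.map fun j => gen θ j ^ n j).prod (basisVec 0)
      = basisVec ((l.map fun j => Pi.single j (n j)).sum) := by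
  induction l with
  | nil => simp
  | cons a l ih =>
    rw [List.pairwise_cons] at hl
    rw [List.map_cons, List.prod_cons, LinearIsometryEquiv.coe_mul, Function.comp_apply, ih hl.2,
      gen_zpow_basisVec, List.map_cons, List.sum_cons, add_comm]
    intro k hk
    have : ∀ l : List (Fin d), (∀ i ∈ l, k < i) →
        (l.map fun j => (Pi.single j (n j) : Fin d → ℤ)).sum k = 0 := by
      intro l
      induction l with
      | nil => simp
      | cons b l ih' =>
        intro h
        simp only [List.mem_cons, forall_eq_or_imp] at h
        rw [List.map_cons, List.sum_cons, Pi.add_apply, ih' h.2, Pi.single_eq_of_ne h.1.ne, add_zero]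
    exact this l fun i hi => hk.trans (hl.1 i hi)

lemma monomial_basisVec_zero (θ : Matrix (Fin d) (Fin d) ℝ) (n : Fin d → ℤ) :
    monomial θ n (basisVec 0) = basisVec n := by
  change (List.ofFn fun j => gen θ j ^ n j).prod (basisVec 0) = _
  rw [List.ofFn_eq_map, list_prod_gen_basisVec θ n _ (List.pairwise_lt_finRange d),
    ← List.ofFn_eq_map, List.sum_ofFn, Finset.univ_sum_single]

lemma isometryEquiv_mul_mem {θ : Matrix (Fin d) (Fin d) ℝ} {e f : Hilb d ≃ₗᵢ[ℂ] Hilb d}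
    (he : (e : Op d) ∈ torus θ) (hf : (f : Op d) ∈ torus θ) :
    ((e * f : Hilb d ≃ₗᵢ[ℂ] Hilb d) : Op d) ∈ torus θ :=
  mul_mem he hf

lemma isometryEquiv_inv_mem {θ : Matrix (Fin d) (Fin d) ℝ} {e : Hilb d ≃ₗᵢ[ℂ] Hilb d}
    (he : (e : Op d) ∈ torus θ) : ((e⁻¹ : Hilb d ≃ₗᵢ[ℂ] Hilb d) : Op d) ∈ torus θ := by
  have := star_mem he
  rwa [star_isometryEquiv] at this

lemma monomial_mem_torus (θ : Matrix (Fin d) (Fin d) ℝ) (n : Fin d → ℤ) :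
    monomial θ n ∈ torus θ := by
  -- The unitaries lying in the algebra form a group, which disposes of products and of negative
  -- powers at once.
  let G : Subgroup (Hilb d ≃ₗᵢ[ℂ] Hilb d) :=
    { carrier := {e | (e : Op d) ∈ torus θ}
      mul_mem' := isometryEquiv_mul_mem
      one_mem' := one_mem (torus θ)
      inv_mem' := isometryEquiv_inv_mem }
  change (List.ofFn fun j => gen θ j ^ n j).prod ∈ G
  refine Subgroup.list_prod_mem _ fun e he => ?_
  obtain ⟨j, rfl⟩ := (List.mem_ofFn' _ _).1 he
  exact Subgroup.zpow_mem _ (genOp_mem_torus θ j) _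

lemma norm_monomial_le (θ : Matrix (Fin d) (Fin d) ℝ) (n : Fin d → ℤ) : ‖monomial θ n‖ ≤ 1 :=
  ContinuousLinearMap.opNorm_le_bound _ zero_le_one fun f => by
    rw [one_mul]
    exact (LinearIsometryEquiv.norm_map _ f).le

end QuantumTorus

end

section

namespace QuantumTorus

variable {H : Type*} [NormedAddCommGroup H] [InnerProductSpace ℂ H] [CompleteSpace H]
  {M : VonNeumannAlgebra H} {Ω : H}

/-! ### Functional calculus in a von Neumann algebra with a tracial vector state -/

/-- The functional `y ↦ ⟨Ω, y Ω⟩`. -/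
def vecState (Ω : H) (y : H →L[ℂ] H) : ℂ := ⟪Ω, y Ω⟫_ℂ

/-- The vector state of `Ω` is a vecState Ω on `M`. -/
def IsTracial (M : VonNeumannAlgebra H) (Ω : H) : Prop :=
  ∀ x ∈ M, ∀ y ∈ M, vecState Ω (x * y) = vecState Ω (y * x)

/-- The vector state as a bounded linear functional. -/
def vecStateCLM (Ω : H) : (H →L[ℂ] H) →L[ℂ] ℂ :=
  (innerSL ℂ Ω).comp (ContinuousLinearMap.apply ℂ H Ω)

lemma vecStateCLM_apply (Ω : H) (y : H →L[ℂ] H) : vecStateCLM Ω y = vecState Ω y := rfl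

lemma vecState_sub (x y : H →L[ℂ] H) : vecState Ω (x - y) = vecState Ω x - vecState Ω y := by
  simp only [← vecStateCLM_apply, map_sub]

lemma vecState_smul (c : ℂ) (x : H →L[ℂ] H) : vecState Ω (c • x) = c * vecState Ω x := by
  simp only [← vecStateCLM_apply, map_smul, smul_eq_mul]

lemma continuous_vecState : Continuous (vecState Ω) := (vecStateCLM Ω).continuous

lemma vecState_mul (x y : H →L[ℂ] H) : vecState Ω (x * y) = ⟪star x Ω, y Ω⟫_ℂ := by
  rw [vecState, ContinuousLinearMap.star_eq_adjoint, ContinuousLinearMap.adjoint_inner_left]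
  rfl

/-- By the double commutant property. Operators built from a by functional calculus commute with
everything that commutes with a and its adjoint, so this criterion keeps them in M. -/
lemma mem_of_forall_commute {y : H →L[ℂ] H} (hy : ∀ c ∈ M.commutant, Commute y c) : y ∈ M := by
  rw [← M.commutant_commutant, VonNeumannAlgebra.mem_commutant_iff]
  exact fun c hc => (hy c hc).symm.eq

lemma commute_of_mem_commutant {y c : H →L[ℂ] H} (hy : y ∈ M) (hc : c ∈ M.commutant) :
    Commute y c :=
  VonNeumannAlgebra.mem_commutant_iff.1 hc y hy

lemma cfc_mem {a : H →L[ℂ] H} (ha : a ∈ M) (f : ℝ → ℝ) :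
    cfc f a ∈ M :=
  mem_of_forall_commute fun c hc => by
    have h : Commute a c := commute_of_mem_commutant ha hc
    exact h.cfc_real f

lemma sqrt_mem {a : H →L[ℂ] H} (ha : a ∈ M) :
    CFC.sqrt a ∈ M :=
  mem_of_forall_commute fun c hc => by
    have h : Commute a c := commute_of_mem_commutant ha hc
    exact h.cfcₙ_nnreal _

lemma abs_mem {a : H →L[ℂ] H} (ha : a ∈ M) :
    CFC.abs a ∈ M :=
  sqrt_mem (mul_mem (star_mem ha) ha)

lemma exp_mem {a : H →L[ℂ] H} (ha : a ∈ M) :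
    NormedSpace.exp a ∈ M :=
  mem_of_forall_commute fun c hc => by
    have h : Commute a c := commute_of_mem_commutant ha hc
    exact h.exp_left

lemma vecState_eq_re_of_nonneg {h : H →L[ℂ] H} (hh : 0 ≤ h) :
    0 ≤ (vecState Ω h).re ∧ vecState Ω h = ((vecState Ω h).re : ℂ) := by
  have hp := (ContinuousLinearMap.nonneg_iff_isPositive h).1 hh
  have h1 := hp.re_inner_nonneg_right Ω
  refine ⟨h1, Complex.ext (by simp) ?_⟩
  have h2 : starRingEnd ℂ (vecState Ω h) = vecState Ω h := by
    rw [vecState, inner_conj_symm]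
    exact hp.isSymmetric Ω Ω
  simpa using Complex.conj_eq_iff_im.1 h2

lemma vecState_re_nonneg {h : H →L[ℂ] H} (hh : 0 ≤ h) : 0 ≤ (vecState Ω h).re := (vecState_eq_re_of_nonneg hh).1

lemma vecState_re_mono {g h : H →L[ℂ] H} (hgh : g ≤ h) : (vecState Ω g).re ≤ (vecState Ω h).re := by
  have := vecState_re_nonneg (Ω := Ω) (sub_nonneg.2 hgh)
  rw [vecState_sub, Complex.sub_re] at this
  linarith

/-- `|τ(c h)| ≤ ‖c‖ τ(h)` for `h ≥ 0`. -/
lemma norm_vecState_mul_le (hM : IsTracial M Ω) {c h : H →L[ℂ] H} (hc : c ∈ M)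
    (hh : h ∈ M) (h0 : 0 ≤ h) : ‖vecState Ω (c * h)‖ ≤ ‖c‖ * (vecState Ω h).re := by
  set r := CFC.sqrt h with hr
  have hrr : r * r = h := CFC.sqrt_mul_sqrt_self h h0
  have hrm : r ∈ M := sqrt_mem hh
  have hsa : star r = r := (IsSelfAdjoint.of_nonneg (CFC.sqrt_nonneg h)).star_eq
  -- The trace property splits h = r² around c, which reduces the bound to Cauchy–Schwarz at the
  -- vector rΩ.
  have h1 : vecState Ω (c * h) = ⟪r Ω, c (r Ω)⟫_ℂ := by
    rw [← hrr, ← mul_assoc, hM _ (mul_mem hc hrm) _ hrm, vecState_mul, hsa]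
    rfl
  have h2 : vecState Ω h = ⟪r Ω, r Ω⟫_ℂ := by
    rw [← hrr, vecState_mul, hsa]
  have h3 : (vecState Ω h).re = ‖r Ω‖ * ‖r Ω‖ := by
    rw [h2, ← inner_self_eq_norm_mul_norm (𝕜 := ℂ)]
    rfl
  rw [h1, h3]
  calc _ ≤ ‖r Ω‖ * ‖c (r Ω)‖ := norm_inner_le_norm _ _
    _ ≤ ‖r Ω‖ * (‖c‖ * ‖r Ω‖) := by gcongr; exact c.le_opNorm _
    _ = _ := by ring

lemma abs_isSelfAdjoint (y : H →L[ℂ] H) : IsSelfAdjoint (CFC.abs y) :=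
  IsSelfAdjoint.of_nonneg (CFC.abs_nonneg y)

lemma spectrum_abs_nonneg {y : H →L[ℂ] H} {x : ℝ} (hx : x ∈ spectrum ℝ (CFC.abs y)) : 0 ≤ x :=
  spectrum_nonneg_of_nonneg (CFC.abs_nonneg y) hx

/-- An approximate polar decomposition `y = w (|y| + ε)`. -/
lemma exists_eq_mul_abs_add {y : H →L[ℂ] H} (hy : y ∈ M) {ε : ℝ}
    (hε : 0 < ε) :
    ∃ w ∈ M, ‖w‖ ≤ 1 ∧ y = w * (CFC.abs y + algebraMap ℝ (H →L[ℂ] H) ε) := by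
  set h := CFC.abs y with hh
  have hsa : IsSelfAdjoint h := abs_isSelfAdjoint y
  have hpos : ∀ x ∈ spectrum ℝ h, 0 < x + ε := fun x hx => by
    have := spectrum_abs_nonneg hx
    linarith
  have hc : ContinuousOn (fun x : ℝ => (x + ε)⁻¹) (spectrum ℝ h) :=
    ContinuousOn.inv₀ (by fun_prop) fun x hx => (hpos x hx).ne'
  have hadd : h + algebraMap ℝ (H →L[ℂ] H) ε = cfc (fun x : ℝ => x + ε) h := by
    rw [cfc_add_const ε (fun x => x) h, cfc_id' ℝ h]
  -- With w = y (|y| + ε)⁻¹, the operator w^* w is the function x²/(x + ε)² ≤ 1 of |y|.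
  refine ⟨y * cfc (fun x : ℝ => (x + ε)⁻¹) h, mul_mem hy (cfc_mem (abs_mem hy) _),
    ?_, ?_⟩
  · have hs : star (cfc (fun x : ℝ => (x + ε)⁻¹) h) = cfc (fun x : ℝ => (x + ε)⁻¹) h :=
      (cfc_predicate (fun x : ℝ => (x + ε)⁻¹) h : IsSelfAdjoint _).star_eq
    have h1 : star (y * cfc (fun x : ℝ => (x + ε)⁻¹) h) * (y * cfc (fun x : ℝ => (x + ε)⁻¹) h)
        = cfc (fun x : ℝ => (x + ε)⁻¹ * (x * x) * (x + ε)⁻¹) h := by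
      rw [cfc_mul (fun x : ℝ => (x + ε)⁻¹ * (x * x)) (fun x : ℝ => (x + ε)⁻¹) h
          (hc.mul (by fun_prop)) hc,
        cfc_mul (fun x : ℝ => (x + ε)⁻¹) (fun x : ℝ => x * x) h hc (by fun_prop),
        cfc_mul (fun x : ℝ => x) (fun x => x) h, cfc_id' ℝ h, hh, CFC.abs_mul_abs, ← hh,
        star_mul, hs]
      simp only [mul_assoc]
    have h2 : ‖star (y * cfc (fun x : ℝ => (x + ε)⁻¹) h) * (y * cfc (fun x : ℝ => (x + ε)⁻¹) h)‖
        ≤ 1 := by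
      rw [h1]
      refine norm_cfc_le zero_le_one fun x hx => ?_
      have hx0 := spectrum_abs_nonneg hx
      have := hpos x hx
      rw [Real.norm_of_nonneg (by positivity), ← div_eq_inv_mul, ← div_eq_mul_inv, div_div,
        div_le_one (by positivity)]
      nlinarith
    rw [CStarRing.norm_star_mul_self] at h2
    nlinarith [norm_nonneg (y * cfc (fun x : ℝ => (x + ε)⁻¹) h)]
  · rw [hadd, mul_assoc, ← cfc_mul _ _ h hc (by fun_prop)]
    have : cfc (fun x : ℝ => (x + ε)⁻¹ * (x + ε)) h = cfc (fun _ : ℝ => (1 : ℝ)) h :=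
      cfc_congr fun x hx => inv_mul_cancel₀ (hpos x hx).ne'
    rw [this, cfc_const_one ℝ h, mul_one]

/-! ### The three lines argument -/

lemma norm_exp_mul_I_smul_le {B : H →L[ℂ] H} (hB : IsSelfAdjoint B) (t : ℝ) :
    ‖NormedSpace.exp ((t * Complex.I : ℂ) • B)‖ ≤ 1 := by
  have hB' : IsSelfAdjoint ((t : ℂ) • B) := IsSelfAdjoint.smul (by simp [IsSelfAdjoint]) hB
  have : NormedSpace.exp ((t * Complex.I : ℂ) • B)
      = ((selfAdjoint.expUnitary ⟨(t : ℂ) • B, selfAdjoint.mem_iff.2 hB'.star_eq⟩ :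
        unitary (H →L[ℂ] H)) : H →L[ℂ] H) := by
    rw [selfAdjoint.expUnitary_coe, smul_smul, mul_comm]
  rw [this]
  -- Only ‖1‖ ≤ 1 is available, since H may be the zero space.
  refine le_trans (le_of_eq ?_) (ContinuousLinearMap.norm_id_le (𝕜 := ℂ) (E := H))
  exact (congrArg norm (mul_one _)).symm.trans (CStarRing.norm_coe_unitary_mul _ _)

lemma exp_smul_eq_mul (B : H →L[ℂ] H) (z : ℂ) :
    NormedSpace.exp (z • B)
      = NormedSpace.exp ((z.re : ℂ) • B) * NormedSpace.exp ((z.im * Complex.I : ℂ) • B) := by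
  let +nondep : NormedAlgebra ℚ (H →L[ℂ] H) := .restrictScalars ℚ ℂ (H →L[ℂ] H)
  rw [← NormedSpace.exp_add_of_commute (((Commute.refl B).smul_left _).smul_right _), ← add_smul,
    Complex.re_add_im]

lemma exp_smul_eq_mul' (B : H →L[ℂ] H) (z : ℂ) :
    NormedSpace.exp (z • B)
      = NormedSpace.exp ((z.im * Complex.I : ℂ) • B) * NormedSpace.exp ((z.re : ℂ) • B) := by
  let +nondep : NormedAlgebra ℚ (H →L[ℂ] H) := .restrictScalars ℚ ℂ (H →L[ℂ] H)
  rw [← NormedSpace.exp_add_of_commute (((Commute.refl B).smul_left _).smul_right _), ← add_smul,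
    add_comm, Complex.re_add_im]

lemma exists_norm_exp_smul_le {B : H →L[ℂ] H} (hB : IsSelfAdjoint B) :
    ∃ K, ∀ z : ℂ, z.re ∈ Set.Icc (0 : ℝ) 1 → ‖NormedSpace.exp (z • B)‖ ≤ K := by
  let +nondep : NormedAlgebra ℚ (H →L[ℂ] H) := .restrictScalars ℚ ℂ (H →L[ℂ] H)
  have hcont : Continuous fun t : ℝ => NormedSpace.exp ((t : ℂ) • B) := by fun_prop
  obtain ⟨K, hK⟩ := (isCompact_Icc (a := (0 : ℝ)) (b := 1)).exists_bound_of_continuousOn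
    hcont.continuousOn
  refine ⟨K, fun z hz => ?_⟩
  rw [exp_smul_eq_mul]
  refine (norm_mul_le _ _).trans ?_
  have h1 := norm_exp_mul_I_smul_le hB z.im
  nlinarith [hK _ hz, norm_nonneg (NormedSpace.exp ((z.re : ℂ) • B))]

lemma norm_mul_le_one_of_le {x y : H →L[ℂ] H} (hx : ‖x‖ ≤ 1) (hy : ‖y‖ ≤ 1) : ‖x * y‖ ≤ 1 :=
  (norm_mul_le _ _).trans (mul_le_one₀ hx (norm_nonneg _) hy)

/-- The three lines argument behind Hölder's inequality. -/
lemma norm_vecState_exp_le (hM : IsTracial M Ω) {v w A B : H →L[ℂ] H} (hv : v ∈ M) (hw : w ∈ M)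
    (hA : A ∈ M) (hB : B ∈ M) (hv1 : ‖v‖ ≤ 1) (hw1 : ‖w‖ ≤ 1) (hAs : IsSelfAdjoint A)
    (hBs : IsSelfAdjoint B) {s : ℝ} (hs : s ∈ Set.Icc (0 : ℝ) 1) :
    ‖vecState Ω (v * NormedSpace.exp (((1 - s : ℝ) : ℂ) • A) * w * NormedSpace.exp ((s : ℂ) • B))‖
      ≤ (vecState Ω (NormedSpace.exp A)).re ^ (1 - s)
        * (vecState Ω (NormedSpace.exp B)).re ^ s := by
  have hsm : ∀ {C : H →L[ℂ] H} (z : ℂ), C ∈ M → NormedSpace.exp (z • C) ∈ M := fun z hC =>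
    exp_mem (M.toStarSubalgebra.smul_mem hC z)
  obtain ⟨K, hK⟩ := exists_norm_exp_smul_le hAs
  obtain ⟨L, hL⟩ := exists_norm_exp_smul_le hBs
  -- On the line Re z = 0 all factors except exp A are contractions, and on Re z = 1 all except exp
  -- B. Tracial cyclicity brings the remaining positive factor to the end, where
  -- `norm_vecState_mul_le` applies.
  set f : ℂ → ℂ := fun z =>
    vecStateCLM Ω (v * NormedSpace.exp ((1 - z) • A) * w * NormedSpace.exp (z • B)) with hf
  have hdiff : Differentiable ℂ f := by
    have h1 : ∀ C : H →L[ℂ] H, Differentiable ℂ fun z : ℂ => NormedSpace.exp (z • C) := fun C z =>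
      (hasDerivAt_exp_smul_const C z).differentiableAt
    have h2 : Differentiable ℂ fun z : ℂ => NormedSpace.exp ((1 - z) • A) :=
      (h1 A).comp (by fun_prop : Differentiable ℂ fun z : ℂ => 1 - z)
    exact (vecStateCLM Ω).differentiable.comp
      ((((differentiable_const v).mul h2).mul (differentiable_const w)).mul (h1 B))
  have hpos : ∀ {C : H →L[ℂ] H}, IsSelfAdjoint C → 0 ≤ NormedSpace.exp C := fun hC => hC.exp_nonneg
  have key := Complex.HadamardThreeLines.norm_le_interp_of_mem_verticalClosedStrip₀₁' f
    (z := (s : ℂ)) (a := (vecState Ω (NormedSpace.exp A)).re)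
    (b := (vecState Ω (NormedSpace.exp B)).re) (by simpa [Complex.HadamardThreeLines.verticalClosedStrip] using hs) hdiff.diffContOnCl ?_ ?_ ?_
  · simpa only [Complex.ofReal_re, hf, vecStateCLM_apply, Complex.ofReal_sub, Complex.ofReal_one]
      using key
  · refine ⟨‖vecStateCLM Ω‖ * (1 * K * 1 * L), ?_⟩
    rintro _ ⟨z, hz, rfl⟩
    have hz' : z.re ∈ Set.Icc (0 : ℝ) 1 := hz
    have hz1 : (1 - z).re ∈ Set.Icc (0 : ℝ) 1 := by
      simp only [Complex.sub_re, Complex.one_re, Set.mem_Icc] at hz' ⊢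
      constructor <;> linarith [hz'.1, hz'.2]
    have hK0 : 0 ≤ K := (norm_nonneg _).trans (hK z hz')
    refine ((vecStateCLM Ω).le_opNorm _).trans ?_
    refine mul_le_mul_of_nonneg_left ?_ (norm_nonneg _)
    refine (norm_mul_le _ _).trans (mul_le_mul ?_ (hL z hz') (norm_nonneg _) (by positivity))
    refine (norm_mul_le _ _).trans (mul_le_mul ?_ hw1 (norm_nonneg _) (by positivity))
    exact (norm_mul_le _ _).trans (mul_le_mul hv1 (hK _ hz1) (norm_nonneg _) zero_le_one)
  · intro z hz
    have hz0 : z.re = 0 := hz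
    have e1 : NormedSpace.exp ((1 - z) • A)
        = NormedSpace.exp A * NormedSpace.exp (((-z.im : ℝ) * Complex.I : ℂ) • A) := by
      rw [exp_smul_eq_mul]
      simp [hz0]
    have e2 : NormedSpace.exp (z • B) = NormedSpace.exp ((z.im * Complex.I : ℂ) • B) := by
      congr 2
      apply Complex.ext <;> simp [hz0]
    have h3 : f z = vecState Ω ((NormedSpace.exp (((-z.im : ℝ) * Complex.I : ℂ) • A) * w *
        NormedSpace.exp ((z.im * Complex.I : ℂ) • B) * v) * NormedSpace.exp A) := by
      rw [hf]
      simp only [vecStateCLM_apply]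
      have := hM _ (mul_mem hv (exp_mem hA)) _ (mul_mem (mul_mem
        (hsm (((-z.im : ℝ) : ℂ) * Complex.I) hA) hw) (hsm ((z.im : ℂ) * Complex.I) hB))
      simp only [mul_assoc] at this ⊢
      rw [e1, e2, mul_assoc]
      exact this
    rw [h3]
    refine (norm_vecState_mul_le hM
      (mul_mem (mul_mem (mul_mem (hsm _ hA) hw) (hsm _ hB)) hv) (exp_mem hA) (hpos hAs)).trans ?_
    refine mul_le_of_le_one_left (vecState_re_nonneg (hpos hAs)) ?_
    have n1 := norm_exp_mul_I_smul_le hAs (-z.im)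
    have n2 := norm_exp_mul_I_smul_le hBs z.im
    exact norm_mul_le_one_of_le (norm_mul_le_one_of_le (norm_mul_le_one_of_le n1 hw1) n2) hv1
  · intro z hz
    have hz0 : z.re = 1 := hz
    have e1 : NormedSpace.exp ((1 - z) • A)
        = NormedSpace.exp (((-z.im : ℝ) * Complex.I : ℂ) • A) := by
      congr 2
      apply Complex.ext <;> simp [hz0]
    have e2 : NormedSpace.exp (z • B)
        = NormedSpace.exp ((z.im * Complex.I : ℂ) • B) * NormedSpace.exp B := by
      rw [exp_smul_eq_mul']
      simp [hz0]
    have h3 : f z = vecState Ω ((v * NormedSpace.exp (((-z.im : ℝ) * Complex.I : ℂ) • A) * w *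
        NormedSpace.exp ((z.im * Complex.I : ℂ) • B)) * NormedSpace.exp B) := by
      rw [hf]
      simp only [vecStateCLM_apply]
      rw [e1, e2]
      simp only [mul_assoc]
    rw [h3]
    refine (norm_vecState_mul_le hM
      (mul_mem (mul_mem (mul_mem hv (hsm _ hA)) hw) (hsm _ hB)) (exp_mem hB) (hpos hBs)).trans ?_
    refine mul_le_of_le_one_left (vecState_re_nonneg (hpos hBs)) ?_
    have n1 := norm_exp_mul_I_smul_le hAs (-z.im)
    have n2 := norm_exp_mul_I_smul_le hBs z.im
    exact norm_mul_le_one_of_le (norm_mul_le_one_of_le (norm_mul_le_one_of_le hv1 n1) hw1) n2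

end QuantumTorus

end

section

namespace QuantumTorus

variable {H : Type*} [NormedAddCommGroup H] [InnerProductSpace ℂ H] [CompleteSpace H]
  {M : VonNeumannAlgebra H} {Ω : H}

/-! ### Hölder's inequality -/

/-- The `L_p`-norm `τ(|y|^p)^{1/p}` with respect to a vector state. -/
def vecLpNorm (Ω : H) (p : ℝ≥0∞) (y : H →L[ℂ] H) : ℝ :=
  if p = ∞ then ‖y‖ else (vecState Ω (absPow y p.toReal)).re ^ (1 / p.toReal)

lemma absPow_nonneg (y : H →L[ℂ] H) (p : ℝ) : 0 ≤ absPow y p := CFC.rpow_nonneg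

lemma absPow_eq_cfc (y : H →L[ℂ] H) (p : ℝ) :
    absPow y p = cfc (fun x : ℝ => x ^ p) (CFC.abs y) :=
  CFC.rpow_eq_cfc_real (CFC.abs_nonneg y)

lemma vecLpNorm_nonneg (p : ℝ≥0∞) (y : H →L[ℂ] H) : 0 ≤ vecLpNorm Ω p y := by
  rw [vecLpNorm]
  split_ifs
  · exact norm_nonneg y
  · exact Real.rpow_nonneg (vecState_re_nonneg (absPow_nonneg y _)) _

/-- Writing a power as an exponential embeds a in the analytic family z ↦ exp(z log a). Strict
positivity of the spectrum is needed for log to be continuous there. -/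
lemma exp_smul_cfc_log {a : H →L[ℂ] H} (ha : 0 ≤ a) (hs : ∀ x ∈ spectrum ℝ a, 0 < x) (t : ℝ) :
    NormedSpace.exp ((t : ℂ) • cfc Real.log a) = a ^ t := by
  have hlog : ContinuousOn Real.log (spectrum ℝ a) :=
    Real.continuousOn_log.mono fun x hx => (hs x hx).ne'
  have hsa : IsSelfAdjoint a := IsSelfAdjoint.of_nonneg ha
  have h1 : (t : ℂ) • cfc Real.log a = cfc (fun x => t * Real.log x) a := by
    rw [cfc_const_mul t Real.log a hlog]
    exact (RCLike.real_smul_eq_coe_smul t _).symm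
  rw [h1, ← CFC.real_exp_eq_normedSpace_exp (cfc_predicate _ a),
    ← cfc_comp' Real.exp (fun x => t * Real.log x) a (by fun_prop) (hlog.const_mul t) hsa,
    CFC.rpow_eq_cfc_real ha]
  refine cfc_congr fun x hx => ?_
  simp only [Real.rpow_def_of_pos (hs x hx), mul_comm]

lemma spectrum_add_algebraMap_pos {h : H →L[ℂ] H} (hh : 0 ≤ h) {ε : ℝ} (hε : 0 < ε) {x : ℝ}
    (hx : x ∈ spectrum ℝ (h + algebraMap ℝ (H →L[ℂ] H) ε)) : 0 < x := by
  have hsa : IsSelfAdjoint h := IsSelfAdjoint.of_nonneg hh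
  have hadd : h + algebraMap ℝ (H →L[ℂ] H) ε = cfc (fun x : ℝ => x + ε) h := by
    rw [cfc_add_const ε (fun x => x) h, cfc_id' ℝ h]
  rw [hadd, cfc_map_spectrum (fun x : ℝ => x + ε) h] at hx
  obtain ⟨z, hz, rfl⟩ := hx
  have := spectrum_nonneg_of_nonneg hh hz
  positivity

lemma add_algebraMap_nonneg {h : H →L[ℂ] H} (hh : 0 ≤ h) {ε : ℝ} (hε : 0 ≤ ε) :
    0 ≤ h + algebraMap ℝ (H →L[ℂ] H) ε :=
  add_nonneg hh (by
    rw [← cfc_const ε h (IsSelfAdjoint.of_nonneg hh)]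
    exact cfc_nonneg fun _ _ => hε)

lemma algebraMap_real_mem (r : ℝ) : algebraMap ℝ (H →L[ℂ] H) r ∈ M := by
  have : algebraMap ℝ (H →L[ℂ] H) r = algebraMap ℂ (H →L[ℂ] H) (r : ℂ) := by
    rw [Algebra.algebraMap_eq_smul_one, Algebra.algebraMap_eq_smul_one]
    exact RCLike.real_smul_eq_coe_smul r _
  rw [this]
  exact M.toStarSubalgebra.algebraMap_mem _

lemma tendsto_add_algebraMap (h : H →L[ℂ] H) :
    Tendsto (fun ε : ℝ => h + algebraMap ℝ (H →L[ℂ] H) ε) (𝓝[>] 0) (𝓝 h) := by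
  have h1 : Continuous fun ε : ℝ => h + algebraMap ℝ (H →L[ℂ] H) ε :=
    continuous_const.add (algebraMapCLM ℝ (H →L[ℂ] H)).continuous
  have := (h1.tendsto 0).mono_left (nhdsWithin_le_nhds (s := Set.Ioi (0 : ℝ)))
  simpa using this

/-- This removes the shift by ε that made logarithms available: powers of positive exponent are norm
continuous on positive operators. -/
lemma tendsto_vecState_add_algebraMap_rpow (y : H →L[ℂ] H) {p : ℝ} (hp : 0 < p) :
    Tendsto (fun ε : ℝ => (vecState Ω ((CFC.abs y + algebraMap ℝ (H →L[ℂ] H) ε) ^ p)).re) (𝓝[>] 0)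
      (𝓝 (vecState Ω (absPow y p)).re) := by
  refine (Complex.continuous_re.tendsto _).comp ((continuous_vecState.tendsto _).comp ?_)
  have hc := CFC.continuousOn_nnrpow (A := H →L[ℂ] H) ⟨p, hp.le⟩
  have hy := hc (CFC.abs y) (CFC.abs_nonneg y)
  have h2 : Tendsto (fun ε : ℝ => CFC.abs y + algebraMap ℝ (H →L[ℂ] H) ε) (𝓝[>] 0)
      (𝓝[{a | 0 ≤ a}] (CFC.abs y)) :=
    tendsto_nhdsWithin_iff.2 ⟨tendsto_add_algebraMap _, by
      filter_upwards [self_mem_nhdsWithin] with ε hε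
      exact add_algebraMap_nonneg (CFC.abs_nonneg y) (le_of_lt hε)⟩
  have h3 := hy.tendsto.comp h2
  have hp' : (0 : ℝ≥0) < ⟨p, hp.le⟩ := hp
  simp only [CFC.nnrpow_eq_rpow hp'] at h3
  exact h3

lemma norm_vecState_holder (hM : IsTracial M Ω) {v w a b : H →L[ℂ] H} (hv : v ∈ M) (hw : w ∈ M)
    (ha : a ∈ M) (hb : b ∈ M) (hv1 : ‖v‖ ≤ 1) (hw1 : ‖w‖ ≤ 1) (ha0 : 0 ≤ a) (hb0 : 0 ≤ b)
    (has : ∀ x ∈ spectrum ℝ a, 0 < x) (hbs : ∀ x ∈ spectrum ℝ b, 0 < x) {p q : ℝ}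
    (hpq : p.HolderConjugate q) :
    ‖vecState Ω (v * a * w * b)‖
      ≤ (vecState Ω (a ^ p)).re ^ (1 / p) * (vecState Ω (b ^ q)).re ^ (1 / q) := by
  have hsm : ∀ {c : H →L[ℂ] H} (t : ℝ), c ∈ M → ((t : ℂ) • cfc Real.log c) ∈ M := fun t hc =>
    M.toStarSubalgebra.smul_mem (cfc_mem hc _) _
  have hsa : ∀ (c : H →L[ℂ] H) (t : ℝ), IsSelfAdjoint ((t : ℂ) • cfc Real.log c) := fun c t =>
    IsSelfAdjoint.smul (by simp [IsSelfAdjoint]) (cfc_predicate _ c)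
  have hs : (1 / q) ∈ Set.Icc (0 : ℝ) 1 := by
    refine ⟨hpq.symm.one_div_nonneg, ?_⟩
    rw [one_div]
    exact inv_le_one_of_one_le₀ hpq.symm.lt.le
  have h1q : 1 - 1 / q = 1 / p := by
    rw [one_div, one_div, hpq.symm.one_sub_inv]
  -- The endpoints are A = p log a and B = q log b; at s = 1/q the two exponentials become a and b.
  have key := norm_vecState_exp_le hM hv hw (hsm p ha) (hsm q hb) hv1 hw1 (hsa a p) (hsa b q) hs
  rw [h1q, smul_smul, smul_smul, ← Complex.ofReal_mul, ← Complex.ofReal_mul,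
    one_div_mul_cancel hpq.ne_zero, one_div_mul_cancel hpq.symm.ne_zero,
    exp_smul_cfc_log ha0 has, exp_smul_cfc_log hb0 hbs, exp_smul_cfc_log ha0 has,
    exp_smul_cfc_log hb0 hbs, CFC.rpow_one a ha0, CFC.rpow_one b hb0] at key
  exact key

/-- Both factors are written as v (|y| + ε) and w (|b| + ε) with contractions v and w, to which the
strictly positive case applies; then ε → 0. -/
lemma norm_vecState_mul_le_of_holderConjugate (hM : IsTracial M Ω) {y b : H →L[ℂ] H} (hy : y ∈ M)
    (hb : b ∈ M) {p q : ℝ} (hpq : p.HolderConjugate q) :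
    ‖vecState Ω (y * b)‖ ≤ (vecState Ω (absPow y p)).re ^ (1 / p)
      * (vecState Ω (absPow b q)).re ^ (1 / q) := by
  have hlim := ((tendsto_vecState_add_algebraMap_rpow (Ω := Ω) y hpq.pos).rpow_const
    (p := 1 / p) (Or.inr hpq.one_div_nonneg)).mul
    ((tendsto_vecState_add_algebraMap_rpow (Ω := Ω) b hpq.symm.pos).rpow_const
      (p := 1 / q) (Or.inr hpq.symm.one_div_nonneg))
  refine ge_of_tendsto hlim ?_
  filter_upwards [self_mem_nhdsWithin] with ε hε
  have hε' : (0 : ℝ) < ε := hε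
  obtain ⟨v, hv, hv1, hyv⟩ := exists_eq_mul_abs_add hy hε'
  obtain ⟨w, hw, hw1, hbw⟩ := exists_eq_mul_abs_add hb hε'
  have := norm_vecState_holder hM hv hw (add_mem (abs_mem hy) (algebraMap_real_mem ε))
    (add_mem (abs_mem hb) (algebraMap_real_mem ε)) hv1 hw1
    (add_algebraMap_nonneg (CFC.abs_nonneg y) hε'.le)
    (add_algebraMap_nonneg (CFC.abs_nonneg b) hε'.le)
    (fun x hx => spectrum_add_algebraMap_pos (CFC.abs_nonneg y) hε' hx)
    (fun x hx => spectrum_add_algebraMap_pos (CFC.abs_nonneg b) hε' hx) hpq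
  rw [mul_assoc (v * _), ← hyv, ← hbw] at this
  exact this

/-- At the endpoint no interpolation is needed: by cyclicity bv is an operator of norm at most ‖b‖
in front of the positive operator |y| + ε. -/
lemma norm_vecState_mul_le_one_top (hM : IsTracial M Ω) {y b : H →L[ℂ] H} (hy : y ∈ M)
    (hb : b ∈ M) : ‖vecState Ω (y * b)‖ ≤ (vecState Ω (absPow y 1)).re * ‖b‖ := by
  have hlim := (tendsto_vecState_add_algebraMap_rpow (Ω := Ω) y one_pos).mul_const ‖b‖
  refine ge_of_tendsto hlim ?_
  filter_upwards [self_mem_nhdsWithin] with ε hε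
  have hε' : (0 : ℝ) < ε := hε
  obtain ⟨v, hv, hv1, hyv⟩ := exists_eq_mul_abs_add hy hε'
  have h0 := add_algebraMap_nonneg (CFC.abs_nonneg y) hε'.le
  have hm := add_mem (abs_mem hy) (algebraMap_real_mem (M := M) ε)
  rw [CFC.rpow_one _ h0, hM _ hy _ hb]
  conv_lhs => rw [hyv, ← mul_assoc]
  refine (norm_vecState_mul_le hM (mul_mem hb hv) hm h0).trans ?_
  rw [mul_comm]
  refine mul_le_mul_of_nonneg_left ?_ (vecState_re_nonneg h0)
  exact (norm_mul_le _ _).trans (mul_le_of_le_one_right (norm_nonneg _) hv1)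

lemma vecLpNorm_top (y : H →L[ℂ] H) : vecLpNorm Ω ∞ y = ‖y‖ := if_pos rfl

lemma vecLpNorm_of_ne_top {p : ℝ≥0∞} (hp : p ≠ ∞) (y : H →L[ℂ] H) :
    vecLpNorm Ω p y = (vecState Ω (absPow y p.toReal)).re ^ (1 / p.toReal) := if_neg hp

lemma vecLpNorm_one (y : H →L[ℂ] H) : vecLpNorm Ω 1 y = (vecState Ω (absPow y 1)).re := by
  rw [vecLpNorm_of_ne_top ENNReal.one_ne_top, ENNReal.toReal_one, div_one, Real.rpow_one]

lemma holderConjugate_cases {p q : ℝ≥0∞} (hpq : p.HolderConjugate q) :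
    (p = 1 ∧ q = ∞) ∨ (p = ∞ ∧ q = 1) ∨
      (p ≠ ∞ ∧ q ≠ ∞ ∧ p.toReal.HolderConjugate q.toReal) := by
  by_cases hp : p = ∞
  · subst hp
    exact Or.inr (Or.inl ⟨rfl, by simpa using ENNReal.HolderConjugate.inv_add_inv_eq_one ∞ q⟩)
  by_cases hq : q = ∞
  · subst hq
    exact Or.inl ⟨by simpa using ENNReal.HolderConjugate.inv_add_inv_eq_one p ∞, rfl⟩
  · have hp0 : p ≠ 0 := ENNReal.HolderConjugate.ne_zero p q
    have hq0 : q ≠ 0 := ENNReal.HolderConjugate.ne_zero q p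
    have h1 := ENNReal.HolderTriple.toReal (r := 1) (ENNReal.toReal_pos hp0 hp)
      (ENNReal.toReal_pos hq0 hq)
    exact Or.inr (Or.inr ⟨hp, hq, by simpa using h1⟩)

/-- **Hölder's inequality** for a tracial vector state. -/
theorem norm_vecState_mul_le_vecLpNorm (hM : IsTracial M Ω) {p q : ℝ≥0∞}
    (hpq : p.HolderConjugate q) {y b : H →L[ℂ] H} (hy : y ∈ M) (hb : b ∈ M) :
    ‖vecState Ω (y * b)‖ ≤ vecLpNorm Ω p y * vecLpNorm Ω q b := by
  rcases holderConjugate_cases hpq with ⟨rfl, rfl⟩ | ⟨rfl, rfl⟩ | ⟨hp, hq, h⟩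
  · rw [vecLpNorm_one, vecLpNorm_top]
    exact norm_vecState_mul_le_one_top hM hy hb
  · rw [vecLpNorm_one, vecLpNorm_top, hM _ hy _ hb, mul_comm]
    exact norm_vecState_mul_le_one_top hM hb hy
  · rw [vecLpNorm_of_ne_top hp, vecLpNorm_of_ne_top hq]
    exact norm_vecState_mul_le_of_holderConjugate hM hy hb h

/-! ### Duality -/

/-- Because |y^*|² = y y^*. Working with |y^*| lets y^* itself play the part of the polar phase in
the dual element. -/
lemma star_mul_cfc_abs_star (y : H →L[ℂ] H) {g : ℝ → ℝ}
    (hg : ContinuousOn g (spectrum ℝ (CFC.abs (star y)))) :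
    y * (star y * cfc g (CFC.abs (star y)))
      = cfc (fun x => x * x * g x) (CFC.abs (star y)) := by
  have hsa := abs_isSelfAdjoint (star y)
  rw [cfc_mul (fun x : ℝ => x * x) g _ (by fun_prop) hg, cfc_mul (fun x : ℝ => x) (fun x => x) _,
    cfc_id' ℝ (CFC.abs (star y)), CFC.abs_mul_abs, star_star, mul_assoc]

lemma star_mul_cfc_abs_star_sq (y : H →L[ℂ] H) {g : ℝ → ℝ}
    (hg : ContinuousOn g (spectrum ℝ (CFC.abs (star y)))) :
    star (star y * cfc g (CFC.abs (star y))) * (star y * cfc g (CFC.abs (star y)))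
      = cfc (fun x => (x * g x) * (x * g x)) (CFC.abs (star y)) := by
  have hs : star (cfc g (CFC.abs (star y))) = cfc g (CFC.abs (star y)) :=
    (cfc_predicate g (CFC.abs (star y)) : IsSelfAdjoint _).star_eq
  rw [star_mul, star_star, hs, mul_assoc, star_mul_cfc_abs_star y hg,
    ← cfc_mul g (fun x => x * x * g x) _ hg ((continuousOn_id.mul continuousOn_id).mul hg)]
  exact cfc_congr fun x _ => by ring

lemma abs_star_mul_cfc (y : H →L[ℂ] H) {g : ℝ → ℝ}
    (hg : ContinuousOn g (spectrum ℝ (CFC.abs (star y))))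
    (hg0 : ∀ x ∈ spectrum ℝ (CFC.abs (star y)), 0 ≤ g x) :
    CFC.abs (star y * cfc g (CFC.abs (star y)))
      = cfc (fun x => x * g x) (CFC.abs (star y)) := by
  have hc : ContinuousOn (fun x => x * g x) (spectrum ℝ (CFC.abs (star y))) :=
    continuousOn_id.mul hg
  rw [CFC.abs, star_mul_cfc_abs_star_sq y hg, cfc_mul _ _ _ hc hc]
  exact CFC.sqrt_mul_self _ (cfc_nonneg fun x hx => mul_nonneg (spectrum_abs_nonneg hx) (hg0 x hx))

/-- The dual element `y^* g(|y^*|)` with `g(t) = t^{p-1} / (t + ε)` almost norms `y^*`. -/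
lemma exists_dual_element {p q : ℝ≥0∞} (hpq : p.HolderConjugate q) (hp : p ≠ ∞)
    {y : H →L[ℂ] H} (hy : y ∈ M) {ε : ℝ} (hε : 0 < ε) :
    ∃ b ∈ M, vecLpNorm Ω q b ≤ (vecState Ω (absPow (star y) p.toReal)).re ^ (1 - 1 / p.toReal) ∧
      (vecState Ω (absPow (star y) p.toReal)).re
        - ε * (vecState Ω (absPow (star y) (p.toReal - 1))).re ≤ ‖vecState Ω (y * b)‖ := by
  set k := CFC.abs (star y) with hk
  set r := p.toReal with hr
  have hr1 : 1 ≤ r := by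
    have := ENNReal.HolderConjugate.one_le p q
    exact (ENNReal.toReal_mono hp this).trans' (by simp)
  have hk0 : ∀ {x}, x ∈ spectrum ℝ k → 0 ≤ x := fun hx => spectrum_abs_nonneg hx
  have hksa : IsSelfAdjoint k := abs_isSelfAdjoint _
  have hpw : Continuous fun x : ℝ => x ^ (r - 1) :=
    Real.continuous_rpow_const (by linarith)
  have hpw' : Continuous fun x : ℝ => x ^ r := Real.continuous_rpow_const (by linarith)
  have hxr : ∀ {x : ℝ}, 0 ≤ x → x * x ^ (r - 1) = x ^ r := by
    intro x hx
    rcases hx.eq_or_lt with rfl | hx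
    · rw [zero_mul, Real.zero_rpow (by linarith)]
    · rw [Real.rpow_sub_one hx.ne', mul_div_cancel₀ _ hx.ne']
  -- For b = y^* g(|y^*|) the modulus is |b| = x g(x) ≤ x^{p-1} as a function of x = |y^*|, so |b|^q
  -- ≤ x^p when q < ∞. On the other side y b = x² g(x) ≥ x^p - ε x^{p-1}, since x² ≥ x² - ε². The
  -- denominator x + ε avoids dividing by zero.
  set g : ℝ → ℝ := fun x => x ^ (r - 1) / (x + ε) with hgdef
  have hg : ContinuousOn g (spectrum ℝ k) :=
    hpw.continuousOn.div (by fun_prop) fun x hx => by linarith [hk0 hx]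
  have hg0 : ∀ x ∈ spectrum ℝ k, 0 ≤ g x := fun x hx =>
    div_nonneg (Real.rpow_nonneg (hk0 hx) _) (by linarith [hk0 hx])
  have hxg : ∀ x ∈ spectrum ℝ k, x * g x ≤ x ^ (r - 1) := fun x hx => by
    have h0 := hk0 hx
    have h1 := Real.rpow_nonneg h0 (r - 1)
    rw [hgdef]
    simp only
    rw [← mul_div_assoc, div_le_iff₀ (by linarith)]
    nlinarith
  have hcg : ContinuousOn (fun x => x * g x) (spectrum ℝ k) := continuousOn_id.mul hg
  refine ⟨star y * cfc g k, mul_mem (star_mem hy) (cfc_mem (abs_mem (star_mem hy)) _), ?_, ?_⟩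
  · rcases holderConjugate_cases hpq with ⟨rfl, rfl⟩ | ⟨rfl, rfl⟩ | ⟨-, hq, h⟩
    · have hr' : r = 1 := by simp [hr]
      rw [vecLpNorm_top, hr', div_one, sub_self, Real.rpow_zero]
      have h2 : ‖star (star y * cfc g k) * (star y * cfc g k)‖ ≤ 1 := by
        rw [star_mul_cfc_abs_star_sq y hg]
        refine norm_cfc_le zero_le_one fun x hx => ?_
        have h0 := mul_nonneg (hk0 hx) (hg0 x hx)
        have h1 := hxg x hx
        rw [hr', sub_self, Real.rpow_zero] at h1
        rw [Real.norm_of_nonneg (mul_nonneg h0 h0)]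
        exact mul_le_one₀ h1 h0 h1
      rw [CStarRing.norm_star_mul_self] at h2
      nlinarith [norm_nonneg (star y * cfc g k)]
    · exact absurd rfl hp
    · rw [vecLpNorm_of_ne_top hq]
      have he : 1 - 1 / r = 1 / q.toReal := by rw [one_div, one_div, h.one_sub_inv]
      rw [he]
      refine Real.rpow_le_rpow (vecState_re_nonneg (absPow_nonneg _ _)) (vecState_re_mono ?_)
        h.symm.one_div_nonneg
      rw [absPow_eq_cfc, absPow_eq_cfc, abs_star_mul_cfc y hg hg0, ← hk,
        ← cfc_comp' (fun x : ℝ => x ^ q.toReal) (fun x => x * g x) k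
          ((Real.continuous_rpow_const h.symm.nonneg).continuousOn) hcg hksa]
      refine cfc_mono (fun x hx => ?_)
        ((Real.continuous_rpow_const h.symm.nonneg).comp_continuousOn hcg) hpw'.continuousOn
      refine (Real.rpow_le_rpow (mul_nonneg (hk0 hx) (hg0 x hx)) (hxg x hx)
        h.symm.nonneg).trans_eq ?_
      rw [← Real.rpow_mul (hk0 hx), h.sub_one_mul_conj]
  · have h0 : 0 ≤ y * (star y * cfc g k) := by
      rw [star_mul_cfc_abs_star y hg]
      exact cfc_nonneg fun x hx => mul_nonneg (mul_nonneg (hk0 hx) (hk0 hx)) (hg0 x hx)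
    rw [(vecState_eq_re_of_nonneg h0).2, Complex.norm_real,
      Real.norm_of_nonneg (vecState_re_nonneg h0), star_mul_cfc_abs_star y hg, absPow_eq_cfc,
      absPow_eq_cfc, ← hk]
    have h1 : (vecState Ω (cfc (fun x : ℝ => x ^ r - ε * x ^ (r - 1)) k)).re
        = (vecState Ω (cfc (fun x : ℝ => x ^ r) k)).re
          - ε * (vecState Ω (cfc (fun x : ℝ => x ^ (r - 1)) k)).re := by
      rw [cfc_sub _ _ k hpw'.continuousOn (hpw.continuousOn.const_mul ε) ,
        cfc_const_mul ε _ k hpw.continuousOn, vecState_sub, Complex.sub_re,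
        RCLike.real_smul_eq_coe_smul (K := ℂ), vecState_smul]
      simp
    rw [← h1]
    refine vecState_re_mono (cfc_mono (fun x hx => ?_)
      (hpw'.continuousOn.sub (hpw.continuousOn.const_mul ε))
      ((continuousOn_id.mul continuousOn_id).mul hg))
    have hx0 := hk0 hx
    have h2 := Real.rpow_nonneg hx0 (r - 1)
    rw [← hxr hx0, hgdef]
    simp only
    rw [← mul_div_assoc, le_div_iff₀ (by linarith)]
    nlinarith [mul_nonneg (sq_nonneg ε) h2]

/-- With T = τ(|y^*|^p), testing on the dual elements and letting ε → 0 gives T ≤ C T^{1-1/p}, that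
is, T^{1/p} ≤ C. The conclusion concerns y^* because the dual element is built from |y^*|. -/
lemma vecLpNorm_star_le_of_forall {p q : ℝ≥0∞} (hpq : p.HolderConjugate q) (hp : p ≠ ∞)
    {y : H →L[ℂ] H} (hy : y ∈ M) {C : ℝ} (hC : 0 ≤ C)
    (h : ∀ b ∈ M, ‖vecState Ω (y * b)‖ ≤ C * vecLpNorm Ω q b) :
    vecLpNorm Ω p (star y) ≤ C := by
  have hr1 : 0 < p.toReal := ENNReal.toReal_pos (ENNReal.HolderConjugate.ne_zero p q) hp
  set T := (vecState Ω (absPow (star y) p.toReal)).re with hT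
  have hT0 : 0 ≤ T := vecState_re_nonneg (absPow_nonneg _ _)
  set S := (vecState Ω (absPow (star y) (p.toReal - 1))).re with hS
  have key : T ≤ C * T ^ (1 - 1 / p.toReal) := by
    have hlim : Tendsto (fun ε : ℝ => T - ε * S) (𝓝[>] 0) (𝓝 (T - 0 * S)) :=
      ((by fun_prop : Continuous fun ε : ℝ => T - ε * S).tendsto 0).mono_left nhdsWithin_le_nhds
    rw [zero_mul, sub_zero] at hlim
    refine le_of_tendsto hlim ?_
    filter_upwards [self_mem_nhdsWithin] with ε hε
    obtain ⟨b, hb, hb1, hb2⟩ := exists_dual_element (Ω := Ω) hpq hp hy hε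
    exact hb2.trans ((h b hb).trans (mul_le_mul_of_nonneg_left hb1 hC))
  rw [vecLpNorm_of_ne_top hp, ← hT]
  rcases hT0.eq_or_lt with h0 | h0
  · rw [← h0, Real.zero_rpow (one_div_pos.2 hr1).ne']
    exact hC
  · have h2 : T ^ (1 - 1 / p.toReal) * T ^ (1 / p.toReal) = T := by
      rw [← Real.rpow_add h0, sub_add_cancel, Real.rpow_one]
    have h3 := Real.rpow_pos_of_pos h0 (1 - 1 / p.toReal)
    refine le_of_mul_le_mul_left ?_ h3
    rw [h2, mul_comm]
    exact key

/-- Hölder's inequality for y supplies the hypothesis of the previous bound. Applied to y^*, this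
transfers the duality from y^* back to y. -/
lemma vecLpNorm_star_le (hM : IsTracial M Ω) {p q : ℝ≥0∞} (hpq : p.HolderConjugate q) (hp : p ≠ ∞)
    {y : H →L[ℂ] H} (hy : y ∈ M) : vecLpNorm Ω p (star y) ≤ vecLpNorm Ω p y :=
  vecLpNorm_star_le_of_forall hpq hp hy (vecLpNorm_nonneg p y) fun _ hb =>
    norm_vecState_mul_le_vecLpNorm hM hpq hy hb

lemma vecLpNorm_le_of_forall_of_ne_top (hM : IsTracial M Ω) {p q : ℝ≥0∞}
    (hpq : p.HolderConjugate q) (hp : p ≠ ∞) {y : H →L[ℂ] H} (hy : y ∈ M) {C : ℝ} (hC : 0 ≤ C)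
    (h : ∀ b ∈ M, ‖vecState Ω (y * b)‖ ≤ C * vecLpNorm Ω q b) : vecLpNorm Ω p y ≤ C := by
  have := vecLpNorm_star_le hM hpq hp (star_mem hy)
  rw [star_star] at this
  exact this.trans (vecLpNorm_star_le_of_forall hpq hp hy hC h)

lemma vecLpNorm_one_mul_star_le (hM : IsTracial M Ω) {e c : H →L[ℂ] H} (he : e ∈ M) (hc : c ∈ M) :
    vecLpNorm Ω 1 (e * star c) ≤ ‖e Ω‖ * ‖c Ω‖ := by
  have hpq : (1 : ℝ≥0∞).HolderConjugate ∞ := inferInstance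
  refine vecLpNorm_le_of_forall_of_ne_top hM hpq ENNReal.one_ne_top (mul_mem he (star_mem hc))
    (by positivity) fun b hb => ?_
  rw [mul_assoc, hM _ he _ (mul_mem (star_mem hc) hb), mul_assoc, vecState_mul, star_star,
    vecLpNorm_top]
  calc _ ≤ ‖c Ω‖ * ‖b (e Ω)‖ := norm_inner_le_norm _ _
    _ ≤ ‖c Ω‖ * (‖b‖ * ‖e Ω‖) := by gcongr; exact b.le_opNorm _
    _ = _ := by ring

/-- For p = ∞ the test elements are e c^*: by the trace property τ(y e c^*) is the matrix
coefficient of y between cΩ and eΩ, while ‖e c^*‖_1 ≤ ‖eΩ‖ ‖cΩ‖. Density of MΩ then bounds the whole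
sesquilinear form. -/
lemma norm_le_of_forall_vecState (hM : IsTracial M Ω)
    (hD : Dense ((fun y : H →L[ℂ] H => y Ω) '' (M : Set (H →L[ℂ] H))))
    {y : H →L[ℂ] H} (hy : y ∈ M) {C : ℝ} (hC : 0 ≤ C)
    (h : ∀ b ∈ M, ‖vecState Ω (y * b)‖ ≤ C * vecLpNorm Ω 1 b) : ‖y‖ ≤ C := by
  have h1 : ∀ e ∈ M, ∀ c ∈ M, ‖⟪c Ω, y (e Ω)⟫_ℂ‖ ≤ C * (‖e Ω‖ * ‖c Ω‖) := by
    intro e he c hc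
    have h2 : ⟪c Ω, y (e Ω)⟫_ℂ = vecState Ω (y * (e * star c)) := by
      rw [← mul_assoc, hM _ (mul_mem hy he) _ (star_mem hc), vecState_mul, star_star]
      rfl
    rw [h2]
    exact (h _ (mul_mem he (star_mem hc))).trans
      (mul_le_mul_of_nonneg_left (vecLpNorm_one_mul_star_le hM he hc) hC)
  have h3 : ∀ ξ η : H, ‖⟪ξ, y η⟫_ℂ‖ ≤ C * (‖η‖ * ‖ξ‖) := by
    intro ξ η
    refine hD.induction (P := fun η => ‖⟪ξ, y η⟫_ℂ‖ ≤ C * (‖η‖ * ‖ξ‖)) ?_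
      (isClosed_le (by fun_prop) (by fun_prop)) η
    rintro _ ⟨e, he, rfl⟩
    refine hD.induction (P := fun ξ => ‖⟪ξ, y (e Ω)⟫_ℂ‖ ≤ C * (‖e Ω‖ * ‖ξ‖)) ?_
      (isClosed_le (by fun_prop) (by fun_prop)) ξ
    rintro _ ⟨c, hc, rfl⟩
    exact h1 e he c hc
  refine y.opNorm_le_bound hC fun η => ?_
  have h4 := h3 (y η) η
  rw [inner_self_eq_norm_sq_to_K, norm_pow, RCLike.norm_ofReal, abs_norm] at h4
  rcases (norm_nonneg (y η)).eq_or_lt with h0 | h0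
  · rw [← h0]
    positivity
  · nlinarith

/-- The `L_p`-norm is the norm of the functional `b ↦ τ(y b)` on `L_q`. -/
theorem vecLpNorm_le_of_forall (hM : IsTracial M Ω)
    (hD : Dense ((fun y : H →L[ℂ] H => y Ω) '' (M : Set (H →L[ℂ] H)))) {p q : ℝ≥0∞}
    (hpq : p.HolderConjugate q) {y : H →L[ℂ] H} (hy : y ∈ M) {C : ℝ} (hC : 0 ≤ C)
    (h : ∀ b ∈ M, ‖vecState Ω (y * b)‖ ≤ C * vecLpNorm Ω q b) : vecLpNorm Ω p y ≤ C := by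
  by_cases hp : p = ∞
  · subst hp
    rcases holderConjugate_cases hpq with ⟨h1, -⟩ | ⟨-, rfl⟩ | ⟨h1, -⟩
    · exact absurd h1 ENNReal.top_ne_one
    · rw [vecLpNorm_top]
      exact norm_le_of_forall_vecState hM hD hy hC h
    · exact absurd rfl h1
  · exact vecLpNorm_le_of_forall_of_ne_top hM hpq hp hy hC h

/-! ### Unitary invariance -/

/-- Conjugation by a unitary is a continuous star automorphism and so commutes with the functional
calculus; p ≥ 0 makes x ↦ x^p continuous at 0. -/
lemma absPow_conj (U : unitary (H →L[ℂ] H)) (y : H →L[ℂ] H) {p : ℝ} (hp : 0 ≤ p) :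
    absPow ((U : H →L[ℂ] H) * y * star (U : H →L[ℂ] H)) p
      = (U : H →L[ℂ] H) * absPow y p * star (U : H →L[ℂ] H) := by
  let φ : (H →L[ℂ] H) ≃⋆ₐ[ℂ] (H →L[ℂ] H) := Unitary.conjStarAlgAut ℂ (H →L[ℂ] H) U
  have hφ : ∀ z, φ z = (U : H →L[ℂ] H) * z * star (U : H →L[ℂ] H) := fun z => rfl
  have hφc : Continuous φ := by
    have : (φ : (H →L[ℂ] H) → (H →L[ℂ] H))
        = fun z => (U : H →L[ℂ] H) * z * star (U : H →L[ℂ] H) := rfl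
    rw [this]
    fun_prop
  have h1 : ∀ (f : ℝ → ℝ) (a : H →L[ℂ] H), 0 ≤ a → ContinuousOn f (spectrum ℝ a) →
      φ (cfc f a) = cfc f (φ a) := by
    intro f a ha hf
    have hsa : IsSelfAdjoint a := IsSelfAdjoint.of_nonneg ha
    exact StarAlgHomClass.map_cfc φ f a hf hφc hsa (hsa.map φ)
  have hpos : 0 ≤ φ (CFC.abs y) := by
    rw [hφ]
    exact star_right_conjugate_nonneg (CFC.abs_nonneg y) _
  have habs : CFC.abs (φ y) = φ (CFC.abs y) := by
    rw [CFC.abs]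
    refine CFC.sqrt_unique ?_ hpos
    rw [← map_mul, CFC.abs_mul_abs, map_mul, map_star]
  rw [← hφ, ← hφ, absPow_eq_cfc, absPow_eq_cfc, habs, h1 _ _ (CFC.abs_nonneg y)
    (Real.continuous_rpow_const hp).continuousOn]

lemma vecLpNorm_conj (U : unitary (H →L[ℂ] H)) (hU : star (U : H →L[ℂ] H) Ω = Ω) (p : ℝ≥0∞)
    (y : H →L[ℂ] H) :
    vecLpNorm Ω p ((U : H →L[ℂ] H) * y * star (U : H →L[ℂ] H)) = vecLpNorm Ω p y := by
  by_cases hp : p = ∞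
  · subst hp
    rw [vecLpNorm_top, vecLpNorm_top, ← Unitary.coe_star, CStarRing.norm_mul_coe_unitary,
      CStarRing.norm_coe_unitary_mul]
  · rw [vecLpNorm_of_ne_top hp, vecLpNorm_of_ne_top hp, absPow_conj U y ENNReal.toReal_nonneg,
      mul_assoc, vecState_mul, hU, mul_apply_eq_comp, hU]
    rfl

end QuantumTorus

end

section

namespace QuantumTorus

variable {d : ℕ}

/-! ### The smooth algebra as operators -/

lemma isTracial_torus (θ : Matrix (Fin d) (Fin d) ℝ) : IsTracial (torus θ) (basisVec 0) :=
  fun _ hx _ hy => trace_mul_comm hx hy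

lemma hasSum_basisVec (f : Hilb d) : HasSum (fun n => f n • basisVec n) f := by
  have := lp.hasSum_single (p := 2) (by norm_num) f
  convert this using 2 with n
  rw [basisVec, ← lp.single_smul, smul_eq_mul, mul_one]

lemma dense_torus (θ : Matrix (Fin d) (Fin d) ℝ) :
    Dense ((fun y : Op d => y (basisVec 0)) '' (torus θ : Set (Op d))) := by
  intro f
  refine mem_closure_of_tendsto (hasSum_basisVec f) (Eventually.of_forall fun s => ?_)
  refine ⟨∑ n ∈ s, f n • monomial θ n,
    sum_mem fun n _ => smul_mem_torus _ (monomial_mem_torus θ n), ?_⟩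
  simp [monomial_basisVec_zero]

/-- The vector at 0 is separating: its image under y fixes all the images of basis vectors through
right multiplications. -/
lemma ext_of_mem_torus {θ : Matrix (Fin d) (Fin d) ℝ} {y z : Op d} (hy : y ∈ torus θ)
    (hz : z ∈ torus θ) (h : y (basisVec 0) = z (basisVec 0)) : y = z := by
  ext1 f
  have hn : ∀ n, y (basisVec n) = z (basisVec n) := fun n => by
    rw [apply_basisVec_of_mem_torus hy, apply_basisVec_of_mem_torus hz, h]
  have h1 := (hasSum_basisVec f).mapL y
  have h2 := (hasSum_basisVec f).mapL z
  simp only [map_smul, hn] at h1 h2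
  exact h1.unique h2

/-- A finite set of lattice points lies in the box of its coordinate projections, over which the sum
factorises. -/
lemma summable_prod_of_summable {g : ℤ → ℝ} (hg : Summable g) (hg0 : ∀ z, 0 ≤ g z) :
    Summable fun n : Fin d → ℤ => ∏ j, g (n j) := by
  classical
  refine summable_of_sum_le (c := ∏ _j : Fin d, ∑' z, g z)
    (fun n => Finset.prod_nonneg fun _ _ => hg0 _) fun s => ?_
  calc ∑ n ∈ s, ∏ j, g (n j)
      ≤ ∑ n ∈ Fintype.piFinset fun j => s.image fun n => n j, ∏ j, g (n j) := by
        refine Finset.sum_le_sum_of_subset_of_nonneg (fun n hn => ?_)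
          fun _ _ _ => Finset.prod_nonneg fun _ _ => hg0 _
        exact Fintype.mem_piFinset.2 fun j => Finset.mem_image_of_mem _ hn
    _ = ∏ j, ∑ z ∈ s.image fun n => n j, g z := by rw [Finset.prod_univ_sum]
    _ ≤ ∏ _j : Fin d, ∑' z, g z := by
        refine Finset.prod_le_prod (fun _ _ => Finset.sum_nonneg fun _ _ => hg0 _) fun j _ => ?_
        exact hg.sum_le_tsum _ fun _ _ => hg0 _

/-- The exponent 2d leaves a square for each coordinate: (1 + ‖n‖)^{2d} dominates the product of the
(1 + |n_j|)². -/
lemma summable_one_add_norm_pow : Summable fun n : Fin d → ℤ => ((1 + ‖n‖) ^ (2 * d))⁻¹ := by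
  have h1 : Summable fun z : ℤ => ((1 + |(z : ℝ)|) ^ 2)⁻¹ := by
    -- The comparison with 1/z² fails only at z = 0, where the quotient takes the value 0.
    refine Summable.of_norm_bounded_eventually
      (g := fun z : ℤ => 1 / (z : ℝ) ^ 2) (Real.summable_one_div_int_pow.2 one_lt_two) ?_
    rw [Filter.eventually_cofinite]
    refine (Set.finite_singleton (0 : ℤ)).subset fun z hz => ?_
    by_contra hz0
    refine hz ?_
    have hz1 : (z : ℝ) ≠ 0 := by exact_mod_cast hz0
    rw [Real.norm_of_nonneg (by positivity), one_div, ← sq_abs (z : ℝ)]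
    have := abs_pos.2 hz1
    gcongr
    linarith
  refine (summable_prod_of_summable (d := d) h1 fun z => by positivity).of_nonneg_of_le
    (fun n => by positivity) fun n => ?_
  rw [Finset.prod_inv_distrib]
  refine inv_anti₀ (Finset.prod_pos fun j _ => by positivity) ?_
  calc ∏ j, (1 + |((n j : ℤ) : ℝ)|) ^ 2 ≤ ∏ _j : Fin d, (1 + ‖n‖) ^ 2 := by
        refine Finset.prod_le_prod (fun _ _ => by positivity) fun j _ => ?_
        gcongr
        rw [← Int.norm_eq_abs]
        exact norm_le_pi_norm n j
    _ = (1 + ‖n‖) ^ (2 * d) := by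
        rw [Finset.prod_const, Finset.card_univ, Fintype.card_fin, ← pow_mul]

lemma summable_one_add_norm_pow_mul (a : Smooth d) (N : ℕ) :
    Summable fun n => (1 + ‖n‖) ^ N * ‖a.1 n‖ := by
  obtain ⟨C, hC⟩ := a.2 (N + 2 * d)
  refine (summable_one_add_norm_pow.mul_left C).of_nonneg_of_le (fun n => by positivity)
    fun n => ?_
  rw [← div_eq_mul_inv, le_div_iff₀ (by positivity)]
  calc _ = (1 + ‖n‖) ^ (N + 2 * d) * ‖a.1 n‖ := by ring
    _ ≤ C := hC n

lemma summable_norm_smooth (a : Smooth d) : Summable fun n => ‖a.1 n‖ := by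
  simpa using summable_one_add_norm_pow_mul a 0

lemma norm_smul_monomial_le (θ : Matrix (Fin d) (Fin d) ℝ) (c : ℂ) (n : Fin d → ℤ) :
    ‖c • monomial θ n‖ ≤ ‖c‖ := by
  rw [norm_smul]
  exact mul_le_of_le_one_right (norm_nonneg _) (norm_monomial_le θ n)

lemma summable_toOp (θ : Matrix (Fin d) (Fin d) ℝ) (a : Smooth d) :
    Summable fun n => a.1 n • monomial θ n :=
  Summable.of_norm_bounded (summable_norm_smooth a) fun n => norm_smul_monomial_le θ _ n

lemma norm_toOp_le (θ : Matrix (Fin d) (Fin d) ℝ) (a : Smooth d) :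
    ‖toOp θ a‖ ≤ ∑' n, ‖a.1 n‖ :=
  tsum_of_norm_bounded (summable_norm_smooth a).hasSum fun n => norm_smul_monomial_le θ _ n

lemma toOp_mem_torus (θ : Matrix (Fin d) (Fin d) ℝ) (a : Smooth d) : toOp θ a ∈ torus θ :=
  (isClosed_torus θ).mem_of_tendsto (summable_toOp θ a).hasSum
    (Eventually.of_forall fun _ => sum_mem fun n _ => smul_mem_torus _ (monomial_mem_torus θ n))

lemma toOp_basisVec_zero (θ : Matrix (Fin d) (Fin d) ℝ) (a : Smooth d) (k : Fin d → ℤ) :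
    toOp θ a (basisVec 0) k = a.1 k := by
  have h := ((summable_toOp θ a).hasSum.mapL
    (ContinuousLinearMap.apply ℂ (Hilb d) (basisVec (0 : Fin d → ℤ)))).mapL
      (innerSL ℂ (basisVec k))
  have h2 := hasSum_single (f := fun n => (innerSL ℂ (basisVec k))
    ((ContinuousLinearMap.apply ℂ (Hilb d) (basisVec (0 : Fin d → ℤ))) (a.1 n • monomial θ n))) k
    fun n hn => by
      simp [monomial_basisVec_zero, inner_basisVec, basisVec_apply, hn.symm]
  have h3 := h.unique h2
  simp only [innerSL_apply_apply, ContinuousLinearMap.apply_apply, inner_basisVec] at h3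
  rw [toOp, h3]
  simp [monomial_basisVec_zero, basisVec_apply]

/-! ### Translations -/

lemma norm_torusChar (u : EuclideanSpace ℝ (Fin d)) (n : Fin d → ℤ) : ‖torusChar u n‖ = 1 := by
  rw [torusChar, Complex.norm_exp_ofReal_mul_I]

lemma torusChar_zero_right (u : EuclideanSpace ℝ (Fin d)) : torusChar u 0 = 1 := by
  simp [torusChar]

lemma torusChar_add_right (u : EuclideanSpace ℝ (Fin d)) (m n : Fin d → ℤ) :
    torusChar u (m + n) = torusChar u m * torusChar u n := by
  rw [torusChar, torusChar, torusChar, ← Complex.exp_add, ← add_mul, ← Complex.ofReal_add,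
    ← mul_add, ← Finset.sum_add_distrib]
  simp [mul_add]

lemma torusChar_add_left (u v : EuclideanSpace ℝ (Fin d)) (n : Fin d → ℤ) :
    torusChar (u + v) n = torusChar u n * torusChar v n := by
  rw [torusChar, torusChar, torusChar, ← Complex.exp_add, ← add_mul, ← Complex.ofReal_add,
    ← mul_add, ← Finset.sum_add_distrib]
  simp [add_mul]

lemma torusChar_neg_right (u : EuclideanSpace ℝ (Fin d)) (n : Fin d → ℤ) :
    torusChar u (-n) = starRingEnd ℂ (torusChar u n) := by
  rw [torusChar, torusChar, ← Complex.exp_conj, map_mul, Complex.conj_ofReal, Complex.conj_I]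
  simp

/-- The unitary `V_u` of `ℓ²(ℤ^d)` which implements the translation `T_u`. -/
def charMul (u : EuclideanSpace ℝ (Fin d)) : Hilb d ≃ₗᵢ[ℂ] Hilb d :=
  weightedPerm (Equiv.refl _) (torusChar u) fun _ => norm_torusChar u _

lemma charMul_apply (u : EuclideanSpace ℝ (Fin d)) (f : Hilb d) (n : Fin d → ℤ) :
    charMul u f n = torusChar u n * f n := rfl

/-- The unitary `V_u` as an element of the unitary group. -/
def charUnitary (u : EuclideanSpace ℝ (Fin d)) : unitary (Op d) :=
  ⟨(charMul u : Op d), isometryEquiv_mem_unitary _⟩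

/-- The translation `T_u y = V_u y V_u^*` of bounded operators. -/
def opTranslate (u : EuclideanSpace ℝ (Fin d)) (y : Op d) : Op d :=
  (charUnitary u : Op d) * y * star (charUnitary u : Op d)

lemma star_charUnitary (u : EuclideanSpace ℝ (Fin d)) :
    star (charUnitary u : Op d) = ((charMul u).symm : Op d) := star_isometryEquiv _

lemma star_charUnitary_basisVec_zero (u : EuclideanSpace ℝ (Fin d)) :
    star (charUnitary u : Op d) (basisVec 0) = basisVec 0 := by
  rw [star_charUnitary]
  change (charMul u).symm _ = _
  rw [LinearIsometryEquiv.symm_apply_eq, charMul, weightedPerm_basisVec]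
  simp [torusChar_zero_right]

lemma opTranslate_basisVec_zero (u : EuclideanSpace ℝ (Fin d)) (y : Op d) (n : Fin d → ℤ) :
    opTranslate u y (basisVec 0) n = torusChar u n * y (basisVec 0) n := by
  have : opTranslate u y (basisVec 0) = charMul u (y (star (charUnitary u : Op d) (basisVec 0))) :=
    rfl
  rw [this, star_charUnitary_basisVec_zero, charMul_apply]

lemma opTranslate_genOp (θ : Matrix (Fin d) (Fin d) ℝ) (u : EuclideanSpace ℝ (Fin d))
    (j : Fin d) :
    (charUnitary u : Op d) * genOp θ j
      = torusChar u (Pi.single j 1) • (genOp θ j * (charUnitary u : Op d)) := by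
  ext f n
  change charMul u (gen θ j f) n = torusChar u (Pi.single j 1) * gen θ j (charMul u f) n
  rw [charMul_apply, gen_apply, gen_apply, charMul_apply]
  have : torusChar u n = torusChar u (Pi.single j 1) * torusChar u (n - Pi.single j 1) := by
    rw [← torusChar_add_right, add_sub_cancel]
  rw [this]
  ring

/-- Conjugation by V_u multiplies each generator by a scalar, so conjugation by V_u^* preserves the
commutant of the generators, and hence T_u preserves the bicommutant. -/
lemma opTranslate_mem_torus {θ : Matrix (Fin d) (Fin d) ℝ} (u : EuclideanSpace ℝ (Fin d))
    {y : Op d} (hy : y ∈ torus θ) : opTranslate u y ∈ torus θ := by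
  set V : Op d := (charUnitary u : Op d) with hV
  have hU1 : star V * V = 1 := Unitary.coe_star_mul_self (charUnitary u)
  have hU2 : V * star V = 1 := Unitary.coe_mul_star_self (charUnitary u)
  refine mem_torus_of_commute fun c hc => ?_
  have h1 : (star V * c * V) * y = y * (star V * c * V) := by
    refine commute_of_mem_torus hy fun j => ?_
    have hne : torusChar u (Pi.single j 1) ≠ 0 := fun h => by
      simpa [h] using norm_torusChar u (Pi.single j 1)
    have hg := opTranslate_genOp θ u j
    rw [← hV] at hg
    have hg' : star V * genOp θ j = (torusChar u (Pi.single j 1))⁻¹ • (genOp θ j * star V) := by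
      have h2 : star V * (V * genOp θ j) * star V
          = star V * (torusChar u (Pi.single j 1) • (genOp θ j * V)) * star V := by rw [hg]
      rw [← mul_assoc, hU1, one_mul, mul_smul_comm, smul_mul_assoc, mul_assoc, mul_assoc, hU2,
        mul_one] at h2
      rw [h2, smul_smul, inv_mul_cancel₀ hne, one_smul]
    have hg2 : genOp θ j * star V = torusChar u (Pi.single j 1) • (star V * genOp θ j) := by
      rw [hg', smul_smul, mul_inv_cancel₀ hne, one_smul]
    calc genOp θ j * (star V * c * V) = (genOp θ j * star V) * c * V := by simp only [mul_assoc]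
      _ = torusChar u (Pi.single j 1) • (star V * (genOp θ j * c) * V) := by
          rw [hg2]; simp only [smul_mul_assoc, mul_assoc]
      _ = star V * c * (torusChar u (Pi.single j 1) • (genOp θ j * V)) := by
          rw [hc j]; simp only [mul_smul_comm, mul_assoc]
      _ = star V * c * V * genOp θ j := by rw [← hg]; simp only [mul_assoc]
  change c * (V * y * star V) = V * y * star V * c
  calc c * (V * y * star V) = (V * star V) * c * (V * y * star V) := by rw [hU2, one_mul]
    _ = V * ((star V * c * V) * y) * star V := by simp only [mul_assoc]
    _ = V * (y * (star V * c * V)) * star V := by rw [h1]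
    _ = V * y * star V * c * (V * star V) := by simp only [mul_assoc]
    _ = V * y * star V * c := by rw [hU2, mul_one]

lemma opLpNorm_opTranslate (u : EuclideanSpace ℝ (Fin d)) (p : ℝ≥0∞) (y : Op d) :
    opLpNorm p (opTranslate u y) = opLpNorm p y :=
  vecLpNorm_conj (charUnitary u) (star_charUnitary_basisVec_zero u) p y

lemma toOp_translate (θ : Matrix (Fin d) (Fin d) ℝ) (u : EuclideanSpace ℝ (Fin d)) (a : Smooth d) :
    toOp θ (translate u a) = opTranslate u (toOp θ a) := by
  refine ext_of_mem_torus (toOp_mem_torus θ _) (opTranslate_mem_torus u (toOp_mem_torus θ a)) ?_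
  ext n
  rw [toOp_basisVec_zero, opTranslate_basisVec_zero, toOp_basisVec_zero]
  rfl

lemma opTranslate_sub (u : EuclideanSpace ℝ (Fin d)) (x y : Op d) :
    opTranslate u (x - y) = opTranslate u x - opTranslate u y := by
  simp only [opTranslate, mul_sub, sub_mul]

/-- The trace pairs the coefficient of y at -n with that of a at n, and e_u(-n) = e_{-u}(n). This
matches T_u on operators with T_u on distributions. -/
lemma trace_opTranslate_mul_toOp (θ : Matrix (Fin d) (Fin d) ℝ) (u : EuclideanSpace ℝ (Fin d))
    {y : Op d} (hy : y ∈ torus θ) (a : Smooth d) :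
    trace (opTranslate u y * toOp θ a) = trace (y * toOp θ (translate (-u) a)) := by
  rw [trace_mul_eq_tsum (opTranslate_mem_torus u hy), trace_mul_eq_tsum hy]
  refine tsum_congr fun n => ?_
  rw [opTranslate_basisVec_zero, toOp_basisVec_zero, toOp_basisVec_zero]
  change _ = _ * (torusChar (-u) n * a.1 n)
  have : torusChar u (-n) = torusChar (-u) n := by simp [torusChar]
  rw [this]
  ring

/-! ### The `L_p`-norms on the quantum torus -/

lemma opLpNorm_nonneg (p : ℝ≥0∞) (y : Op d) : 0 ≤ opLpNorm p y := vecLpNorm_nonneg p y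

/-- Hölder's inequality on the quantum torus. -/
lemma norm_trace_mul_le_opLpNorm {θ : Matrix (Fin d) (Fin d) ℝ} {p q : ℝ≥0∞}
    (hpq : p.HolderConjugate q) {y b : Op d} (hy : y ∈ torus θ) (hb : b ∈ torus θ) :
    ‖trace (y * b)‖ ≤ opLpNorm p y * opLpNorm q b :=
  norm_vecState_mul_le_vecLpNorm (isTracial_torus θ) hpq hy hb

lemma opLpNorm_le_of_forall {θ : Matrix (Fin d) (Fin d) ℝ} {p q : ℝ≥0∞}
    (hpq : p.HolderConjugate q) {y : Op d} (hy : y ∈ torus θ) {C : ℝ} (hC : 0 ≤ C)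
    (h : ∀ b ∈ torus θ, ‖trace (y * b)‖ ≤ C * opLpNorm q b) : opLpNorm p y ≤ C :=
  vecLpNorm_le_of_forall (isTracial_torus θ) (dense_torus θ) hpq hy hC h

/-- Minkowski's inequality. -/
lemma opLpNorm_add_le {θ : Matrix (Fin d) (Fin d) ℝ} {p : ℝ≥0∞} (hp : 1 ≤ p) {x y : Op d}
    (hx : x ∈ torus θ) (hy : y ∈ torus θ) : opLpNorm p (x + y) ≤ opLpNorm p x + opLpNorm p y := by
  obtain ⟨q, hpq⟩ : ∃ q : ℝ≥0∞, p.HolderConjugate q := ⟨_, .conjExponent hp⟩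
  refine opLpNorm_le_of_forall hpq (add_mem hx hy)
    (add_nonneg (opLpNorm_nonneg p x) (opLpNorm_nonneg p y)) fun b hb => ?_
  rw [add_mul, trace_add, add_mul]
  exact (norm_add_le _ _).trans (add_le_add (norm_trace_mul_le_opLpNorm hpq hx hb)
    (norm_trace_mul_le_opLpNorm hpq hy hb))

lemma opLpNorm_smul_le {θ : Matrix (Fin d) (Fin d) ℝ} {p : ℝ≥0∞} (hp : 1 ≤ p) (c : ℂ) {x : Op d}
    (hx : x ∈ torus θ) : opLpNorm p (c • x) ≤ ‖c‖ * opLpNorm p x := by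
  obtain ⟨q, hpq⟩ : ∃ q : ℝ≥0∞, p.HolderConjugate q := ⟨_, .conjExponent hp⟩
  refine opLpNorm_le_of_forall hpq (smul_mem_torus c hx)
    (mul_nonneg (norm_nonneg c) (opLpNorm_nonneg p x)) fun b hb => ?_
  rw [smul_mul_assoc, trace_smul, norm_mul, mul_assoc]
  exact mul_le_mul_of_nonneg_left (norm_trace_mul_le_opLpNorm hpq hx hb) (norm_nonneg c)

end QuantumTorus

end

section

namespace QuantumTorus

variable {d : ℕ}

/-! ### Fejér means -/

/-- Lebesgue measure on the cube `(0,1]^d`. -/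
def cubeMeasure (d : ℕ) : Measure (Fin d → ℝ) :=
  Measure.pi fun _ => (volume : Measure ℝ).restrict (Set.Ioc 0 1)

instance : IsProbabilityMeasure (cubeMeasure d) := by
  have : IsProbabilityMeasure ((volume : Measure ℝ).restrict (Set.Ioc 0 1)) :=
    ⟨by simp⟩
  exact inferInstanceAs (IsProbabilityMeasure (Measure.pi fun _ => _))

lemma continuous_torusChar (n : Fin d → ℤ) :
    Continuous fun u : Fin d → ℝ => torusChar (WithLp.toLp 2 u) n := by
  unfold torusChar
  fun_prop

lemma integral_torusChar (n : Fin d → ℤ) :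
    ∫ u, torusChar (WithLp.toLp 2 u) n ∂(cubeMeasure d) = if n = 0 then 1 else 0 := by
  have h1 : ∀ u : Fin d → ℝ, torusChar (WithLp.toLp 2 u) n
      = ∏ j, Complex.exp ((2 * Real.pi * (n j : ℂ) * Complex.I) * (u j : ℂ)) := by
    intro u
    rw [torusChar, ← Complex.exp_sum]
    congr 1
    push_cast
    rw [Finset.mul_sum, Finset.sum_mul]
    exact Finset.sum_congr rfl fun j _ => by ring
  simp_rw [h1]
  rw [cubeMeasure, integral_fintype_prod_eq_prod (𝕜 := ℂ)
    (f := fun j (t : ℝ) => Complex.exp ((2 * Real.pi * (n j : ℂ) * Complex.I) * (t : ℂ)))]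
  have h2 : ∀ z : ℤ, ∫ t in Set.Ioc (0 : ℝ) 1,
      Complex.exp ((2 * Real.pi * (z : ℂ) * Complex.I) * (t : ℂ)) = if z = 0 then 1 else 0 := by
    intro z
    rw [← intervalIntegral.integral_of_le zero_le_one]
    split_ifs with hz
    · simp [hz]
    · have hc : (2 * Real.pi * (z : ℂ) * Complex.I) ≠ 0 := by
        simp [hz, Real.pi_ne_zero]
      rw [integral_exp_mul_complex hc]
      have : Complex.exp (2 * Real.pi * (z : ℂ) * Complex.I * ((1 : ℝ) : ℂ)) = 1 := by
        rw [Complex.exp_eq_one_iff]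
        exact ⟨z, by push_cast; ring⟩
      rw [this]
      simp
  simp_rw [h2]
  split_ifs with hn
  · simp [hn]
  · obtain ⟨j, hj⟩ := Function.ne_iff.1 hn
    exact Finset.prod_eq_zero (Finset.mem_univ j) (if_neg hj)

/-- The Fourier coefficients of the Fejér kernel of a finite set `Q`. -/
def fejerCoeff (Q : Finset (Fin d → ℤ)) (n : Fin d → ℤ) : ℝ :=
  ((Q.filter fun l => n + l ∈ Q).card : ℝ) / Q.card

lemma fejerCoeff_nonneg (Q : Finset (Fin d → ℤ)) (n : Fin d → ℤ) : 0 ≤ fejerCoeff Q n := by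
  unfold fejerCoeff
  positivity

lemma fejerCoeff_le_one (Q : Finset (Fin d → ℤ)) (n : Fin d → ℤ) : fejerCoeff Q n ≤ 1 := by
  unfold fejerCoeff
  refine div_le_one_of_le₀ ?_ (by positivity)
  exact_mod_cast Finset.card_filter_le _ _

/-- The Dirichlet kernel of a finite set `Q`. -/
def dirichletKernel (Q : Finset (Fin d → ℤ)) (u : Fin d → ℝ) : ℂ :=
  ∑ k ∈ Q, torusChar (WithLp.toLp 2 u) k

lemma continuous_dirichletKernel (Q : Finset (Fin d → ℤ)) : Continuous (dirichletKernel Q) :=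
  continuous_finsetSum _ fun k _ => continuous_torusChar k

lemma norm_dirichletKernel_le (Q : Finset (Fin d → ℤ)) (u : Fin d → ℝ) :
    ‖dirichletKernel Q u‖ ≤ Q.card := by
  refine (norm_sum_le _ _).trans ?_
  simp [norm_torusChar]

/-- Expanding |D_Q|² as a double sum over l, k in Q, orthogonality of characters keeps exactly the
pairs with k = n + l. -/
lemma integral_torusChar_mul_normSq (Q : Finset (Fin d → ℤ)) (n : Fin d → ℤ) :
    ∫ u, torusChar (WithLp.toLp 2 u) n * ((‖dirichletKernel Q u‖ ^ 2 : ℝ) : ℂ) ∂(cubeMeasure d)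
      = ((Q.filter fun l => n + l ∈ Q).card : ℂ) := by
  have h1 : ∀ u : Fin d → ℝ,
      torusChar (WithLp.toLp 2 u) n * ((‖dirichletKernel Q u‖ ^ 2 : ℝ) : ℂ)
        = ∑ l ∈ Q, ∑ k ∈ Q, torusChar (WithLp.toLp 2 u) (n + l + -k) := by
    intro u
    have h2 : ((‖dirichletKernel Q u‖ ^ 2 : ℝ) : ℂ)
        = dirichletKernel Q u * starRingEnd ℂ (dirichletKernel Q u) := by
      rw [Complex.mul_conj, Complex.normSq_eq_norm_sq]
    rw [h2, dirichletKernel, map_sum, Finset.sum_mul_sum, Finset.mul_sum]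
    refine Finset.sum_congr rfl fun l _ => ?_
    rw [Finset.mul_sum]
    refine Finset.sum_congr rfl fun k _ => ?_
    rw [torusChar_add_right, torusChar_add_right, torusChar_neg_right, mul_assoc]
  have hint : ∀ m : Fin d → ℤ,
      Integrable (fun u => torusChar (WithLp.toLp 2 u) m) (cubeMeasure d) := fun m =>
    Integrable.of_bound (continuous_torusChar m).aestronglyMeasurable 1
      (Eventually.of_forall fun u => (norm_torusChar _ _).le)
  simp_rw [h1]
  rw [integral_finsetSum _ fun l _ => integrable_finsetSum _ fun k _ => hint _]
  simp_rw [integral_finsetSum _ fun k _ => hint _, integral_torusChar]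
  rw [Finset.card_filter, Nat.cast_sum]
  refine Finset.sum_congr rfl fun l _ => ?_
  by_cases hl : n + l ∈ Q
  · rw [if_pos hl, Finset.sum_eq_single (n + l)]
    · simp
    · intro k _ hk
      rw [if_neg fun h => hk (add_neg_eq_zero.1 h).symm]
    · exact fun h => absurd hl h
  · rw [if_neg hl, Nat.cast_zero]
    refine Finset.sum_eq_zero fun k hk => if_neg fun h => hl ?_
    rwa [add_neg_eq_zero.1 h]

/-- Convolution with the Fejér kernel does not increase the supremum norm. -/
lemma norm_tsum_fejerCoeff_le {Q : Finset (Fin d → ℤ)} (hQ : Q.Nonempty) {f : (Fin d → ℤ) → ℂ}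
    (hf : Summable fun n => ‖f n‖) {K : ℝ}
    (hK : ∀ u : EuclideanSpace ℝ (Fin d), ‖∑' n, torusChar u n * f n‖ ≤ K) :
    ‖∑' n, (fejerCoeff Q n : ℂ) * f n‖ ≤ K := by
  have hcard : (0 : ℝ) < Q.card := by exact_mod_cast hQ.card_pos
  -- Divided by |Q|, this weight is a probability density whose Fourier coefficients are `fejerCoeff
  -- Q`; the estimate is an average of the bound K.
  set w : (Fin d → ℝ) → ℝ := fun u => ‖dirichletKernel Q u‖ ^ 2 with hw
  have hw0 : ∀ u, 0 ≤ w u := fun u => by positivity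
  have hwle : ∀ u, w u ≤ (Q.card : ℝ) ^ 2 := fun u =>
    pow_le_pow_left₀ (norm_nonneg _) (norm_dirichletKernel_le Q u) 2
  have hwc : Continuous w := (continuous_dirichletKernel Q).norm.pow 2
  set F : (Fin d → ℤ) → (Fin d → ℝ) → ℂ :=
    fun n u => f n * (torusChar (WithLp.toLp 2 u) n * (w u : ℂ)) with hF
  have hFn : ∀ n u, ‖F n u‖ ≤ ‖f n‖ * (Q.card : ℝ) ^ 2 := fun n u => by
    rw [hF]
    simp only [norm_mul, norm_torusChar, one_mul, Complex.norm_real, Real.norm_of_nonneg (hw0 u)]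
    exact mul_le_mul_of_nonneg_left (hwle u) (norm_nonneg _)
  have hFm : ∀ n, AEStronglyMeasurable (F n) (cubeMeasure d) := fun n =>
    (continuous_const.mul ((continuous_torusChar n).mul
      (Complex.continuous_ofReal.comp hwc))).aestronglyMeasurable
  have hsum := hasSum_integral_of_dominated_convergence (μ := cubeMeasure d) (F := F)
    (f := fun u => ∑' n, F n u)
    (fun n _ => ‖f n‖ * (Q.card : ℝ) ^ 2) hFm (fun n => Eventually.of_forall (hFn n))
    (Eventually.of_forall fun _ => hf.mul_right _) (integrable_const _)
    (Eventually.of_forall fun u =>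
      (Summable.of_norm_bounded (hf.mul_right _) fun n => hFn n u).hasSum)
  have hint : ∀ n, ∫ u, F n u ∂(cubeMeasure d) = (Q.card : ℂ) * ((fejerCoeff Q n : ℂ) * f n) := by
    intro n
    rw [hF, integral_const_mul, integral_torusChar_mul_normSq, fejerCoeff]
    have : (Q.card : ℂ) ≠ 0 := by exact_mod_cast hcard.ne'
    push_cast
    field_simp
  simp_rw [hint] at hsum
  have hw1 : ∫ u, w u ∂(cubeMeasure d) = Q.card := by
    have := integral_torusChar_mul_normSq Q 0
    simp only [torusChar_zero_right, one_mul, zero_add, Finset.filter_mem_eq_inter,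
      Finset.inter_self] at this
    rw [integral_complex_ofReal] at this
    exact_mod_cast this
  have hmain : ‖∑' n, (Q.card : ℂ) * ((fejerCoeff Q n : ℂ) * f n)‖ ≤ K * Q.card := by
    rw [hsum.tsum_eq, ← hw1, ← integral_const_mul]
    refine norm_integral_le_of_norm_le ((Integrable.of_bound hwc.aestronglyMeasurable
      ((Q.card : ℝ) ^ 2) (Eventually.of_forall fun u => ?_)).const_mul K)
      (Eventually.of_forall fun u => ?_)
    · rw [Real.norm_of_nonneg (hw0 u)]
      exact hwle u
    · have : ∑' n, F n u = (∑' n, torusChar (WithLp.toLp 2 u) n * f n) * (w u : ℂ) := by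
        rw [← tsum_mul_right]
        exact tsum_congr fun n => by rw [hF]; ring
      rw [this, norm_mul, Complex.norm_real, Real.norm_of_nonneg (hw0 u)]
      exact mul_le_mul_of_nonneg_right (hK _) (hw0 u)
  rw [tsum_mul_left, norm_mul, Complex.norm_natCast, mul_comm] at hmain
  exact le_of_mul_le_mul_right hmain hcard

/-- The box `{0, …, N}^d`. -/
def fejerBox (d N : ℕ) : Finset (Fin d → ℤ) := Finset.Icc 0 fun _ => (N : ℤ)

lemma fejerBox_nonempty (N : ℕ) : (fejerBox d N).Nonempty :=
  ⟨0, Finset.mem_Icc.2 ⟨le_rfl, fun _ => by simp⟩⟩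

lemma tendsto_fejerCoeff (n : Fin d → ℤ) :
    Tendsto (fun N => fejerCoeff (fejerBox d N) n) atTop (𝓝 1) := by
  set r : ℕ := ∑ j, (n j).natAbs with hr
  have hnr : ∀ j, |n j| ≤ r := fun j => by
    rw [Int.abs_eq_natAbs, hr]
    exact_mod_cast Finset.single_le_sum (f := fun j => (n j).natAbs) (fun _ _ => Nat.zero_le _)
      (Finset.mem_univ j)
  -- If r bounds every |n_j|, then all l in the smaller box {r, …, N-r}^d stay in the large box
  -- after the shift by n. The ratio of the cardinalities tends to 1.
  have hlow : ∀ᶠ N : ℕ in atTop,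
      (1 - 2 * (r : ℝ) * (1 / ((N : ℝ) + 1))) ^ d ≤ fejerCoeff (fejerBox d N) n := by
    filter_upwards [eventually_ge_atTop (2 * r)] with N hN
    have hsub : Finset.Icc (fun _ : Fin d => (r : ℤ)) (fun _ => (N : ℤ) - r)
        ⊆ (fejerBox d N).filter fun l => n + l ∈ fejerBox d N := by
      intro l hl
      obtain ⟨h1, h2⟩ := Finset.mem_Icc.1 hl
      refine Finset.mem_filter.2 ⟨Finset.mem_Icc.2 ⟨fun j => ?_, fun j => ?_⟩,
        Finset.mem_Icc.2 ⟨fun j => ?_, fun j => ?_⟩⟩ <;>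
      · have h3 := h1 j
        have h4 := h2 j
        have h5 := abs_le.1 (hnr j)
        simp only [Pi.zero_apply, Pi.add_apply] at h3 h4 ⊢
        omega
    have hc1 : (Finset.Icc (fun _ : Fin d => (r : ℤ)) (fun _ => (N : ℤ) - r)).card
        = (N + 1 - 2 * r) ^ d := by
      rw [Pi.card_Icc]
      simp only [Int.card_Icc, Finset.prod_const, Finset.card_univ, Fintype.card_fin]
      congr 1
      omega
    have hc2 : (fejerBox d N).card = (N + 1) ^ d := by
      rw [fejerBox, Pi.card_Icc]
      simp only [Pi.zero_apply, Int.card_Icc, Finset.prod_const, Finset.card_univ,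
        Fintype.card_fin]
      congr 1
    have h := Finset.card_le_card hsub
    rw [hc1] at h
    rw [fejerCoeff, hc2, le_div_iff₀ (by positivity)]
    refine le_trans (le_of_eq ?_) (Nat.cast_le.2 h)
    push_cast [Nat.cast_sub (by omega : 2 * r ≤ N + 1)]
    rw [← mul_pow]
    congr 1
    field_simp
  have hlim : Tendsto (fun N : ℕ => (1 - 2 * (r : ℝ) * (1 / ((N : ℝ) + 1))) ^ d) atTop (𝓝 1) := by
    have := ((tendsto_one_div_add_atTop_nhds_zero_nat (𝕜 := ℝ)).const_mul (2 * (r : ℝ))).const_sub 1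
    simpa using this.pow d
  exact tendsto_of_tendsto_of_tendsto_of_le_of_le' hlim tendsto_const_nhds hlow
    (Eventually.of_forall fun N => fejerCoeff_le_one _ n)

/-! ### Fejér means of operators and testing on smooth elements -/

lemma mem_smooth_of_finite_support {a : (Fin d → ℤ) → ℂ} (ha : a.support.Finite) :
    a ∈ Smooth d := by
  intro N
  refine ⟨∑ n ∈ ha.toFinset, (1 + ‖n‖) ^ N * ‖a n‖, fun n => ?_⟩
  by_cases hn : a n = 0
  · rw [hn, norm_zero, mul_zero]
    exact Finset.sum_nonneg fun _ _ => by positivity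
  · exact Finset.single_le_sum (f := fun n => (1 + ‖n‖) ^ N * ‖a n‖) (fun _ _ => by positivity)
      (ha.mem_toFinset.2 hn)

lemma fejerCoeff_support_finite (Q : Finset (Fin d → ℤ)) :
    (Function.support (fejerCoeff Q)).Finite := by
  refine ((Q ×ˢ Q).image fun x => x.1 - x.2).finite_toSet.subset fun n hn => ?_
  have : (Q.filter fun l => n + l ∈ Q).Nonempty := by
    rw [Finset.nonempty_iff_ne_empty]
    intro h
    exact hn (by rw [fejerCoeff, h, Finset.card_empty, Nat.cast_zero, zero_div])
  obtain ⟨l, hl⟩ := this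
  obtain ⟨h1, h2⟩ := Finset.mem_filter.1 hl
  exact Finset.mem_coe.2 (Finset.mem_image.2 ⟨(n + l, l), Finset.mem_product.2 ⟨h2, h1⟩,
    add_sub_cancel_right n l⟩)

/-- The Fejér mean of an operator. -/
def fejerMean (Q : Finset (Fin d → ℤ)) (b : Op d) : Smooth d :=
  ⟨fun n => (fejerCoeff Q n : ℂ) * b (basisVec 0) n, mem_smooth_of_finite_support
    ((fejerCoeff_support_finite Q).subset fun n hn h => hn (by simp [h]))⟩

lemma summable_trace_mul {θ : Matrix (Fin d) (Fin d) ℝ} {x : Op d} (hx : x ∈ torus θ) (y : Op d) :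
    Summable fun n => ‖rightPhase θ (-n) n * x (basisVec 0) (-n) * y (basisVec 0) n‖ := by
  have := (lp.summable_inner (𝕜 := ℂ) (star x (basisVec 0)) (y (basisVec 0))).norm
  refine this.congr fun n => ?_
  rw [RCLike.inner_apply', star_apply_basisVec_zero hx]

lemma trace_mul_fejerMean {θ : Matrix (Fin d) (Fin d) ℝ} {x : Op d} (hx : x ∈ torus θ)
    (Q : Finset (Fin d → ℤ)) (b : Op d) :
    trace (x * toOp θ (fejerMean Q b)) = ∑' n, (fejerCoeff Q n : ℂ) *
      (rightPhase θ (-n) n * x (basisVec 0) (-n) * b (basisVec 0) n) := by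
  rw [trace_mul_eq_tsum hx]
  refine tsum_congr fun n => ?_
  rw [toOp_basisVec_zero]
  change _ * ((fejerCoeff Q n : ℂ) * b (basisVec 0) n) = _
  ring

/-- Fejér means are contractions of the `L_q`-norms. -/
lemma opLpNorm_fejerMean_le {θ : Matrix (Fin d) (Fin d) ℝ} {q : ℝ≥0∞} (hq : 1 ≤ q)
    {Q : Finset (Fin d → ℤ)} (hQ : Q.Nonempty) {b : Op d} (hb : b ∈ torus θ) :
    opLpNorm q (toOp θ (fejerMean Q b)) ≤ opLpNorm q b := by
  obtain ⟨p, hpq⟩ : ∃ p : ℝ≥0∞, q.HolderConjugate p := ⟨_, .conjExponent hq⟩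
  refine opLpNorm_le_of_forall hpq (toOp_mem_torus θ _) (opLpNorm_nonneg q b) fun c hc => ?_
  rw [trace_mul_comm (toOp_mem_torus θ _) hc, trace_mul_fejerMean hc]
  -- The kernel averages the scalar function u ↦ τ(c T_u b), which Hölder's inequality and
  -- translation invariance bound uniformly in u.
  refine norm_tsum_fejerCoeff_le hQ (summable_trace_mul hc b) fun u => ?_
  have := norm_trace_mul_le_opLpNorm hpq (opTranslate_mem_torus u hb) hc
  rw [opLpNorm_opTranslate, trace_mul_comm (opTranslate_mem_torus u hb) hc,
    trace_mul_eq_tsum hc] at this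
  refine le_trans (le_of_eq ?_) this
  congr 1
  refine tsum_congr fun n => ?_
  rw [opTranslate_basisVec_zero]
  ring

lemma tendsto_trace_mul_fejerMean {θ : Matrix (Fin d) (Fin d) ℝ} {x : Op d} (hx : x ∈ torus θ)
    (b : Op d) :
    Tendsto (fun N => trace (x * toOp θ (fejerMean (fejerBox d N) b))) atTop
      (𝓝 (trace (x * b))) := by
  simp_rw [trace_mul_fejerMean hx]
  rw [trace_mul_eq_tsum hx]
  refine tendsto_tsum_of_dominated_convergence (summable_trace_mul hx b) (fun n => ?_)
    (Eventually.of_forall fun N n => ?_)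
  · have := ((Complex.continuous_ofReal.tendsto 1).comp (tendsto_fejerCoeff n)).mul_const
      (rightPhase θ (-n) n * x (basisVec 0) (-n) * b (basisVec 0) n)
    simpa using this
  · rw [norm_mul, Complex.norm_real, Real.norm_of_nonneg (fejerCoeff_nonneg _ _)]
    exact mul_le_of_le_one_left (norm_nonneg _) (fejerCoeff_le_one _ _)

/-- The `L_p`-norm is determined by testing against smooth elements. -/
lemma opLpNorm_le_of_forall_smooth {θ : Matrix (Fin d) (Fin d) ℝ} {p q : ℝ≥0∞}
    (hpq : p.HolderConjugate q) {y : Op d} (hy : y ∈ torus θ) {C : ℝ} (hC : 0 ≤ C)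
    (h : ∀ a, ‖trace (y * toOp θ a)‖ ≤ C * opLpNorm q (toOp θ a)) : opLpNorm p y ≤ C := by
  refine opLpNorm_le_of_forall hpq hy hC fun b hb => ?_
  refine le_of_tendsto (tendsto_trace_mul_fejerMean hy b).norm (Eventually.of_forall fun N => ?_)
  have hq : 1 ≤ q := ENNReal.HolderConjugate.one_le q p
  exact (h _).trans
    (mul_le_mul_of_nonneg_left (opLpNorm_fejerMean_le hq (fejerBox_nonempty N) hb) hC)

end QuantumTorus

end

section

namespace QuantumTorus
variable {d : ℕ}

/-! ### Distributions in `L_p` -/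

/-- Hölder turns the Cauchy property in L_p into convergence of the functionals in the dual norm,
uniformly over all smooth a. -/
lemma Represents.exists_norm_sub_le {θ : Matrix (Fin d) (Fin d) ℝ} {p q : ℝ≥0∞}
    (hpq : p.HolderConjugate q) {y : ℕ → Op d} {F : Functional d} (h : Represents θ p y F)
    {ε : ℝ} (hε : 0 < ε) :
    ∃ N, ∀ i ≥ N, ∀ a, ‖trace (y i * toOp θ a) - F a‖ ≤ ε * opLpNorm q (toOp θ a) := by
  obtain ⟨N, hN⟩ := h.cauchy ε hε
  refine ⟨N, fun i hi a => ?_⟩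
  refine le_of_tendsto ((tendsto_const_nhds.sub (h.tendsto a)).norm)
    (eventually_atTop.2 ⟨N, fun j hj => ?_⟩)
  rw [← trace_sub, ← sub_mul]
  exact (norm_trace_mul_le_opLpNorm hpq (sub_mem (h.mem i) (h.mem j)) (toOp_mem_torus θ a)).trans
    (mul_le_mul_of_nonneg_right (hN i hi j hj).le (opLpNorm_nonneg _ _))

/-- The `L_p`-norm of a distribution is its norm as a functional for the `L_q`-norm, `q` being the
conjugate exponent. -/
lemma ncLpNorm_le_iff {θ : Matrix (Fin d) (Fin d) ℝ} {p q : ℝ≥0∞}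
    (hpq : p.HolderConjugate q) {F : Functional d} (hF : MemNCLp θ p F) {C : ℝ} (hC : 0 ≤ C) :
    ncLpNorm θ p F ≤ ENNReal.ofReal C ↔ ∀ a, ‖F a‖ ≤ C * opLpNorm q (toOp θ a) := by
  constructor
  · intro h a
    -- The slack ε is there because the infimum over representing sequences need not be attained.
    have key : ∀ ε > 0, ‖F a‖ ≤ (C + ε) * opLpNorm q (toOp θ a) := by
      intro ε hε
      have h1 : ncLpNorm θ p F < ENNReal.ofReal (C + ε) :=
        h.trans_lt ((ENNReal.ofReal_lt_ofReal_iff (by positivity)).2 (by linarith))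
      simp only [ncLpNorm, iInf_lt_iff] at h1
      obtain ⟨y, hy, h2⟩ := h1
      refine le_of_tendsto (hy.tendsto a).norm ?_
      filter_upwards [eventually_lt_of_limsup_lt h2] with i hi
      refine (norm_trace_mul_le_opLpNorm hpq (hy.mem i) (toOp_mem_torus θ a)).trans ?_
      exact mul_le_mul_of_nonneg_right ((ENNReal.ofReal_lt_ofReal_iff (by positivity)).1 hi).le
        (opLpNorm_nonneg _ _)
    have h2 : Tendsto (fun ε : ℝ => (C + ε) * opLpNorm q (toOp θ a)) (𝓝[>] 0)
        (𝓝 ((C + 0) * opLpNorm q (toOp θ a))) :=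
      ((Continuous.tendsto (by fun_prop) 0).mono_left nhdsWithin_le_nhds)
    rw [add_zero] at h2
    exact ge_of_tendsto h2 (eventually_mem_nhdsWithin.mono fun ε hε => key ε hε)
  · intro h
    obtain ⟨y, hy⟩ := hF
    refine ENNReal.le_of_forall_pos_le_add fun ε hε _ => ?_
    -- Far along the sequence y_i is within ε of F as a functional, so its dual norm on smooth
    -- elements, hence its L_p-norm, is at most C + ε.
    obtain ⟨N, hN⟩ := hy.exists_norm_sub_le hpq (ε := ε) hε
    refine (iInf₂_le y hy).trans (limsup_le_of_le (by isBoundedDefault)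
      (eventually_atTop.2 ⟨N, fun i hi => ?_⟩))
    rw [← ENNReal.ofReal_coe_nnreal, ← ENNReal.ofReal_add hC ε.coe_nonneg]
    refine ENNReal.ofReal_le_ofReal
      (opLpNorm_le_of_forall_smooth hpq (hy.mem i) (by positivity) fun a => ?_)
    calc ‖trace (y i * toOp θ a)‖ = ‖F a + (trace (y i * toOp θ a) - F a)‖ := by ring_nf
      _ ≤ C * opLpNorm q (toOp θ a) + ε * opLpNorm q (toOp θ a) :=
        (norm_add_le _ _).trans (add_le_add (h a) (hN i hi a))
      _ = _ := by ring

lemma MemNCLp.ncLpNorm_ne_top {θ : Matrix (Fin d) (Fin d) ℝ} {p : ℝ≥0∞} (hp : 1 ≤ p)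
    {F : Functional d} (hF : MemNCLp θ p F) : ncLpNorm θ p F ≠ ∞ := by
  obtain ⟨q, hpq⟩ : ∃ q : ℝ≥0∞, p.HolderConjugate q := ⟨_, .conjExponent hp⟩
  obtain ⟨y, hy⟩ := id hF
  obtain ⟨N, hN⟩ := hy.exists_norm_sub_le hpq one_pos
  refine ne_top_of_le_ne_top ENNReal.ofReal_ne_top ((ncLpNorm_le_iff hpq hF
    (add_nonneg (opLpNorm_nonneg p (y N)) zero_le_one)).2 fun a => ?_)
  calc ‖F a‖ = ‖trace (y N * toOp θ a) - (trace (y N * toOp θ a) - F a)‖ := by ring_nf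
    _ ≤ opLpNorm p (y N) * opLpNorm q (toOp θ a) + 1 * opLpNorm q (toOp θ a) :=
      (norm_sub_le _ _).trans (add_le_add
        (norm_trace_mul_le_opLpNorm hpq (hy.mem N) (toOp_mem_torus θ a)) (hN N le_rfl a))
    _ = _ := by ring

lemma MemNCLp.norm_apply_le {θ : Matrix (Fin d) (Fin d) ℝ} {p q : ℝ≥0∞}
    (hpq : p.HolderConjugate q) {F : Functional d} (hF : MemNCLp θ p F) (a : Smooth d) :
    ‖F a‖ ≤ (ncLpNorm θ p F).toReal * opLpNorm q (toOp θ a) := by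
  refine (ncLpNorm_le_iff hpq hF ENNReal.toReal_nonneg).1 ?_ a
  rw [ENNReal.ofReal_toReal (hF.ncLpNorm_ne_top hpq.one_le)]

lemma MemNCLp.add {θ : Matrix (Fin d) (Fin d) ℝ} {p : ℝ≥0∞} (hp : 1 ≤ p)
    {F G : Functional d} (hF : MemNCLp θ p F) (hG : MemNCLp θ p G) : MemNCLp θ p (F + G) := by
  obtain ⟨y, hy⟩ := hF
  obtain ⟨z, hz⟩ := hG
  refine ⟨fun i => y i + z i, fun i => add_mem (hy.mem i) (hz.mem i), fun ε hε => ?_, fun a => ?_⟩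
  · obtain ⟨N, hN⟩ := hy.cauchy (ε / 2) (half_pos hε)
    obtain ⟨M, hM⟩ := hz.cauchy (ε / 2) (half_pos hε)
    refine ⟨max N M, fun i hi j hj => ?_⟩
    rw [add_sub_add_comm]
    refine (opLpNorm_add_le hp (sub_mem (hy.mem i) (hy.mem j))
      (sub_mem (hz.mem i) (hz.mem j))).trans_lt ?_
    have h1 := hN i ((le_max_left _ _).trans hi) j ((le_max_left _ _).trans hj)
    have h2 := hM i ((le_max_right _ _).trans hi) j ((le_max_right _ _).trans hj)
    linarith
  · simp only [add_mul, trace_add]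
    exact (hy.tendsto a).add (hz.tendsto a)

lemma MemNCLp.smul {θ : Matrix (Fin d) (Fin d) ℝ} {p : ℝ≥0∞} (hp : 1 ≤ p) (c : ℂ)
    {F : Functional d} (hF : MemNCLp θ p F) : MemNCLp θ p (c • F) := by
  obtain ⟨y, hy⟩ := hF
  refine ⟨fun i => c • y i, fun i => smul_mem_torus c (hy.mem i), fun ε hε => ?_, fun a => ?_⟩
  · obtain ⟨N, hN⟩ := hy.cauchy (ε / (‖c‖ + 1)) (by positivity)
    refine ⟨N, fun i hi j hj => ?_⟩
    rw [← smul_sub]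
    refine (opLpNorm_smul_le hp c (sub_mem (hy.mem i) (hy.mem j))).trans_lt ?_
    have h1 := hN i hi j hj
    rw [lt_div_iff₀ (by positivity)] at h1
    nlinarith [opLpNorm_nonneg p (y i - y j)]
  · simp only [smul_mul_assoc, trace_smul]
    exact (hy.tendsto a).const_mul c

lemma MemNCLp.sub {θ : Matrix (Fin d) (Fin d) ℝ} {p : ℝ≥0∞} (hp : 1 ≤ p)
    {F G : Functional d} (hF : MemNCLp θ p F) (hG : MemNCLp θ p G) : MemNCLp θ p (F - G) := by
  have := hF.add hp (hG.smul hp (-1))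
  rwa [neg_one_smul, ← sub_eq_add_neg] at this

lemma MemNCLp.distTranslate {θ : Matrix (Fin d) (Fin d) ℝ} {p : ℝ≥0∞}
    {F : Functional d} (hF : MemNCLp θ p F) (u : EuclideanSpace ℝ (Fin d)) :
    MemNCLp θ p (distTranslate u F) := by
  obtain ⟨y, hy⟩ := hF
  refine ⟨fun i => opTranslate u (y i), fun i => opTranslate_mem_torus u (hy.mem i),
    fun ε hε => ?_, fun a => ?_⟩
  · simp only [← opTranslate_sub, opLpNorm_opTranslate]
    exact hy.cauchy ε hε
  · simp only [trace_opTranslate_mul_toOp θ u (hy.mem _)]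
    exact hy.tendsto _

lemma MemNCLp.difference_pow {θ : Matrix (Fin d) (Fin d) ℝ} {p : ℝ≥0∞} (hp : 1 ≤ p)
    {F : Functional d} (hF : MemNCLp θ p F) (u : EuclideanSpace ℝ (Fin d)) (k : ℕ) :
    MemNCLp θ p ((difference u ^ k) F) := by
  induction k with
  | zero => exact hF
  | succ k ih =>
    rw [pow_succ']
    exact (ih.distTranslate u).sub hp ih

lemma opLpNorm_toOp_translate (θ : Matrix (Fin d) (Fin d) ℝ) (u : EuclideanSpace ℝ (Fin d))
    (q : ℝ≥0∞) (a : Smooth d) : opLpNorm q (toOp θ (translate u a)) = opLpNorm q (toOp θ a) := by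
  rw [toOp_translate, opLpNorm_opTranslate]

end QuantumTorus

end

section

namespace QuantumTorus
variable {d : ℕ}

/-! ### Fourier multipliers of smooth elements -/

/-- `Q` is the Fourier multiplier with symbol `φ`. -/
def IsMultiplier (Q : Module.End ℂ (Smooth d)) (φ : (Fin d → ℤ) → ℂ) : Prop :=
  ∀ a n, (Q a).1 n = φ n * a.1 n

namespace IsMultiplier

variable {Q R : Module.End ℂ (Smooth d)} {φ ψ : (Fin d → ℤ) → ℂ}

/-- A multiplier is determined by its symbol. Commutation, the multinomial expansion and
polarization of derivations thereby become identities between scalar functions on the lattice. -/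
lemma eq (hQ : IsMultiplier Q φ) (hR : IsMultiplier R ψ) (h : φ = ψ) : Q = R := by
  ext a n
  rw [hQ, hR, h]

lemma one : IsMultiplier (1 : Module.End ℂ (Smooth d)) 1 := fun a n => by simp

lemma mul (hQ : IsMultiplier Q φ) (hR : IsMultiplier R ψ) : IsMultiplier (Q * R) (φ * ψ) :=
  fun a n => by rw [Module.End.mul_apply, hQ, hR, Pi.mul_apply, mul_assoc]

lemma commute (hQ : IsMultiplier Q φ) (hR : IsMultiplier R ψ) : Commute Q R :=
  (hQ.mul hR).eq (hR.mul hQ) (mul_comm _ _)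

lemma pow (hQ : IsMultiplier Q φ) (k : ℕ) : IsMultiplier (Q ^ k) (φ ^ k) := by
  induction k with
  | zero => simpa using one
  | succ k ih => simpa only [pow_succ] using ih.mul hQ

lemma add (hQ : IsMultiplier Q φ) (hR : IsMultiplier R ψ) : IsMultiplier (Q + R) (φ + ψ) :=
  fun a n => by
    change (Q a).1 n + (R a).1 n = _
    rw [hQ, hR, Pi.add_apply, add_mul]

lemma sub (hQ : IsMultiplier Q φ) (hR : IsMultiplier R ψ) : IsMultiplier (Q - R) (φ - ψ) :=
  fun a n => by
    change (Q a).1 n - (R a).1 n = _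
    rw [hQ, hR, Pi.sub_apply, sub_mul]

lemma smul (c : ℂ) (hQ : IsMultiplier Q φ) : IsMultiplier (c • Q) (c • φ) := fun a n => by
  change c * (Q a).1 n = _
  rw [hQ, Pi.smul_apply, smul_eq_mul, mul_assoc]

lemma sum {ι : Type*} (s : Finset ι) {Q : ι → Module.End ℂ (Smooth d)}
    {φ : ι → (Fin d → ℤ) → ℂ} (h : ∀ i ∈ s, IsMultiplier (Q i) (φ i)) :
    IsMultiplier (∑ i ∈ s, Q i) (∑ i ∈ s, φ i) := by
  classical
  induction s using Finset.induction_on with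
  | empty => exact fun a n => by simp
  | insert i s hi ih =>
    rw [Finset.sum_insert hi, Finset.sum_insert hi]
    exact (h i (Finset.mem_insert_self _ _)).add
      (ih fun j hj => h j (Finset.mem_insert_of_mem hj))

lemma list_prod {ι : Type*} (l : List ι) {Q : ι → Module.End ℂ (Smooth d)}
    {φ : ι → (Fin d → ℤ) → ℂ} (h : ∀ i, IsMultiplier (Q i) (φ i)) :
    IsMultiplier (l.map Q).prod (l.map φ).prod := by
  induction l with
  | nil => exact one
  | cons i l ih => simpa only [List.map_cons, List.prod_cons] using (h i).mul ih

end IsMultiplier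

lemma isMultiplier_partialDeriv (j : Fin d) :
    IsMultiplier (partialDeriv j) fun n => 2 * Real.pi * Complex.I * (n j : ℂ) := fun _ _ => rfl

lemma isMultiplier_translate (u : EuclideanSpace ℝ (Fin d)) :
    IsMultiplier (translate u) (torusChar u) := fun _ _ => rfl

lemma isMultiplier_derivMulti (m : Fin d → ℕ) :
    IsMultiplier (derivMulti m) fun n => ∏ j, (2 * Real.pi * Complex.I * (n j : ℂ)) ^ m j := by
  have h := IsMultiplier.list_prod (List.finRange d)
    (fun j => (isMultiplier_partialDeriv j).pow (m j))
  rw [derivMulti, List.ofFn_eq_map]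
  convert h using 1
  ext n
  rw [← List.ofFn_eq_map, List.prod_ofFn, Finset.prod_apply]
  rfl

/-- The directional derivation `∂_u = ∑ u_j ∂_j`. -/
def dirDeriv (u : EuclideanSpace ℝ (Fin d)) : Module.End ℂ (Smooth d) :=
  ∑ j, (u j : ℂ) • partialDeriv j

lemma isMultiplier_dirDeriv (u : EuclideanSpace ℝ (Fin d)) :
    IsMultiplier (dirDeriv u) fun n => ∑ j, (u j : ℂ) * (2 * Real.pi * Complex.I * (n j : ℂ)) := by
  intro a n
  rw [dirDeriv, IsMultiplier.sum Finset.univ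
    fun j _ => (isMultiplier_partialDeriv (d := d) j).smul (u j : ℂ)]
  simp

lemma torusChar_smul (t : ℝ) (u : EuclideanSpace ℝ (Fin d)) (n : Fin d → ℤ) :
    torusChar (t • u) n
      = Complex.exp (t * ∑ j, (u j : ℂ) * (2 * Real.pi * Complex.I * (n j : ℂ))) := by
  rw [torusChar]
  congr 1
  push_cast
  rw [Finset.mul_sum, Finset.mul_sum, Finset.sum_mul]
  refine Finset.sum_congr rfl fun j _ => ?_
  simp
  ring

lemma translate_add_apply (u v : EuclideanSpace ℝ (Fin d)) (a : Smooth d) :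
    translate (u + v) a = translate u (translate v a) := by
  have := (isMultiplier_translate (u + v)).eq
    ((isMultiplier_translate u).mul (isMultiplier_translate v))
    (funext fun n => torusChar_add_left u v n)
  exact congrArg (fun f : Module.End ℂ (Smooth d) => f a) this

lemma translate_zero_apply (a : Smooth d) : translate 0 a = a := by
  ext n
  change torusChar 0 n * a.1 n = a.1 n
  simp [torusChar]

/-! ### Continuity of distributions -/

/-- A weighted ℓ¹-norm of the coefficients dominates the norms of the topology, so that continuity
of a distribution can be used through dominated convergence of series. -/
lemma smoothNorm_le (θ : Matrix (Fin d) (Fin d) ℝ) (K : ℕ) (a : Smooth d) :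
    (smoothNorm θ K a : ℝ) ≤ ∑' n, (2 * Real.pi) ^ K * ((1 + ‖n‖) ^ K * ‖a.1 n‖) := by
  have hS := (summable_one_add_norm_pow_mul a K).mul_left ((2 * Real.pi) ^ K)
  have h0 : 0 ≤ ∑' n, (2 * Real.pi) ^ K * ((1 + ‖n‖) ^ K * ‖a.1 n‖) :=
    tsum_nonneg fun n => by positivity
  rw [← Real.toNNReal_le_toNNReal_iff h0, Real.toNNReal_coe, smoothNorm]
  refine Finset.sup_le fun i hi => Finset.sup_le fun m hm => ?_
  rw [← NNReal.coe_le_coe, Real.coe_toNNReal _ h0, coe_nnnorm]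
  refine (norm_toOp_le θ _).trans (Summable.tsum_le_tsum (fun n => ?_) (summable_norm_smooth _) hS)
  rw [isMultiplier_derivMulti, norm_mul, norm_prod, ← mul_assoc, ← mul_pow]
  refine mul_le_mul_of_nonneg_right ?_ (norm_nonneg _)
  have h1 : 1 ≤ 2 * Real.pi * (1 + ‖n‖) := by
    nlinarith [Real.pi_gt_three, norm_nonneg n]
  calc ∏ j, ‖(2 * Real.pi * Complex.I * (n j : ℂ)) ^ m j‖
      ≤ ∏ j, (2 * Real.pi * (1 + ‖n‖)) ^ m j := by
        refine Finset.prod_le_prod (fun _ _ => norm_nonneg _) fun j _ => ?_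
        rw [norm_pow]
        refine pow_le_pow_left₀ (norm_nonneg _) ?_ _
        rw [norm_mul, Complex.norm_intCast, ← Int.norm_eq_abs]
        have h2 : ‖(2 * Real.pi * Complex.I : ℂ)‖ = 2 * Real.pi := by
          simp [abs_of_pos Real.pi_pos]
        rw [h2]
        gcongr
        linarith [norm_le_pi_norm n j]
    _ = (2 * Real.pi * (1 + ‖n‖)) ^ i := by
        rw [Finset.prod_pow_eq_pow_sum, (Finset.mem_piAntidiag.1 hm).1]
    _ ≤ _ := pow_le_pow_right₀ h1 (Nat.lt_succ_iff.1 (Finset.mem_range.1 hi))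

/-- A distribution is continuous for dominated pointwise convergence of the coefficients. -/
lemma IsDistribution.tendsto_of_dominated {θ : Matrix (Fin d) (Fin d) ℝ} {x : Functional d}
    (hx : IsDistribution θ x) {ι : Type*} {l : Filter ι} [l.IsCountablyGenerated]
    {b : ι → Smooth d} {a g : Smooth d}
    (hb : ∀ᶠ i in l, ∀ n, ‖(b i).1 n‖ ≤ ‖g.1 n‖)
    (hlim : ∀ n, Tendsto (fun i => (b i).1 n) l (𝓝 (a.1 n))) :
    Tendsto (fun i => x (b i)) l (𝓝 (x a)) := by
  obtain ⟨K, C, hK⟩ := hx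
  have key : Tendsto (fun i => C * ∑' n, (2 * Real.pi) ^ K * ((1 + ‖n‖) ^ K * ‖(b i - a).1 n‖)) l
      (𝓝 (C * ∑' _n : Fin d → ℤ, (0 : ℝ))) := by
    refine Tendsto.const_mul _ (tendsto_tsum_of_dominated_convergence
      (bound := fun n => (2 * Real.pi) ^ K * ((1 + ‖n‖) ^ K * ‖g.1 n‖)
        + (2 * Real.pi) ^ K * ((1 + ‖n‖) ^ K * ‖a.1 n‖))
      (((summable_one_add_norm_pow_mul g K).mul_left _).add
        ((summable_one_add_norm_pow_mul a K).mul_left _)) (fun n => ?_) ?_)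
    · have h1 : Tendsto (fun i => (b i - a).1 n) l (𝓝 0) := by
        have := (hlim n).sub_const (a.1 n)
        rwa [sub_self] at this
      simpa using (h1.norm.const_mul ((1 + ‖n‖) ^ K)).const_mul ((2 * Real.pi) ^ K)
    · filter_upwards [hb] with i hi n
      rw [Real.norm_of_nonneg (by positivity), ← mul_add, ← mul_add]
      gcongr
      exact (norm_sub_le _ _).trans (add_le_add_left (hi n) _)
  rw [tsum_zero, mul_zero] at key
  rw [tendsto_iff_norm_sub_tendsto_zero]
  refine squeeze_zero (fun _ => norm_nonneg _) (fun i => ?_) key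
  rw [← map_sub]
  exact (hK _).trans (mul_le_mul_of_nonneg_left (smoothNorm_le θ K _) C.2)

/-! ### Difference quotients tested on a distribution -/

lemma norm_dirDeriv_symbol (u : EuclideanSpace ℝ (Fin d)) (n : Fin d → ℤ) :
    ∃ r : ℝ, ∑ j, (u j : ℂ) * (2 * Real.pi * Complex.I * (n j : ℂ)) = r * Complex.I := by
  refine ⟨∑ j, u j * (2 * Real.pi * n j), ?_⟩
  push_cast
  rw [Finset.sum_mul]
  exact Finset.sum_congr rfl fun j _ => by ring

/-- On symbols this is (e^{tz} - 1)/t → z. Since z is purely imaginary, |e^{tz} - 1| ≤ |tz|, and the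
coefficients of ∂_u^k a serve as the dominating family. -/
lemma IsDistribution.tendsto_difference_quotient {θ : Matrix (Fin d) (Fin d) ℝ}
    {x : Functional d} (hx : IsDistribution θ x) (u : EuclideanSpace ℝ (Fin d)) (k : ℕ)
    (a : Smooth d) :
    Tendsto (fun t : ℝ => ((t : ℂ) ^ k)⁻¹ * x (((translate (t • u) - 1 :
      Module.End ℂ (Smooth d)) ^ k) a)) (𝓝[≠] 0) (𝓝 (x ((dirDeriv u ^ k) a))) := by
  have h1 : ∀ t : ℝ, ((t : ℂ) ^ k)⁻¹ * x (((translate (t • u) - 1 :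
      Module.End ℂ (Smooth d)) ^ k) a) = x (((t : ℂ) ^ k)⁻¹ • ((translate (t • u) - 1 :
      Module.End ℂ (Smooth d)) ^ k) a) := fun t => by rw [map_smul, smul_eq_mul]
  have h2 : ∀ (t : ℝ) n, (((t : ℂ) ^ k)⁻¹ • ((translate (t • u) - 1 :
      Module.End ℂ (Smooth d)) ^ k) a).1 n = ((t : ℂ)⁻¹ * (Complex.exp
        (t * ∑ j, (u j : ℂ) * (2 * Real.pi * Complex.I * (n j : ℂ))) - 1)) ^ k * a.1 n := by
    intro t n
    change ((t : ℂ) ^ k)⁻¹ * (((translate (t • u) - 1 :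
      Module.End ℂ (Smooth d)) ^ k) a).1 n = _
    rw [(((isMultiplier_translate (t • u)).sub IsMultiplier.one).pow k)]
    rw [Pi.pow_apply, Pi.sub_apply, torusChar_smul, Pi.one_apply, mul_pow, inv_pow]
    exact (mul_assoc _ _ _).symm
  simp only [h1]
  refine hx.tendsto_of_dominated (g := (dirDeriv u ^ k) a) (Eventually.of_forall fun t n => ?_)
    fun n => ?_
  · rw [h2, ((isMultiplier_dirDeriv u).pow k), norm_mul, norm_mul, Pi.pow_apply, norm_pow, norm_pow]
    obtain ⟨r, hr⟩ := norm_dirDeriv_symbol u n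
    rw [hr]
    gcongr
    rw [norm_mul, norm_inv, ← mul_assoc, ← Complex.ofReal_mul, norm_mul, Complex.norm_I, mul_one]
    -- Domination is claimed for every t; at t = 0 the left side vanishes because 0⁻¹ = 0.
    rcases eq_or_ne t 0 with rfl | ht
    · simp
    rw [inv_mul_le_iff₀ (norm_pos_iff.2 (by exact_mod_cast ht)), ← norm_mul, ← Complex.ofReal_mul,
      mul_comm _ Complex.I]
    simpa using Real.norm_exp_I_mul_ofReal_sub_one_le (x := t * r)
  · simp only [h2, ((isMultiplier_dirDeriv u).pow k) a n, Pi.pow_apply]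
    refine Tendsto.mul_const _ (Tendsto.pow ?_ k)
    set z := ∑ j, (u j : ℂ) * (2 * Real.pi * Complex.I * (n j : ℂ)) with hz
    have h3 : HasDerivAt (fun t : ℝ => Complex.exp (t * z)) z 0 := by
      have := ((Complex.ofRealCLM.hasDerivAt (x := (0 : ℝ))).mul_const z).cexp
      simpa using this
    have h4 := hasDerivAt_iff_tendsto_slope.1 h3
    refine h4.congr fun t => ?_
    simp [slope_def_module, Complex.real_smul]

end QuantumTorus

end

section

namespace QuantumTorus
variable {d : ℕ}

/-! ### Differences and derivatives of distributions -/

lemma IsDistribution.hasDerivAt_translate {θ : Matrix (Fin d) (Fin d) ℝ}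
    {x : Functional d} (hx : IsDistribution θ x) (u : EuclideanSpace ℝ (Fin d))
    (a : Smooth d) (t : ℝ) :
    HasDerivAt (fun t : ℝ => x (translate (t • u) a)) (x (translate (t • u) (dirDeriv u a))) t := by
  rw [hasDerivAt_iff_tendsto_slope_zero]
  have h := hx.tendsto_difference_quotient u 1 (translate (t • u) a)
  have h1 : dirDeriv u (translate (t • u) a) = translate (t • u) (dirDeriv u a) :=
    congrArg (fun f : Module.End ℂ (Smooth d) => f a)
      ((isMultiplier_dirDeriv u).commute (isMultiplier_translate (t • u))).eq
  rw [pow_one, h1] at h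
  refine h.congr fun s => ?_
  rw [pow_one, pow_one, LinearMap.sub_apply, ← translate_add_apply, ← add_smul, add_comm t s,
    Complex.real_smul, Complex.ofReal_inv, map_sub]
  rfl

/-- The mean value inequality on [0,1] trades one factor T_u - 1 for ∂_u at a further translate
along u. Induction accumulates these translates, which is why the bound is assumed for all real t.
-/
lemma IsDistribution.norm_apply_translate_sub_one_pow_le {θ : Matrix (Fin d) (Fin d) ℝ}
    {x : Functional d} (hx : IsDistribution θ x) (u : EuclideanSpace ℝ (Fin d)) (k : ℕ)
    (a : Smooth d) {M : ℝ} (hM : ∀ t : ℝ, ‖x (translate (t • u) ((dirDeriv u ^ k) a))‖ ≤ M) :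
    ‖x (((translate u - 1 : Module.End ℂ (Smooth d)) ^ k) a)‖ ≤ M := by
  induction k generalizing a with
  | zero => simpa [translate_zero_apply] using hM 0
  | succ k ih =>
    set b := ((translate u - 1 : Module.End ℂ (Smooth d)) ^ k) a with hb
    have h1 : ∀ t : ℝ, ‖x (translate (t • u) (dirDeriv u b))‖ ≤ M := by
      intro t
      have hc : translate (t • u) (dirDeriv u b) = ((translate u - 1 : Module.End ℂ (Smooth d)) ^ k)
          (translate (t • u) (dirDeriv u a)) :=
        congrArg (fun f : Module.End ℂ (Smooth d) => f a)
          (((isMultiplier_translate (t • u)).mul (isMultiplier_dirDeriv u)).commute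
            (((isMultiplier_translate u).sub IsMultiplier.one).pow k)).eq
      rw [hc]
      refine ih _ fun s => ?_
      have hc2 : (dirDeriv u ^ k) (translate (t • u) (dirDeriv u a))
          = translate (t • u) ((dirDeriv u ^ (k + 1)) a) := by
        rw [pow_succ]
        exact congrArg (fun f : Module.End ℂ (Smooth d) => f (dirDeriv u a))
          (((isMultiplier_dirDeriv u).pow k).commute (isMultiplier_translate (t • u))).eq
      rw [hc2, ← translate_add_apply, ← add_smul]
      exact hM _
    have h2 := norm_image_sub_le_of_norm_deriv_le_segment_01'
      (fun t _ => (hx.hasDerivAt_translate u b t).hasDerivWithinAt) (fun t _ => h1 t)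
    rw [one_smul, zero_smul, translate_zero_apply, ← map_sub] at h2
    rw [pow_succ']
    exact h2

lemma difference_pow_apply (u : EuclideanSpace ℝ (Fin d)) (k : ℕ) (x : Functional d)
    (a : Smooth d) : ((difference u ^ k) x) a
      = x (((translate (-u) - 1 : Module.End ℂ (Smooth d)) ^ k) a) := by
  induction k generalizing a with
  | zero => rfl
  | succ k ih =>
    rw [pow_succ', pow_succ, Module.End.mul_apply, Module.End.mul_apply, ← ih, LinearMap.sub_apply,
      map_sub]
    rfl

lemma distDeriv_pow (j : Fin d) (m : ℕ) (F : Functional d) :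
    (distDeriv j ^ m) F = F ∘ₗ (((-1 : ℂ) • partialDeriv j : Module.End ℂ (Smooth d)) ^ m) := by
  induction m with
  | zero => rfl
  | succ m ih =>
    rw [pow_succ', Module.End.mul_apply, ih, pow_succ]
    ext a
    change -(F _) = F _
    rw [Module.End.mul_apply, LinearMap.smul_apply, neg_one_smul, map_neg, map_neg]

lemma distDerivMulti_apply (m : Fin d → ℕ) (x : Functional d) (a : Smooth d) :
    distDerivMulti m x a = (-1) ^ (∑ j, m j) * x (derivMulti m a) := by
  -- Transposition reverses the order of the factors, which is immaterial for multipliers; the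
  -- induction therefore tracks only the symbol.
  have key : ∀ l : List (Fin d), ∃ Q : Module.End ℂ (Smooth d),
      IsMultiplier Q (l.map fun j n =>
        (-1 : ℂ) ^ m j * (2 * Real.pi * Complex.I * (n j : ℂ)) ^ m j).prod ∧
      (l.map fun j => distDeriv j ^ m j).prod x = x ∘ₗ Q := by
    intro l
    induction l with
    | nil => exact ⟨1, IsMultiplier.one, rfl⟩
    | cons j l ih =>
      obtain ⟨Q, hQ, hQ2⟩ := ih
      refine ⟨Q * ((-1 : ℂ) • partialDeriv j : Module.End ℂ (Smooth d)) ^ m j, ?_, ?_⟩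
      · rw [List.map_cons, List.prod_cons, mul_comm]
        convert hQ.mul (((isMultiplier_partialDeriv j).smul (-1)).pow (m j)) using 2
        ext n
        simp only [Pi.pow_apply, Pi.smul_apply, smul_eq_mul, mul_pow]
      · rw [List.map_cons, List.prod_cons, Module.End.mul_apply, hQ2, distDeriv_pow]
        rfl
  obtain ⟨Q, hQ, hQ2⟩ := key (List.finRange d)
  rw [distDerivMulti, List.ofFn_eq_map, hQ2]
  have h : Q = ((-1 : ℂ) ^ (∑ j, m j)) • derivMulti m := by
    refine hQ.eq ((isMultiplier_derivMulti m).smul _) (funext fun n => ?_)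
    rw [← List.ofFn_eq_map, List.prod_ofFn, Finset.prod_apply, Finset.prod_mul_distrib,
      Finset.prod_pow_eq_pow_sum]
    rfl
  rw [h, LinearMap.comp_apply, LinearMap.smul_apply, map_smul, smul_eq_mul]

lemma norm_distDerivMulti_apply (m : Fin d → ℕ) (x : Functional d) (a : Smooth d) :
    ‖distDerivMulti m x a‖ = ‖x (derivMulti m a)‖ := by
  rw [distDerivMulti_apply, norm_mul, norm_pow, norm_neg, norm_one, one_pow, one_mul]

lemma dirDeriv_pow (u : EuclideanSpace ℝ (Fin d)) (k : ℕ) :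
    dirDeriv u ^ k = ∑ m ∈ Finset.piAntidiag Finset.univ k,
      ((Nat.multinomial Finset.univ m : ℂ) * ∏ j, (u j : ℂ) ^ m j) • derivMulti m := by
  refine ((isMultiplier_dirDeriv u).pow k).eq (IsMultiplier.sum _
    fun m _ => (isMultiplier_derivMulti m).smul _) (funext fun n => ?_)
  rw [Pi.pow_apply, Finset.sum_pow_eq_sum_piAntidiag, Finset.sum_apply]
  refine Finset.sum_congr rfl fun m _ => ?_
  simp only [mul_pow, Finset.prod_mul_distrib, Pi.smul_apply, smul_eq_mul]
  ring

lemma MemSobolev.memNCLp_self {θ : Matrix (Fin d) (Fin d) ℝ} {k : ℕ} {p : ℝ≥0∞}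
    {x : Functional d} (hx : MemSobolev θ k p x) : MemNCLp θ p x := by
  simpa [distDerivMulti] using hx.memNCLp 0 (by simp)

lemma MemSobolev.memNCLp_distDerivMulti {θ : Matrix (Fin d) (Fin d) ℝ} {k : ℕ} {p : ℝ≥0∞}
    {x : Functional d} (hx : MemSobolev θ k p x) {m : Fin d → ℕ}
    (hm : m ∈ Finset.piAntidiag Finset.univ k) : MemNCLp θ p (distDerivMulti m x) :=
  hx.memNCLp m (Finset.mem_piAntidiag.1 hm).1.le

/-- Tested on smooth elements, Δ_u^k x is controlled by translates of ∂_u^k x. Each coefficient ∏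
u_j^{m_j} is at most ‖u‖^k in absolute value, and the multinomial coefficients add up to d^k. -/
lemma MemSobolev.ncLpNorm_difference_pow_le {θ : Matrix (Fin d) (Fin d) ℝ} {k : ℕ} {p : ℝ≥0∞}
    (hp : 1 ≤ p) {x : Functional d} (hx : MemSobolev θ k p x) {S : ℝ} (hS : 0 ≤ S)
    (h : ∀ m ∈ Finset.piAntidiag Finset.univ k,
      ncLpNorm θ p (distDerivMulti m x) ≤ ENNReal.ofReal S) (u : EuclideanSpace ℝ (Fin d)) :
    ncLpNorm θ p ((difference u ^ k) x) ≤ ENNReal.ofReal (d ^ k * S * ‖u‖ ^ k) := by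
  obtain ⟨q, hpq⟩ : ∃ q : ℝ≥0∞, p.HolderConjugate q := ⟨_, .conjExponent hp⟩
  refine (ncLpNorm_le_iff hpq (hx.memNCLp_self.difference_pow hp u k) (by positivity)).2
    fun a => ?_
  rw [difference_pow_apply]
  refine hx.isDistribution.norm_apply_translate_sub_one_pow_le _ _ _ fun t => ?_
  set b := translate (t • -u) a with hb
  have h1 : translate (t • -u) ((dirDeriv (-u) ^ k) a) = (dirDeriv (-u) ^ k) b :=
    congrArg (fun f : Module.End ℂ (Smooth d) => f a)
      ((isMultiplier_translate (t • -u)).commute ((isMultiplier_dirDeriv (-u)).pow k)).eq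
  have h2 : ∀ m ∈ Finset.piAntidiag Finset.univ k,
      ‖x (derivMulti m b)‖ ≤ S * opLpNorm q (toOp θ a) := by
    intro m hm
    rw [← norm_distDerivMulti_apply, ← opLpNorm_toOp_translate θ (t • -u) q a]
    exact (ncLpNorm_le_iff hpq (hx.memNCLp_distDerivMulti hm) hS).1 (h m hm) _
  have h3 : ∑ m ∈ Finset.piAntidiag (Finset.univ : Finset (Fin d)) k,
      (Nat.multinomial Finset.univ m : ℝ) = (d : ℝ) ^ k := by
    have := Finset.sum_pow_eq_sum_piAntidiag Finset.univ (fun _ : Fin d => (1 : ℝ)) k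
    simpa using this.symm
  rw [h1, dirDeriv_pow, LinearMap.sum_apply, map_sum]
  calc ‖∑ m ∈ Finset.piAntidiag Finset.univ k, x ((((Nat.multinomial Finset.univ m : ℂ)
        * ∏ j, (((-u) j : ℝ) : ℂ) ^ m j) • derivMulti m) b)‖
      ≤ ∑ m ∈ Finset.piAntidiag Finset.univ k, (Nat.multinomial Finset.univ m : ℝ)
        * (‖u‖ ^ k * (S * opLpNorm q (toOp θ a))) := by
        refine norm_sum_le_of_le _ fun m hm => ?_
        rw [LinearMap.smul_apply, map_smul, norm_smul, norm_mul, Complex.norm_natCast, mul_assoc]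
        refine mul_le_mul_of_nonneg_left ?_ (Nat.cast_nonneg _)
        refine mul_le_mul ?_ (h2 m hm) (norm_nonneg _) (by positivity)
        rw [norm_prod, ← (Finset.mem_piAntidiag.1 hm).1, ← Finset.prod_pow_eq_pow_sum]
        refine Finset.prod_le_prod (fun _ _ => norm_nonneg _) fun j _ => ?_
        rw [norm_pow, Complex.norm_real]
        refine pow_le_pow_left₀ (norm_nonneg _) ?_ _
        simpa using PiLp.norm_apply_le (-u) j
    _ = _ := by
        rw [← Finset.sum_mul, h3]
        ring

/-! ### Polarization: mixed derivatives from directional ones -/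

/-- The polarization formula for a product. -/
lemma sum_neg_one_pow_mul_sum_pow {ι R : Type*} [Fintype ι] [DecidableEq ι] [CommRing R]
    (z : ι → R) :
    ∑ s : Finset ι, (-1) ^ sᶜ.card * (∑ i ∈ s, z i) ^ Fintype.card ι
      = (Fintype.card ι).factorial * ∏ i, z i := by
  set k := Fintype.card ι with hk
  -- The factors 0^{κ_i}, with 0^0 = 1, encode that κ is supported in s.
  have h1 : ∀ s : Finset ι, (∑ i ∈ s, z i) ^ k = ∑ κ ∈ Finset.piAntidiag Finset.univ k,
      (Nat.multinomial Finset.univ κ : R) * ((∏ i ∈ s, z i ^ κ i) * ∏ i ∈ sᶜ, 0 ^ κ i) := by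
    intro s
    rw [← Finset.univ_inter s, ← Finset.sum_ite_mem, Finset.sum_pow_eq_sum_piAntidiag]
    refine Finset.sum_congr rfl fun κ _ => ?_
    rw [Finset.univ_inter, ← Finset.prod_mul_prod_compl s]
    congr 2
    · exact Finset.prod_congr rfl fun i hi => by rw [if_pos hi]
    · exact Finset.prod_congr rfl fun i hi => by rw [if_neg (Finset.mem_compl.1 hi)]
  have h2 : ∀ κ : ι → ℕ, ∑ s : Finset ι, (-1) ^ sᶜ.card *
      ((∏ i ∈ s, z i ^ κ i) * ∏ i ∈ sᶜ, 0 ^ κ i) = ∏ i, (z i ^ κ i - 0 ^ κ i) := by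
    intro κ
    simp only [sub_eq_add_neg]
    rw [Finset.prod_add, Finset.powerset_univ]
    refine Finset.sum_congr rfl fun s _ => ?_
    rw [← Finset.compl_eq_univ_sdiff, Finset.prod_neg]
    ring
  simp only [h1, Finset.mul_sum]
  rw [Finset.sum_comm]
  simp only [mul_left_comm _ (Nat.multinomial _ _ : R), ← Finset.mul_sum, h2]
  -- A factor z_i^{κ_i} - 0^{κ_i} vanishes when κ_i = 0, and exponents that are all at least 1 with
  -- sum equal to the number of indices are all 1.
  rw [Finset.sum_eq_single (fun _ : ι => 1)]
  · simp [Nat.multinomial, hk]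
  · intro κ hκ hne
    obtain ⟨i, hi⟩ : ∃ i, κ i = 0 := by
      by_contra! hcon
      refine hne (funext fun i => ?_)
      have hsum : ∑ _i : ι, 1 = ∑ i, κ i := by
        rw [(Finset.mem_piAntidiag.1 hκ).1]
        simp [hk]
      exact ((Finset.sum_eq_sum_iff_of_le fun i _ => Nat.one_le_iff_ne_zero.2 (hcon i)).1 hsum i
        (Finset.mem_univ i)).symm
    rw [Finset.prod_eq_zero (Finset.mem_univ i) (by simp [hi]), mul_zero]
  · intro hne
    exact absurd (Finset.mem_piAntidiag.2 ⟨by simp [hk], by simp⟩) hne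

/-- Dividing by t^k and letting t → 0 turns the bound on differences into one on ∂_u^k for every u,
even though only short shifts are assumed. Polarization then sums over 2^k directions of length at
most k, whence 2^k k^k; the gain 1/k! is discarded. -/
lemma MemSobolev.ncLpNorm_distDerivMulti_le {θ : Matrix (Fin d) (Fin d) ℝ} {k : ℕ} {p : ℝ≥0∞}
    (hk : 1 ≤ k) (hp : 1 ≤ p) {x : Functional d} (hx : MemSobolev θ k p x) {S : ℝ} (hS : 0 ≤ S)
    (h : ∀ u : EuclideanSpace ℝ (Fin d), 0 < ‖u‖ → ‖u‖ ≤ 1 →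
      ncLpNorm θ p ((difference u ^ k) x) ≤ ENNReal.ofReal (S * ‖u‖ ^ k))
    {m : Fin d → ℕ} (hm : m ∈ Finset.piAntidiag Finset.univ k) :
    ncLpNorm θ p (distDerivMulti m x) ≤ ENNReal.ofReal (2 ^ k * k ^ k * S) := by
  obtain ⟨q, hpq⟩ : ∃ q : ℝ≥0∞, p.HolderConjugate q := ⟨_, .conjExponent hp⟩
  have h1 : ∀ (u : EuclideanSpace ℝ (Fin d)) (a : Smooth d),
      ‖x ((dirDeriv u ^ k) a)‖ ≤ S * ‖u‖ ^ k * opLpNorm q (toOp θ a) := by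
    intro u a
    rcases eq_or_ne u 0 with rfl | hu
    · have h0 : dirDeriv (0 : EuclideanSpace ℝ (Fin d)) = 0 := by simp [dirDeriv]
      rw [h0, zero_pow (by omega), LinearMap.zero_apply, map_zero, norm_zero]
      exact mul_nonneg (by positivity) (opLpNorm_nonneg _ _)
    refine le_of_tendsto (hx.isDistribution.tendsto_difference_quotient u k a).norm ?_
    have h0 : ∀ᶠ t : ℝ in 𝓝[≠] 0, ‖t • u‖ ≤ 1 := by
      have : Tendsto (fun t : ℝ => ‖t • u‖) (𝓝[≠] 0) (𝓝 ‖(0 : ℝ) • u‖) :=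
        (Continuous.tendsto (by fun_prop) 0).mono_left nhdsWithin_le_nhds
      rw [zero_smul, norm_zero] at this
      exact this.eventually_le_const one_pos
    filter_upwards [h0, self_mem_nhdsWithin] with t ht ht0
    have ht0 : t ≠ 0 := ht0
    rw [norm_mul, norm_inv, norm_pow, Complex.norm_real,
      inv_mul_le_iff₀ (pow_pos (norm_pos_iff.2 ht0) k), ← neg_neg (t • u), ← difference_pow_apply]
    have hv : 0 < ‖-(t • u)‖ := by
      rw [norm_neg]
      exact norm_pos_iff.2 (smul_ne_zero ht0 hu)
    refine ((ncLpNorm_le_iff hpq (hx.memNCLp_self.difference_pow hp _ k) (by positivity)).1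
      (h _ hv (by rwa [norm_neg])) a).trans_eq ?_
    rw [norm_neg, norm_smul, mul_pow]
    ring
  refine (ncLpNorm_le_iff hpq (hx.memNCLp_distDerivMulti hm) (by positivity)).2 fun a => ?_
  rw [norm_distDerivMulti_apply]
  have hsum := (Finset.mem_piAntidiag.1 hm).1
  -- The index set lists each direction j with multiplicity m_j, so that D^m is a product of exactly
  -- k first-order derivations.
  have hcard : Fintype.card (Σ j, Fin (m j)) = k := by simp [hsum]
  set U : Finset (Σ j, Fin (m j)) → EuclideanSpace ℝ (Fin d) := fun s =>
    ∑ i ∈ s, EuclideanSpace.single i.1 (1 : ℝ) with hU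
  have hUk : ∀ s, ‖U s‖ ≤ k := by
    intro s
    refine (norm_sum_le _ _).trans ?_
    simp only [PiLp.norm_single, norm_one, Finset.sum_const, nsmul_eq_mul, mul_one]
    rw [← hcard]
    exact_mod_cast Finset.card_le_univ s
  have h2 : (k.factorial : ℂ) • derivMulti m
      = ∑ s : Finset (Σ j, Fin (m j)), ((-1 : ℂ) ^ sᶜ.card) • dirDeriv (U s) ^ k := by
    refine ((isMultiplier_derivMulti m).smul _).eq (IsMultiplier.sum _
      fun s _ => ((isMultiplier_dirDeriv (U s)).pow k).smul _) (funext fun n => ?_)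
    have h3 := sum_neg_one_pow_mul_sum_pow
      fun i : (Σ j, Fin (m j)) => 2 * (Real.pi : ℂ) * Complex.I * (n i.1 : ℂ)
    rw [hcard, Fintype.prod_sigma] at h3
    simp only [Finset.prod_const, Finset.card_univ, Fintype.card_fin] at h3
    rw [Pi.smul_apply, smul_eq_mul, ← h3, Finset.sum_apply]
    refine Finset.sum_congr rfl fun s _ => ?_
    rw [Pi.smul_apply, Pi.pow_apply, smul_eq_mul]
    congr 2
    simp only [hU, WithLp.ofLp_sum, Finset.sum_apply, Complex.ofReal_sum, Finset.sum_mul]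
    rw [Finset.sum_comm]
    refine Finset.sum_congr rfl fun i _ => ?_
    simp [apply_ite Complex.ofReal]
  have h4 : (k.factorial : ℂ) * x (derivMulti m a)
      = ∑ s : Finset (Σ j, Fin (m j)), (-1 : ℂ) ^ sᶜ.card * x ((dirDeriv (U s) ^ k) a) := by
    have := congrArg (fun f : Module.End ℂ (Smooth d) => x (f a)) h2
    simpa [LinearMap.sum_apply] using this
  have h5 : (1 : ℝ) ≤ k.factorial := by exact_mod_cast Nat.one_le_iff_ne_zero.2 k.factorial_ne_zero
  calc ‖x (derivMulti m a)‖ ≤ k.factorial * ‖x (derivMulti m a)‖ :=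
        le_mul_of_one_le_left (norm_nonneg _) h5
    _ = ‖∑ s : Finset (Σ j, Fin (m j)), (-1 : ℂ) ^ sᶜ.card * x ((dirDeriv (U s) ^ k) a)‖ := by
        rw [← h4, norm_mul, Complex.norm_natCast]
    _ ≤ ∑ s : Finset (Σ j, Fin (m j)), S * k ^ k * opLpNorm q (toOp θ a) := by
        refine norm_sum_le_of_le _ fun s _ => ?_
        rw [norm_mul, norm_pow, norm_neg, norm_one, one_pow, one_mul]
        refine (h1 (U s) a).trans ?_
        have := hUk s
        have := opLpNorm_nonneg q (toOp θ a)
        gcongr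
    _ = _ := by
        rw [Finset.sum_const, Finset.card_univ, Fintype.card_finset, hcard, nsmul_eq_mul]
        push_cast
        ring

end QuantumTorus

end

section

namespace QuantumTorus
variable {d : ℕ}

/-! ### The modulus of smoothness -/

lemma distTranslate_nsmul (v : EuclideanSpace ℝ (Fin d)) (m : ℕ) :
    distTranslate ((m : ℝ) • v) = distTranslate v ^ m := by
  induction m with
  | zero =>
    ext F a
    change F (translate (-(((0 : ℕ) : ℝ) • v)) a) = F a
    rw [Nat.cast_zero, zero_smul, neg_zero, translate_zero_apply]
  | succ m ih =>
    rw [pow_succ, ← ih]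
    ext F a
    change F (translate _ a) = F (translate _ (translate _ a))
    rw [← translate_add_apply]
    congr 3
    push_cast
    module

/-- The geometric sum T_v^m - 1 = (1 + T_v + … + T_v^{m-1})(T_v - 1) has m isometric terms in its
first factor, which costs m for each of the k powers. -/
lemma ncLpNorm_difference_nsmul_pow_le {θ : Matrix (Fin d) (Fin d) ℝ} {p : ℝ≥0∞} (hp : 1 ≤ p)
    {x : Functional d} (hx : MemNCLp θ p x) (v : EuclideanSpace ℝ (Fin d)) (m k : ℕ) :
    ncLpNorm θ p ((difference ((m : ℝ) • v) ^ k) x) ≤ m ^ k * ncLpNorm θ p ((difference v ^ k) x) := by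
  obtain ⟨q, hpq⟩ : ∃ q : ℝ≥0∞, p.HolderConjugate q := ⟨_, .conjExponent hp⟩
  have hv := hx.difference_pow hp v k
  set R : Module.End ℂ (Functional d) := ∑ i ∈ Finset.range m, distTranslate v ^ i with hR
  have h1 : difference ((m : ℝ) • v) ^ k = R ^ k * difference v ^ k := by
    rw [difference, distTranslate_nsmul, ← geom_sum_mul, ← hR]
    refine Commute.mul_pow (Commute.sum_left _ _ _ fun i _ => ?_) k
    exact ((Commute.refl _).sub_right (Commute.one_right _)).pow_left i
  have h2 : ∀ (G : Functional d) (N : ℝ), (∀ a, ‖G a‖ ≤ N * opLpNorm q (toOp θ a)) →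
      ∀ a, ‖R G a‖ ≤ m * N * opLpNorm q (toOp θ a) := by
    intro G N hG a
    rw [hR, LinearMap.sum_apply, LinearMap.sum_apply]
    refine (norm_sum_le_of_le (n := fun _ => N * opLpNorm q (toOp θ a)) _ fun i _ => ?_).trans_eq ?_
    · rw [← distTranslate_nsmul, ← opLpNorm_toOp_translate θ (-((i : ℝ) • v)) q a]
      exact hG _
    · simp [mul_assoc]
  have h3 : ∀ (j : ℕ) (G : Functional d) (N : ℝ), (∀ a, ‖G a‖ ≤ N * opLpNorm q (toOp θ a)) →
      ∀ a, ‖(R ^ j) G a‖ ≤ m ^ j * N * opLpNorm q (toOp θ a) := by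
    intro j G N hG
    induction j with
    | zero => simpa using hG
    | succ j ih =>
      intro a
      rw [pow_succ', Module.End.mul_apply, pow_succ', mul_assoc (m : ℝ)]
      exact h2 _ _ ih a
  have h4 : (m : ℝ≥0∞) ^ k * ncLpNorm θ p ((difference v ^ k) x)
      = ENNReal.ofReal (m ^ k * (ncLpNorm θ p ((difference v ^ k) x)).toReal) := by
    rw [ENNReal.ofReal_mul (by positivity), ENNReal.ofReal_toReal (hv.ncLpNorm_ne_top hp),
      ENNReal.ofReal_pow (Nat.cast_nonneg m), ENNReal.ofReal_natCast]
  rw [h4]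
  refine (ncLpNorm_le_iff hpq (hx.difference_pow hp _ k) (by positivity)).2 ?_
  rw [h1]
  exact h3 k _ _ (hv.norm_apply_le hpq)

lemma modulus_mono (θ : Matrix (Fin d) (Fin d) ℝ) (k : ℕ) (p : ℝ≥0∞) (x : Functional d) :
    Monotone (modulus θ k p x) := fun _ _ h =>
  iSup₂_le fun u hu => le_iSup₂_of_le u ⟨hu.1, hu.2.trans h⟩ le_rfl

lemma modulus_nat_mul_le {θ : Matrix (Fin d) (Fin d) ℝ} {p : ℝ≥0∞} (hp : 1 ≤ p)
    {x : Functional d} (hx : MemNCLp θ p x) (k : ℕ) {m : ℕ} (hm : 0 < m) (ε : ℝ) :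
    modulus θ k p x (m * ε) ≤ m ^ k * modulus θ k p x ε := by
  refine iSup₂_le fun u hu => ?_
  have hm' : (0 : ℝ) < m := by exact_mod_cast hm
  have h1 : u = (m : ℝ) • ((m : ℝ)⁻¹ • u) := by rw [smul_inv_smul₀ hm'.ne']
  rw [h1]
  refine (ncLpNorm_difference_nsmul_pow_le hp hx _ m k).trans ?_
  gcongr
  refine le_iSup₂_of_le ((m : ℝ)⁻¹ • u) ?_ le_rfl
  rw [norm_smul, norm_inv, Real.norm_natCast]
  exact ⟨mul_pos (inv_pos.2 hm') hu.1, by rw [inv_mul_le_iff₀ hm']; exact hu.2⟩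

/-! ### The limit of the Besov norms -/

lemma lintegral_rpow_sub_one {s r : ℝ} (hs : 0 < s) (hr : 0 ≤ r) :
    ∫⁻ ε in Set.Ioo (0 : ℝ) r, ENNReal.ofReal (ε ^ (s - 1)) = ENNReal.ofReal (r ^ s / s) := by
  have h1 : IntervalIntegrable (fun ε : ℝ => ε ^ (s - 1)) volume 0 r :=
    intervalIntegral.intervalIntegrable_rpow' (by linarith)
  have h2 := (intervalIntegrable_iff_integrableOn_Ioo_of_le hr).1 h1
  rw [← ofReal_integral_eq_lintegral_ofReal h2
    ((ae_restrict_mem measurableSet_Ioo).mono fun ε hε => Real.rpow_nonneg hε.1.le _),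
    ← integral_Ioc_eq_integral_Ioo, ← intervalIntegral.integral_of_le hr,
    integral_rpow (Or.inl (by linarith)), sub_add_cancel, Real.zero_rpow hs.ne', sub_zero]

lemma besov_integrand_eq {c ε α q : ℝ} (k : ℕ) (hc : 0 ≤ c) (hε : 0 < ε) (hq : 0 ≤ q) :
    ENNReal.ofReal (ε ^ (-(α * q))) * ENNReal.ofReal (c * ε ^ k) ^ q * ENNReal.ofReal ε⁻¹
      = ENNReal.ofReal (c ^ q) * ENNReal.ofReal (ε ^ ((k - α) * q - 1)) := by
  rw [ENNReal.ofReal_rpow_of_nonneg (by positivity) hq, ← ENNReal.ofReal_mul (by positivity),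
    ← ENNReal.ofReal_mul (by positivity), ← ENNReal.ofReal_mul (by positivity),
    Real.mul_rpow hc (by positivity), ← Real.rpow_natCast ε k, ← Real.rpow_mul hε.le,
    ← Real.rpow_neg_one ε]
  congr 1
  calc ε ^ (-(α * q)) * (c ^ q * ε ^ ((k : ℝ) * q)) * ε ^ (-1 : ℝ)
      = c ^ q * (ε ^ (-(α * q)) * ε ^ ((k : ℝ) * q) * ε ^ (-1 : ℝ)) := by ring
    _ = _ := by
        rw [← Real.rpow_add hε, ← Real.rpow_add hε]
        ring_nf

lemma ofReal_besov_const {c r α q : ℝ} (k : ℕ) (hc : 0 ≤ c) (hr : 0 ≤ r) (hα : α < k)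
    (hq : 0 < q) :
    (ENNReal.ofReal (c ^ q) * ENNReal.ofReal (r ^ ((k - α) * q) / ((k - α) * q))) ^ (1 / q)
      = ENNReal.ofReal (c * r ^ (k - α) * (q ^ (-(1 / q)) * ((k - α) ^ (1 / q))⁻¹)) := by
  have hk : 0 < k - α := sub_pos.2 hα
  rw [← ENNReal.ofReal_mul (by positivity),
    ENNReal.ofReal_rpow_of_nonneg (by positivity) (by positivity)]
  congr 1
  rw [Real.mul_rpow (by positivity) (by positivity), ← Real.rpow_mul hc, mul_one_div_cancel hq.ne',
    Real.rpow_one, Real.div_rpow (by positivity) (by positivity), ← Real.rpow_mul hr, mul_assoc,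
    mul_one_div_cancel hq.ne', mul_one, Real.mul_rpow hk.le hq.le, Real.rpow_neg hq.le]
  field_simp

/-- Comparison with the model modulus c ε^k, whose Besov integral is explicit because α < k. -/
lemma besovNorm_le {θ : Matrix (Fin d) (Fin d) ℝ} {k : ℕ} {p : ℝ≥0∞} {q α c : ℝ}
    {x : Functional d} (hq : 0 < q) (hα : α < k) (hc : 0 ≤ c)
    (h : ∀ ε ∈ Set.Ioo (0 : ℝ) 1, modulus θ k p x ε ≤ ENNReal.ofReal (c * ε ^ k)) :
    besovNorm θ k p q α x
      ≤ ENNReal.ofReal (c * (q ^ (-(1 / q)) * ((k - α) ^ (1 / q))⁻¹)) := by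
  have hk : 0 < k - α := sub_pos.2 hα
  have h1 := ofReal_besov_const k hc zero_le_one hα hq
  rw [Real.one_rpow, Real.one_rpow, mul_one] at h1
  rw [← h1, besovNorm]
  refine ENNReal.rpow_le_rpow ?_ (by positivity)
  have h2 := lintegral_rpow_sub_one (s := (k - α) * q) (by positivity) zero_le_one
  rw [Real.one_rpow] at h2
  rw [← h2, ← lintegral_const_mul' _ _ ENNReal.ofReal_ne_top]
  refine setLIntegral_mono' measurableSet_Ioo fun ε hε => ?_
  rw [← besov_integrand_eq k hc hε.1 hq.le]
  gcongr
  exact h ε hε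

/-- A lower bound on (0, r) alone suffices: dropping the rest of the integral costs the factor
r^{k-α}, which tends to 1. -/
lemma le_besovNorm {θ : Matrix (Fin d) (Fin d) ℝ} {k : ℕ} {p : ℝ≥0∞} {q α c r : ℝ}
    {x : Functional d} (hq : 0 < q) (hα : α < k) (hc : 0 ≤ c) (hr : 0 ≤ r) (hr1 : r ≤ 1)
    (h : ∀ ε ∈ Set.Ioo (0 : ℝ) r, ENNReal.ofReal (c * ε ^ k) ≤ modulus θ k p x ε) :
    ENNReal.ofReal (c * r ^ (k - α) * (q ^ (-(1 / q)) * ((k - α) ^ (1 / q))⁻¹))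
      ≤ besovNorm θ k p q α x := by
  have hk : 0 < k - α := sub_pos.2 hα
  rw [← ofReal_besov_const k hc hr hα hq, besovNorm]
  refine ENNReal.rpow_le_rpow ?_ (by positivity)
  rw [← lintegral_rpow_sub_one (by positivity) hr, ← lintegral_const_mul' _ _ ENNReal.ofReal_ne_top]
  refine (setLIntegral_mono' measurableSet_Ioo fun ε hε => ?_).trans
    (lintegral_mono_set (Set.Ioo_subset_Ioo_right hr1))
  rw [← besov_integrand_eq k hc hε.1 hq.le]
  gcongr
  exact h ε hε

/-- If `w` is increasing and `w (m ε) ≤ m^k w ε`, then `w ε / ε^k` tends to its supremum. -/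
lemma exists_forall_lt_of_mono_of_nat_mul_le {w : ℝ → ℝ} {k : ℕ} (hw : MonotoneOn w (Set.Ioi 0))
    (h0 : ∀ ε, 0 < ε → 0 ≤ w ε)
    (hm : ∀ (m : ℕ) (ε : ℝ), 0 < m → 0 < ε → w (m * ε) ≤ m ^ k * w ε) {c s : ℝ} (hs : 0 < s)
    (hc : c * s ^ k < w s) : ∃ r, 0 < r ∧ r ≤ 1 ∧ ∀ ε ∈ Set.Ioo 0 r, c * ε ^ k ≤ w ε := by
  have h1 : Tendsto (fun ε : ℝ => c * (s + ε) ^ k) (𝓝 0) (𝓝 (c * (s + 0) ^ k)) :=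
    Continuous.tendsto (by fun_prop) 0
  rw [add_zero] at h1
  obtain ⟨r, hr, hr2⟩ := Metric.eventually_nhds_iff.1 (h1.eventually_lt_const hc)
  refine ⟨min r 1, by positivity, min_le_right _ _, fun ε hε => ?_⟩
  have hε0 : 0 < ε := hε.1
  have h2 : c * (s + ε) ^ k < w s := hr2 (by
    rw [Real.dist_eq, sub_zero, abs_of_pos hε0]
    exact hε.2.trans_le (min_le_left _ _))
  -- This is the least m with s ≤ mε, so mε overshoots s by at most ε, which the strict inequality
  -- at s absorbs once ε < r.
  set m := ⌈s / ε⌉₊ with hmdef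
  have hm0 : 0 < m := Nat.ceil_pos.2 (by positivity)
  have hm1 : s ≤ m * ε := (div_le_iff₀ hε0).1 (Nat.le_ceil _)
  have hm2 : m * ε ≤ s + ε := by
    have := (Nat.ceil_lt_add_one (show 0 ≤ s / ε by positivity)).le
    calc m * ε ≤ (s / ε + 1) * ε := by gcongr
      _ = s + ε := by field_simp
  have h3 : w s ≤ m ^ k * w ε := (hw hs (hs.trans_le hm1) hm1).trans (hm m ε hm0 hε0)
  rcases le_or_gt c 0 with hc0 | hc0
  · exact (mul_nonpos_of_nonpos_of_nonneg hc0 (by positivity)).trans (h0 ε hε0)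
  have h4 : (m : ℝ) ^ k * (c * ε ^ k) ≤ m ^ k * w ε := by
    calc (m : ℝ) ^ k * (c * ε ^ k) = c * (m * ε) ^ k := by rw [mul_pow]; ring
      _ ≤ c * (s + ε) ^ k := by gcongr
      _ ≤ _ := h2.le.trans h3
  exact le_of_mul_le_mul_left h4 (by positivity)

end QuantumTorus

end

namespace QuantumTorus
variable {d : ℕ}

/-! ### The limit as a supremum, and the comparison with the Sobolev seminorm -/

lemma ncLpNorm_difference_pow_le_modulus (θ : Matrix (Fin d) (Fin d) ℝ) (k : ℕ) (p : ℝ≥0∞)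
    (x : Functional d) {u : EuclideanSpace ℝ (Fin d)} (hu : 0 < ‖u‖) :
    ncLpNorm θ p ((difference u ^ k) x) ≤ modulus θ k p x ‖u‖ :=
  le_iSup₂_of_le u ⟨hu, le_rfl⟩ le_rfl

/-- The supremum `L` of `ω(ε) / ε^k` over `0 < ε ≤ 1` is finite, and it is the limit for `ε → 0`. -/
lemma exists_modulus_bounds {θ : Matrix (Fin d) (Fin d) ℝ} {k : ℕ} {p : ℝ≥0∞} (hp : 1 ≤ p)
    {x : Functional d} (hx : MemNCLp θ p x) {A : ℝ} (hA : 0 ≤ A)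
    (h : ∀ u, ncLpNorm θ p ((difference u ^ k) x) ≤ ENNReal.ofReal (A * ‖u‖ ^ k)) :
    ∃ L : ℝ, 0 ≤ L ∧ L ≤ A ∧
      (∀ ε ∈ Set.Ioc (0 : ℝ) 1, modulus θ k p x ε ≤ ENNReal.ofReal (L * ε ^ k)) ∧
      ∀ c < L, ∃ r, 0 < r ∧ r ≤ 1 ∧
        ∀ ε ∈ Set.Ioo (0 : ℝ) r, ENNReal.ofReal (c * ε ^ k) ≤ modulus θ k p x ε := by
  set w : ℝ → ℝ := fun ε => (modulus θ k p x ε).toReal with hwdef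
  have hmod : ∀ ε, modulus θ k p x ε ≤ ENNReal.ofReal (A * ε ^ k) := fun ε =>
    iSup₂_le fun u hu => (h u).trans (ENNReal.ofReal_le_ofReal (by
      have := hu.2
      gcongr))
  have hfin : ∀ ε, modulus θ k p x ε ≠ ∞ := fun ε =>
    ne_top_of_le_ne_top ENNReal.ofReal_ne_top (hmod ε)
  have hwA : ∀ ε, 0 < ε → w ε ≤ A * ε ^ k := fun ε hε =>
    ENNReal.toReal_le_of_le_ofReal (by positivity) (hmod ε)
  set g : ℝ → ℝ := fun ε => w ε / ε ^ k with hg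
  have hbdd : A ∈ upperBounds (g '' Set.Ioc 0 1) := by
    rintro _ ⟨ε, hε, rfl⟩
    exact (div_le_iff₀ (pow_pos hε.1 k)).2 (hwA ε hε.1)
  have hne : (g '' Set.Ioc 0 1).Nonempty := ⟨_, 1, by simp, rfl⟩
  refine ⟨sSup (g '' Set.Ioc 0 1), ?_, csSup_le hne hbdd, fun ε hε => ?_, fun c hc => ?_⟩
  · exact (by positivity : 0 ≤ g 1).trans (le_csSup ⟨A, hbdd⟩ ⟨1, by simp, rfl⟩)
  · rw [← ENNReal.ofReal_toReal (hfin ε)]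
    refine ENNReal.ofReal_le_ofReal ?_
    rw [← div_le_iff₀ (pow_pos hε.1 k)]
    exact le_csSup ⟨A, hbdd⟩ ⟨ε, hε, rfl⟩
  · obtain ⟨_, ⟨s, hs, rfl⟩, hcs⟩ := exists_lt_of_lt_csSup hne hc
    obtain ⟨r, hr, hr1, hr2⟩ := exists_forall_lt_of_mono_of_nat_mul_le (w := w) (k := k)
      (fun a _ b _ hab => ENNReal.toReal_mono (hfin b) (modulus_mono θ k p x hab))
      (fun ε _ => ENNReal.toReal_nonneg) (fun m ε hm _ => by
        have := ENNReal.toReal_mono (ENNReal.mul_ne_top (by finiteness) (hfin ε))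
          (modulus_nat_mul_le hp hx k hm ε)
        simpa using this) hs.1 ((lt_div_iff₀ (pow_pos hs.1 k)).1 hcs)
    exact ⟨r, hr, hr1, fun ε hε => ENNReal.ofReal_le_of_le_toReal (hr2 ε hε)⟩

lemma tendsto_besovNorm {θ : Matrix (Fin d) (Fin d) ℝ} {k : ℕ} {p : ℝ≥0∞} {q L : ℝ}
    {x : Functional d} (hq : 0 < q) (hL : 0 ≤ L)
    (h1 : ∀ ε ∈ Set.Ioc (0 : ℝ) 1, modulus θ k p x ε ≤ ENNReal.ofReal (L * ε ^ k))
    (h2 : ∀ c < L, ∃ r, 0 < r ∧ r ≤ 1 ∧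
      ∀ ε ∈ Set.Ioo (0 : ℝ) r, ENNReal.ofReal (c * ε ^ k) ≤ modulus θ k p x ε) :
    Tendsto (fun α : ℝ => ENNReal.ofReal (((k : ℝ) - α) ^ (1 / q)) * besovNorm θ k p q α x)
      (𝓝[<] (k : ℝ)) (𝓝 (ENNReal.ofReal (L * q ^ (-(1 / q))))) := by
  have hQ : 0 < q ^ (-(1 / q)) := Real.rpow_pos_of_pos hq _
  have hcancel : ∀ {α : ℝ}, α < k → ∀ {b : ℝ}, ENNReal.ofReal (((k : ℝ) - α) ^ (1 / q)) *
      ENNReal.ofReal (b * (q ^ (-(1 / q)) * ((k - α) ^ (1 / q))⁻¹))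
        = ENNReal.ofReal (b * q ^ (-(1 / q))) := by
    intro α hα b
    have hk : 0 < ((k : ℝ) - α) ^ (1 / q) := Real.rpow_pos_of_pos (sub_pos.2 hα) _
    rw [← ENNReal.ofReal_mul hk.le]
    congr 1
    field_simp
  refine tendsto_order.2 ⟨fun a ha => ?_, fun a ha => ?_⟩
  · have ha' : a ≠ ∞ := ha.ne_top
    have ha2 : a.toReal < L * q ^ (-(1 / q)) :=
      (ENNReal.lt_ofReal_iff_toReal_lt ha').1 ha
    -- A constant c < L with a < c q^{-1/q} leaves room for the factor r^{k-α}, which is close to 1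
    -- when α is close to k.
    obtain ⟨c, hc1, hc2⟩ := exists_between ((div_lt_iff₀ hQ).2 ha2)
    have hc0 : 0 ≤ c := (div_nonneg ENNReal.toReal_nonneg hQ.le).trans hc1.le
    rw [div_lt_iff₀ hQ] at hc1
    obtain ⟨r, hr, hr1, hr2⟩ := h2 c hc2
    have h3 : Tendsto (fun α : ℝ => c * r ^ ((k : ℝ) - α) * q ^ (-(1 / q))) (𝓝[<] (k : ℝ))
        (𝓝 (c * r ^ ((k : ℝ) - k) * q ^ (-(1 / q)))) := by
      have : Continuous fun α : ℝ => r ^ ((k : ℝ) - α) :=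
        (Real.continuous_const_rpow hr.ne').comp (by fun_prop)
      exact (Continuous.tendsto (by fun_prop) _).mono_left nhdsWithin_le_nhds
    rw [sub_self, Real.rpow_zero, mul_one] at h3
    filter_upwards [h3.eventually_const_lt hc1, self_mem_nhdsWithin] with α h4 hα
    refine ((ENNReal.lt_ofReal_iff_toReal_lt ha').2 h4).trans_le ?_
    rw [← hcancel hα]
    gcongr
    exact le_besovNorm hq hα hc0 hr.le hr1 hr2
  · filter_upwards [self_mem_nhdsWithin] with α hα
    refine lt_of_le_of_lt ?_ ha
    rw [← hcancel hα]
    gcongr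
    exact besovNorm_le hq hα hL fun ε hε => h1 ε ⟨hε.1, hε.2.le⟩

/-- Adding 1 to the number of multi-indices ensures N ≥ 1, so that N^{1/p} ≤ N and a single constant
serves all p, including p = ∞. -/
lemma sobolevSeminorm_le {θ : Matrix (Fin d) (Fin d) ℝ} {k : ℕ} {p : ℝ≥0∞} (hp : 1 ≤ p)
    {x : Functional d} {M : ℝ≥0∞}
    (h : ∀ m ∈ Finset.piAntidiag Finset.univ k, ncLpNorm θ p (distDerivMulti m x) ≤ M) :
    sobolevSeminorm θ k p x
      ≤ ((Finset.piAntidiag (Finset.univ : Finset (Fin d)) k).card + 1 : ℕ) * M := by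
  set N := (Finset.piAntidiag (Finset.univ : Finset (Fin d)) k).card + 1 with hN
  have hN1 : (1 : ℝ≥0∞) ≤ N := by exact_mod_cast Nat.le_add_left 1 _
  unfold sobolevSeminorm
  split_ifs with hpt
  · exact (Finset.sup_le h).trans (le_mul_of_one_le_left zero_le hN1)
  · have hp0 : 1 ≤ p.toReal := by
      simpa using ENNReal.toReal_mono hpt hp
    have hp1 : 0 < p.toReal := one_pos.trans_le hp0
    have h1 : ∑ m ∈ Finset.piAntidiag (Finset.univ : Finset (Fin d)) k,
        ncLpNorm θ p (distDerivMulti m x) ^ p.toReal ≤ N * M ^ p.toReal := by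
      refine (Finset.sum_le_card_nsmul _ _ (M ^ p.toReal) fun m hm =>
        ENNReal.rpow_le_rpow (h m hm) hp1.le).trans ?_
      rw [nsmul_eq_mul]
      gcongr
      exact Nat.le_add_right _ _
    refine (ENNReal.rpow_le_rpow h1 (by positivity)).trans ?_
    rw [ENNReal.mul_rpow_of_nonneg _ _ (by positivity), ← ENNReal.rpow_mul,
      mul_one_div_cancel hp1.ne', ENNReal.rpow_one]
    gcongr
    refine (ENNReal.rpow_le_rpow_of_exponent_le hN1 ?_).trans_eq (ENNReal.rpow_one _)
    exact (div_le_one hp1).2 hp0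

lemma ncLpNorm_le_sobolevSeminorm {θ : Matrix (Fin d) (Fin d) ℝ} {k : ℕ} {p : ℝ≥0∞} (hp : 1 ≤ p)
    (x : Functional d) {m : Fin d → ℕ} (hm : m ∈ Finset.piAntidiag Finset.univ k) :
    ncLpNorm θ p (distDerivMulti m x) ≤ sobolevSeminorm θ k p x := by
  unfold sobolevSeminorm
  split_ifs with hpt
  · exact Finset.le_sup (f := fun m => ncLpNorm θ p (distDerivMulti m x)) hm
  · have hp1 : 0 < p.toReal := ENNReal.toReal_pos (one_pos.trans_le hp).ne' hpt
    rw [one_div, ENNReal.le_rpow_inv_iff hp1]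
    exact Finset.single_le_sum (f := fun m => ncLpNorm θ p (distDerivMulti m x) ^ p.toReal)
      (fun _ _ => zero_le) hm

lemma MemSobolev.sobolevSeminorm_ne_top {θ : Matrix (Fin d) (Fin d) ℝ} {k : ℕ} {p : ℝ≥0∞}
    (hp : 1 ≤ p) {x : Functional d} (hx : MemSobolev θ k p x) : sobolevSeminorm θ k p x ≠ ∞ := by
  have h1 : ∑ m ∈ Finset.piAntidiag (Finset.univ : Finset (Fin d)) k,
      ncLpNorm θ p (distDerivMulti m x) ≠ ∞ :=
    ENNReal.sum_ne_top.2 fun m hm => (hx.memNCLp_distDerivMulti hm).ncLpNorm_ne_top hp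
  exact ne_top_of_le_ne_top (ENNReal.mul_ne_top (by finiteness) h1) (sobolevSeminorm_le hp
    fun m hm => Finset.single_le_sum (f := fun m => ncLpNorm θ p (distDerivMulti m x))
      (fun _ _ => zero_le) hm)

end QuantumTorus

end

theorem mainTheorem9 (d k : ℕ) (hd : 2 ≤ d) (hk : 1 ≤ k) :
    ∃ c C : NNReal, 0 < c ∧ 0 < C ∧
      ∀ θ : Matrix (Fin d) (Fin d) ℝ, θ.transpose = -θ →
      ∀ (p : ENNReal) (q : ℝ), 1 ≤ p → 1 ≤ q →
      ∀ x : QuantumTorus.Functional d, QuantumTorus.MemSobolev θ k p x →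
        (∀ α : ℝ, 0 < α → α < k → QuantumTorus.besovNorm θ k p q α x < ⊤) ∧
        ∃ L : NNReal,
          Filter.Tendsto
            (fun α : ℝ => ENNReal.ofReal (((k : ℝ) - α) ^ (1 / q)) *
              QuantumTorus.besovNorm θ k p q α x)
            (nhdsWithin (k : ℝ) (Set.Iio (k : ℝ))) (nhds (L : ENNReal)) ∧
          (c : ENNReal) * (ENNReal.ofReal (q ^ (-(1 / q))) *
            QuantumTorus.sobolevSeminorm θ k p x) ≤ L ∧
          (L : ENNReal) ≤ C * (ENNReal.ofReal (q ^ (-(1 / q))) *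
            QuantumTorus.sobolevSeminorm θ k p x) := by
  set N : ℕ := (Finset.piAntidiag (Finset.univ : Finset (Fin d)) k).card + 1 with hN
  have hB : (0 : NNReal) < N * (2 ^ k * k ^ k) := by positivity
  -- The lower constant combines the polarization loss 2^k k^k for each derivative with the factor N
  -- from summing over multi-indices; the upper constant is the sum of the multinomial coefficients.
  refine ⟨(N * (2 ^ k * k ^ k))⁻¹, d ^ k, inv_pos.2 hB, by positivity,
    fun θ _ p q hp hq x hx => ?_⟩
  have hq0 : 0 < q := one_pos.trans_le hq
  have hS := hx.sobolevSeminorm_ne_top hp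
  set S := QuantumTorus.sobolevSeminorm θ k p x with hSdef
  -- Each ‖D^m x‖_p with |m|₁ = k is at most S, so the mean value bound holds with A = d^k S, and L
  -- ≤ A is already the upper estimate.
  obtain ⟨L, hL0, hLA, hL1, hL2⟩ := QuantumTorus.exists_modulus_bounds hp hx.memNCLp_self
    (by positivity) (hx.ncLpNorm_difference_pow_le hp ENNReal.toReal_nonneg fun m hm => by
      rw [ENNReal.ofReal_toReal hS]
      exact QuantumTorus.ncLpNorm_le_sobolevSeminorm hp x hm)
  have hQ : 0 ≤ q ^ (-(1 / q)) := Real.rpow_nonneg hq0.le _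
  refine ⟨fun α _ hα => (QuantumTorus.besovNorm_le hq0 hα hL0
    fun ε hε => hL1 ε ⟨hε.1, hε.2.le⟩).trans_lt ENNReal.ofReal_lt_top,
    (L * q ^ (-(1 / q))).toNNReal, QuantumTorus.tendsto_besovNorm hq0 hL0 hL1 hL2, ?_, ?_⟩
  · have h1 : S ≤ N * ENNReal.ofReal (2 ^ k * k ^ k * L) :=
      QuantumTorus.sobolevSeminorm_le hp fun m hm =>
        hx.ncLpNorm_distDerivMulti_le hk hp hL0 (fun u hu hu1 =>
          (QuantumTorus.ncLpNorm_difference_pow_le_modulus θ k p x hu).trans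
            (hL1 ‖u‖ ⟨hu, hu1⟩)) hm
    calc (((N * (2 ^ k * k ^ k))⁻¹ : NNReal) : ENNReal) * (ENNReal.ofReal (q ^ (-(1 / q))) * S)
        ≤ (((N * (2 ^ k * k ^ k))⁻¹ : NNReal) : ENNReal) * (ENNReal.ofReal (q ^ (-(1 / q)))
          * (N * ENNReal.ofReal (2 ^ k * k ^ k * L))) := by gcongr
      _ = ENNReal.ofReal (L * q ^ (-(1 / q))) := by
        rw [← ENNReal.ofReal_coe_nnreal, ← ENNReal.ofReal_natCast N,
          ← ENNReal.ofReal_mul (Nat.cast_nonneg N), ← ENNReal.ofReal_mul hQ,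
          ← ENNReal.ofReal_mul (NNReal.coe_nonneg _)]
        congr 1
        have hN0 : (N : ℝ) ≠ 0 := Nat.cast_ne_zero.2 (by omega)
        have hk0 : (k : ℝ) ≠ 0 := by exact_mod_cast (Nat.one_le_iff_ne_zero.1 hk)
        push_cast
        field_simp
  · calc ENNReal.ofReal (L * q ^ (-(1 / q)))
        ≤ ENNReal.ofReal (d ^ k * S.toReal * q ^ (-(1 / q))) := by gcongr
      _ = ((d ^ k : NNReal) : ENNReal) * (ENNReal.ofReal (q ^ (-(1 / q))) * S) := by
        rw [ENNReal.ofReal_mul (by positivity), ENNReal.ofReal_mul (by positivity),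
          ENNReal.ofReal_toReal hS, ENNReal.ofReal_pow (Nat.cast_nonneg d), ENNReal.ofReal_natCast]
        push_cast
        ring
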